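/- Let $k$ be a field of characteristic $0$, $\mathrm{pt}=\operatorname{Spec} k$, and $\Delta^\bullet$ the standard cosimplicial scheme with $\Delta^r=\operatorname{Spec} k[x_0,\dots,x_r]/(x_0+\dots+x_r-1)$. **Definitions.** Let $\tau_{n,n+N}$ be the total space of the tautological rank $n$ bundle on the Grassmannian of rank $n$ quotients of $\mathcal O^{n+N}$: a morphism $W\to\tau_{n,n+N}$ is an epimorphism $\mathcal O_W^{n+N}\twoheadrightarrow E$ onto a locally free sheaf of rank $n$ (up to isomorphism) together with a section $s$ of $E$. For a $k$-scheme $X$ and a presheaf $Y$, an *explicit cobordism-framed correspondence* of level $(n,n+N)$ from $X$ to $Y$ is a tuple $(Z,W,\phi,g)$: $Z\subseteq\mathbb A^n_X$ is a closed subset finite over $X$, $W\to\mathbb A^n_X$ is an étale neighbourhood of $Z$, $\phi\colon W\to\tau_{n,n+N}$ is a morphism such that $Z\subseteq W$ is (as a set) the preimage of the zero section, and $g\in Y(W)$. Two of them are equivalent if they have the same $Z$ and agree on a common refinement of the neighbourhoods. Stable correspondences are the colimit over $n$ and $N$ along the maps that, respectively, replace $Z,W,(\mathcal O^{n+N}\twoheadrightarrow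 E,s),g$ by $\{0\}\times Z$, $\mathbb A^1\times W$, $(\mathcal O\oplus\mathcal O^{n+N}\twoheadrightarrow\mathcal O\oplus E,(x,s))$, $g\circ \mathrm{pr}_W$ with $x$ the coordinate on $\mathbb A^1$, or extend the epimorphism by zero on a new last coordinate. $\mathbb ZF^{\mathrm{cob}}(X,Y)$ is the abelian group generated by the stable correspondences with relations $[c]+[c']=[c\amalg c']$ for $c,c'$ of the same finite level with disjoint supports. $\mathbb ZF^{\mathrm{cob}}(X,\mathbb G_m^{\wedge m})$ is the direct summand of $\mathbb ZF^{\mathrm{cob}}(X,\mathbb G_m^{m})$ that is the image of the idempotent $\prod_{i=1}^m(1-e_i)$, where $e_i$ replaces the $i$-th coordinate by $1$, and $C_*\mathbb ZF^{\mathrm{cob}}(\mathrm{pt},\mathbb G_m^{\wedge m})$ is the complex of the simplicial abelian group $r\mapsto \mathbb ZF^{\mathrm{cob}}(\Delta^r,\mathbb G_m^{\wedge m})$. The external product of $c=(Z,W,\phi,g)$ and $c'=(Z',W',\phi',g')$ of levels $(n,n+N)$ and $(n',n'+N')$ is $(Z\times Z',W\times W',\phi'',g\times g')$ where $\phi''$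 is the direct sum $(E\oplus E',(s,s'))$ with the epimorphism $\mathcal O^{(n+n')+(N+N')}\simeq\mathcal O^{n+N}\oplus\mathcal O^{n'+N'}\twoheadrightarrow E\oplus E'$ obtained by the evident rearrangement of the summands $\mathcal O^n,\mathcal O^{n'},\mathcal O^N,\mathcal O^{N'}$. Finally $K^M_*(k)$ is the quotient of the tensor algebra over $\mathbb Z$ of the abelian group $k^\times$ by the two-sided ideal generated by $a\otimes b$ with $a,b\in k^\times$, $a+b=1$; $K^M_m(k)$ is its degree $m$ part, and $\{g_1,\dots,g_m\}$ is the class of $g_1\otimes\dots\otimes g_m$. **Proposition.** The external product induces on $$\bigoplus_{m\ge0} H^0\big(C_*\mathbb ZF^{\mathrm{cob}}(\mathrm{pt},\mathbb G_m^{\wedge m})\big)$$ the structure of a graded ring whose unit is the class of the identity map $\mathrm{pt}\to\mathrm{pt}=\mathbb G_m^0$. For every $m\ge 0$ there is a well-defined homomorphism of abelian groups $$\sigma_m\colon K^M_m(k)\to H^0\big(C_*\mathbb ZF^{\mathrm{cob}}(\mathrm{pt},\mathbb G_m^{\wedge m})\big)$$ which takes each symbol $\{g_1,\dots,g_m\}$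 to the class of the level $0$ correspondence given by the map $\mathrm{pt}\to\mathbb G_m^m$ with coordinates $(g_1,\dots,g_m)$. Together the $\sigma_m$ form a homomorphism of graded rings $$\bigoplus_m\sigma_m\colon \bigoplus_{m\ge0} K^M_m(k)\to\bigoplus_{m\ge0} H^0\big(C_*\mathbb ZF^{\mathrm{cob}}(\mathrm{pt},\mathbb G_m^{\wedge m})\big).$$ -/

import Mathlib

universe u
open CategoryTheory Limits AlgebraicGeometry Opposite TopologicalSpace

noncomputable section
namespace CobFr

/-- The closed immersion of a closed subset with its reduced induced scheme structure. -/
abbrev redι {A : Scheme.{u}} (Z : Closeds A) :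
    (Scheme.IdealSheafData.vanishingIdeal Z).subscheme ⟶ A :=
  (Scheme.IdealSheafData.vanishingIdeal Z).subschemeι

lemma isIso_pullback_snd_iff {W A T : Scheme.{u}} (e : W ⟶ A) (t : T ⟶ A) :
    IsIso (pullback.snd e t) ↔ ∀ (U : Scheme.{u}) (r : U ⟶ T), ∃! v : U ⟶ W, v ≫ e = r ≫ t := by
  constructor
  · intro h U r
    refine ⟨r ≫ inv (pullback.snd e t) ≫ pullback.fst e t, ?_, ?_⟩
    · simp [pullback.condition]
    · intro v hv
      have : pullback.lift v r hv = r ≫ inv (pullback.snd e t) := by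
        rw [← cancel_mono (pullback.snd e t)]; simp [pullback.lift_snd]
      rw [← Category.assoc, ← this, pullback.lift_fst]
  · intro h
    obtain ⟨v, hv, -⟩ := h T (𝟙 T)
    refine ⟨pullback.lift v (𝟙 T) hv, ?_, pullback.lift_snd _ _ _⟩
    apply pullback.hom_ext
    · refine (h _ (pullback.snd e t)).unique ?_ ?_
      · simp [pullback.lift_fst, hv]
      · simp [pullback.condition]
    · simp [pullback.lift_snd]

lemma exists_lift_redι {T A : Scheme.{u}} (j : T ⟶ A) [IsClosedImmersion j] (Z : Closeds A)
    (hZ : (Z : Set A) ⊆ Set.range j) :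
    ∃ h : (Scheme.IdealSheafData.vanishingIdeal Z).subscheme ⟶ T, h ≫ j = redι Z := by
  refine ⟨IsClosedImmersion.lift j (redι Z) ?_, IsClosedImmersion.lift_fac _ _ _⟩
  rw [Scheme.IdealSheafData.ker_subschemeι, ← Scheme.IdealSheafData.le_support_iff_le_vanishingIdeal]
  intro x hx
  have := Scheme.Hom.support_ker j
  rw [← SetLike.mem_coe, this]
  exact subset_closure (hZ hx)

/-- `e : W ⟶ A` is an étale neighbourhood of the closed subset `Z` of `A`: it is étale and
`W ×_A Z ⟶ Z` is an isomorphism. -/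
structure IsEtaleNhd {A W : Scheme.{u}} (Z : Closeds A) (e : W ⟶ A) : Prop where
  etale : Etale e
  isIso : IsIso (pullback.snd e (redι Z))

lemma IsEtaleNhd.of_closedImmersion {A W T : Scheme.{u}} {Z : Closeds A} {e : W ⟶ A} (he : Etale e)
    (j : T ⟶ A) [IsClosedImmersion j] (hZ : (Z : Set A) ⊆ Set.range j)
    (h : ∀ (U : Scheme.{u}) (r : U ⟶ T), ∃! v : U ⟶ W, v ≫ e = r ≫ j) : IsEtaleNhd Z e := by
  obtain ⟨i, hi⟩ := exists_lift_redι j Z hZ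
  refine ⟨he, (isIso_pullback_snd_iff _ _).2 fun U r => ?_⟩
  simpa [← hi] using h U (r ≫ i)

lemma isFinite_of_closedImmersion {A X T : Scheme.{u}} (Z : Closeds A) (p : A ⟶ X)
    (j : T ⟶ A) [IsClosedImmersion j] (hZ : (Z : Set A) ⊆ Set.range j) (h : IsFinite (j ≫ p)) :
    IsFinite (redι Z ≫ p) := by
  obtain ⟨i, hi⟩ := exists_lift_redι j Z hZ
  have : IsClosedImmersion (i ≫ j) := by rw [hi]; infer_instance
  have : IsClosedImmersion i := IsClosedImmersion.of_comp i j
  rw [← hi, Category.assoc]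
  infer_instance

lemma range_redι {A : Scheme.{u}} (Z : Closeds A) : Set.range (redι Z) = Z := by
  simp

lemma IsEtaleNhd.baseChange {A A' W W' : Scheme.{u}} {Z : Closeds A} {e : W ⟶ A}
    (h : IsEtaleNhd Z e) {q : W' ⟶ W} {e' : W' ⟶ A'} {f : A' ⟶ A} (sq : IsPullback q e' e f)
    (Z' : Closeds A') (hZ' : ∀ x, x ∈ Z' → f x ∈ Z) : IsEtaleNhd Z' e' := by
  have := h.etale
  refine IsEtaleNhd.of_closedImmersion (MorphismProperty.of_isPullback sq h.etale)
    (pullback.snd (redι Z) f) ?_ fun U r => ?_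
  · rw [Scheme.Pullback.range_snd, range_redι]
    exact fun x hx => hZ' x hx
  · obtain ⟨v, hv, hv'⟩ := (isIso_pullback_snd_iff _ _).1 h.isIso U (r ≫ pullback.fst _ _)
    refine ⟨sq.lift v (r ≫ pullback.snd _ _) ?_, sq.lift_snd _ _ _, ?_⟩
    · rw [hv, Category.assoc, Category.assoc, pullback.condition]
    · intro w hw
      apply sq.hom_ext
      · simp only [IsPullback.lift_fst]
        refine hv' _ ?_
        simp only [Category.assoc, pullback.condition]
        rw [sq.w, reassoc_of% hw]
      · simpa using hw

lemma IsEtaleNhd.prod {A₁ A₂ A X W₁ W₂ W : Scheme.{u}} {p₁ : A₁ ⟶ X} {p₂ : A₂ ⟶ X}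
    {a₁ : A ⟶ A₁} {a₂ : A ⟶ A₂} (sq : IsPullback a₁ a₂ p₁ p₂)
    {Z₁ : Closeds A₁} {Z₂ : Closeds A₂} {e₁ : W₁ ⟶ A₁} {e₂ : W₂ ⟶ A₂}
    (h₁ : IsEtaleNhd Z₁ e₁) (h₂ : IsEtaleNhd Z₂ e₂) {w₁ : W ⟶ W₁} {w₂ : W ⟶ W₂}
    (sqW : IsPullback w₁ w₂ (e₁ ≫ p₁) (e₂ ≫ p₂)) (e : W ⟶ A)
    (he₁ : e ≫ a₁ = w₁ ≫ e₁) (he₂ : e ≫ a₂ = w₂ ≫ e₂)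
    (Z : Closeds A) (hZ : ∀ x, x ∈ Z → a₁ x ∈ Z₁ ∧ a₂ x ∈ Z₂) : IsEtaleNhd Z e := by
  have := h₁.etale
  have := h₂.etale
  have het : Etale e := by
    have : MorphismProperty.IsStableUnderComposition @Etale.{u} :=
      MorphismProperty.IsMultiplicative.toIsStableUnderComposition
    have h := MorphismProperty.pullbackMap (P := @Etale) (f := e₁ ≫ p₁) (g := e₂ ≫ p₂)
      (f' := p₁) (g' := p₂) h₁.etale h₂.etale rfl rfl
    have : e = sqW.isoPullback.hom ≫ pullback.map _ _ _ _ e₁ e₂ (𝟙 _) (by simp) (by simp) ≫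
        sq.isoPullback.inv := by
      apply sq.hom_ext <;> simp [he₁, he₂, pullback.map, pullback.lift_fst, pullback.lift_snd]
    rw [this]
    infer_instance
  refine IsEtaleNhd.of_closedImmersion het
    (pullback.fst (pullback.snd (redι Z₁) a₁) (pullback.snd (redι Z₂) a₂) ≫ pullback.snd (redι Z₁) a₁)
    ?_ fun U r => ?_
  · intro x hx
    have h1 : x ∈ Set.range (pullback.snd (redι Z₁) a₁) := by
      rw [Scheme.Pullback.range_snd, range_redι]; exact (hZ x hx).1
    have h2 : x ∈ Set.range (pullback.snd (redι Z₂) a₂) := by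
      rw [Scheme.Pullback.range_snd, range_redι]; exact (hZ x hx).2
    rw [Scheme.Pullback.range_fst_comp]
    exact ⟨h1, h2⟩
  · obtain ⟨v, hv, hv'⟩ := (isIso_pullback_snd_iff _ _).1 h₁.isIso U
      (r ≫ pullback.fst _ _ ≫ pullback.fst _ _)
    obtain ⟨w, hw, hw'⟩ := (isIso_pullback_snd_iff _ _).1 h₂.isIso U
      (r ≫ pullback.snd _ _ ≫ pullback.fst _ _)
    have hv1 : v ≫ e₁ = r ≫ (pullback.fst _ _ ≫ pullback.snd _ _) ≫ a₁ := by
      rw [hv]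
      simp only [Category.assoc]
      rw [pullback.condition (f := redι Z₁) (g := a₁)]
    have hw1 : w ≫ e₂ = r ≫ (pullback.fst _ _ ≫ pullback.snd _ _) ≫ a₂ := by
      rw [pullback.condition (f := pullback.snd (redι Z₁) a₁), hw]
      simp only [Category.assoc]
      rw [pullback.condition (f := redι Z₂) (g := a₂)]
    refine ⟨sqW.lift v w ?_, ?_, ?_⟩
    · rw [reassoc_of% hv1, reassoc_of% hw1, sq.w]
    · apply sq.hom_ext
      · simp [he₁, hv1]
      · simp [he₂, hw1]
    · intro y hy
      apply sqW.hom_ext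
      · rw [sqW.lift_fst]
        refine hv' _ ?_
        rw [hv] at hv1
        simp only [Category.assoc, ← he₁] at hv1 hy ⊢
        rw [reassoc_of% hy, hv1]
      · rw [sqW.lift_snd]
        refine hw' _ ?_
        rw [hw] at hw1
        simp only [Category.assoc, ← he₂] at hw1 hy ⊢
        rw [reassoc_of% hy, hw1]

lemma isFinite_pullback {A A' X X' : Scheme.{u}} {f' : A' ⟶ A} {p' : A' ⟶ X'} {p : A ⟶ X}
    {f : X' ⟶ X} (sq : IsPullback f' p' p f) (Z : Closeds A) (h : IsFinite (redι Z ≫ p))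
    (Z' : Closeds A') (hZ' : ∀ x, x ∈ Z' → f' x ∈ Z) : IsFinite (redι Z' ≫ p') := by
  refine isFinite_of_closedImmersion Z' p' (pullback.snd (redι Z) f') ?_ ?_
  · rw [Scheme.Pullback.range_snd, range_redι]
    exact fun x hx => hZ' x hx
  · have h2 := (IsPullback.of_hasPullback (redι Z) f').flip.paste_horiz sq.flip
    exact MorphismProperty.of_isPullback h2.flip h

lemma isFinite_prod {A₁ A₂ A X : Scheme.{u}} {p₁ : A₁ ⟶ X} {p₂ : A₂ ⟶ X}
    {a₁ : A ⟶ A₁} {a₂ : A ⟶ A₂} (sq : IsPullback a₁ a₂ p₁ p₂)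
    {Z₁ : Closeds A₁} {Z₂ : Closeds A₂} (h₁ : IsFinite (redι Z₁ ≫ p₁)) (h₂ : IsFinite (redι Z₂ ≫ p₂))
    (Z : Closeds A) (hZ : ∀ x, x ∈ Z → a₁ x ∈ Z₁ ∧ a₂ x ∈ Z₂) :
    IsFinite (redι Z ≫ a₁ ≫ p₁) := by
  refine isFinite_of_closedImmersion Z _
    (pullback.fst (pullback.snd (redι Z₁) a₁) (pullback.snd (redι Z₂) a₂) ≫ pullback.snd (redι Z₁) a₁)
    ?_ ?_
  · intro x hx
    have h1 : x ∈ Set.range (pullback.snd (redι Z₁) a₁) := by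
      rw [Scheme.Pullback.range_snd, range_redι]; exact (hZ x hx).1
    have h2 : x ∈ Set.range (pullback.snd (redι Z₂) a₂) := by
      rw [Scheme.Pullback.range_snd, range_redι]; exact (hZ x hx).2
    rw [Scheme.Pullback.range_fst_comp]
    exact ⟨h1, h2⟩
  · have s1 := (IsPullback.of_hasPullback (redι Z₁) a₁).flip.paste_horiz sq.flip
    have f1 : IsFinite (pullback.snd (redι Z₁) a₁ ≫ a₂) := MorphismProperty.of_isPullback s1.flip h₁
    have s2 := (IsPullback.of_hasPullback (redι Z₂) a₂)
    have s3 := (IsPullback.of_hasPullback (pullback.snd (redι Z₁) a₁) (pullback.snd (redι Z₂) a₂))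
    have s4 := s3.flip.paste_horiz s2
    have f2 : IsFinite (pullback.snd (pullback.snd (redι Z₁) a₁) (pullback.snd (redι Z₂) a₂) ≫
        pullback.fst (redι Z₂) a₂) := MorphismProperty.of_isPullback s4.flip f1
    have : (pullback.fst (pullback.snd (redι Z₁) a₁) (pullback.snd (redι Z₂) a₂) ≫
        pullback.snd (redι Z₁) a₁) ≫ a₁ ≫ p₁ =
        (pullback.snd (pullback.snd (redι Z₁) a₁) (pullback.snd (redι Z₂) a₂) ≫
        pullback.fst (redι Z₂) a₂) ≫ redι Z₂ ≫ p₂ := by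
      rw [sq.w, pullback.condition]
      simp only [Category.assoc]
      rw [← pullback.condition_assoc (f := redι Z₂)]
    rw [this]
    infer_instance

/-- An `R`-valued point of the total space of the tautological rank `n` bundle over the Grassmannian
of rank `n` quotients of the free module of rank `n + N`: a quotient `E` of `R ^ (n + N)` that is
locally free of rank `n` (`Module.Grassmannian` is the set of these), and an element `s` of `E`. -/
structure TauPoint (R : Type u) [CommRing R] (n N : ℕ) where
  quot : Module.Grassmannian R (Fin n ⊕ Fin N → R) n
  sec : (Fin n ⊕ Fin N → R) ⧸ quot.toSubmodule

/-- The pair `(E', s')` over `S` is the base change along `f : R ⟶ S` of the pair `(E, s)`: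
the kernel of `S ^ (n + N) ↠ E'` is generated by the kernel of `R ^ (n + N) ↠ E`, and
`s'` is the image of `s`. -/
def TauPoint.IsBaseChange {R S : Type u} [CommRing R] [CommRing S] {n N : ℕ} (f : R →+* S)
    (p : TauPoint R n N) (q : TauPoint S n N) : Prop :=
  q.quot.toSubmodule = Submodule.span S ((fun v => f ∘ v) '' p.quot.toSubmodule) ∧
    ∀ v : Fin n ⊕ Fin N → R, p.quot.toSubmodule.mkQ v = p.sec →
      q.quot.toSubmodule.mkQ (f ∘ v) = q.sec

/-- The point given by an epimorphism `q : R ^ (n + N) ↠ E` and `s : E`. -/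
def TauPoint.ofEpi {R : Type u} [CommRing R] {n N : ℕ} {E : Type u} [AddCommGroup E] [Module R E]
    [Module.Finite R E] [Module.Projective R E] (hE : ∀ p, Module.rankAtStalk (R := R) E p = n)
    (q : (Fin n ⊕ Fin N → R) →ₗ[R] E) (hq : Function.Surjective q) (s : E) : TauPoint R n N where
  quot :=
    { toSubmodule := LinearMap.ker q
      finite_quotient := Module.Finite.equiv (q.quotKerEquivOfSurjective hq).symm
      projective_quotient := Module.Projective.of_equiv (q.quotKerEquivOfSurjective hq).symm
      rankAtStalk_eq := fun p => by
        rw [Module.rankAtStalk_eq_of_equiv (q.quotKerEquivOfSurjective hq), hE] }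
  sec := (q.quotKerEquivOfSurjective hq).symm s

lemma TauPoint.mem_ofEpi {R : Type u} [CommRing R] {n N : ℕ} {E : Type u} [AddCommGroup E]
    [Module R E] [Module.Finite R E] [Module.Projective R E]
    (hE : ∀ p, Module.rankAtStalk (R := R) E p = n)
    (q : (Fin n ⊕ Fin N → R) →ₗ[R] E) (hq : Function.Surjective q) (s : E)
    (v : Fin n ⊕ Fin N → R) : v ∈ (ofEpi hE q hq s).quot.toSubmodule ↔ q v = 0 := Iff.rfl

lemma TauPoint.mkQ_eq_ofEpi_sec {R : Type u} [CommRing R] {n N : ℕ} {E : Type u} [AddCommGroup E]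
    [Module R E] [Module.Finite R E] [Module.Projective R E]
    (hE : ∀ p, Module.rankAtStalk (R := R) E p = n)
    (q : (Fin n ⊕ Fin N → R) →ₗ[R] E) (hq : Function.Surjective q) (s : E)
    (v : Fin n ⊕ Fin N → R) :
    (ofEpi hE q hq s).quot.toSubmodule.mkQ v = (ofEpi hE q hq s).sec ↔ q v = s := by
  change Submodule.Quotient.mk v = (q.quotKerEquivOfSurjective hq).symm s ↔ _
  rw [LinearEquiv.eq_symm_apply]
  rfl

lemma TauPoint.ofEpi_sec_eq_zero {R : Type u} [CommRing R] {n N : ℕ} {E : Type u} [AddCommGroup E]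
    [Module R E] [Module.Finite R E] [Module.Projective R E]
    (hE : ∀ p, Module.rankAtStalk (R := R) E p = n)
    (q : (Fin n ⊕ Fin N → R) →ₗ[R] E) (hq : Function.Surjective q) (s : E) :
    (ofEpi hE q hq s).sec = 0 ↔ s = 0 := by
  change (q.quotKerEquivOfSurjective hq).symm s = 0 ↔ _
  simp

/-- The rearrangement of direct summands
`(O ^ n ⊕ O ^ N) ⊕ (O ^ n' ⊕ O ^ N') ≃ O ^ (n + n') ⊕ O ^ (N + N')`, on indices. -/
def swapIndex (n N n' N' : ℕ) :
    (Fin n ⊕ Fin N) ⊕ (Fin n' ⊕ Fin N') ≃ Fin (n + n') ⊕ Fin (N + N') :=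
  (Equiv.sumSumSumComm (Fin n) (Fin N) (Fin n') (Fin N')).trans
    (Equiv.sumCongr finSumFinEquiv finSumFinEquiv)

/-- The direct sum `(E, s), (E', s') ↦ (E ⊕ E', (s, s'))`, where the epimorphism onto `E ⊕ E'` is
`R ^ ((n + n') + (N + N')) ≃ R ^ (n + N) ⊕ R ^ (n' + N') ↠ E ⊕ E'`. -/
def TauPoint.prod {R : Type u} [CommRing R] {n N n' N' : ℕ} (p : TauPoint R n N)
    (q : TauPoint R n' N') : TauPoint R (n + n') (N + N') :=
  ofEpi (E := ((Fin n ⊕ Fin N → R) ⧸ p.quot.toSubmodule) ×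
      ((Fin n' ⊕ Fin N' → R) ⧸ q.quot.toSubmodule))
    (fun x => by
      rw [Module.rankAtStalk_prod, Pi.add_apply, p.quot.rankAtStalk_eq, q.quot.rankAtStalk_eq])
    (LinearMap.prod
      (p.quot.toSubmodule.mkQ ∘ₗ LinearMap.funLeft R R (swapIndex n N n' N' ∘ Sum.inl))
      (q.quot.toSubmodule.mkQ ∘ₗ LinearMap.funLeft R R (swapIndex n N n' N' ∘ Sum.inr)))
    (by
      rintro ⟨a, b⟩
      obtain ⟨a, rfl⟩ := Submodule.mkQ_surjective _ a
      obtain ⟨b, rfl⟩ := Submodule.mkQ_surjective _ b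
      refine ⟨fun j => Sum.elim a b ((swapIndex n N n' N').symm j), ?_⟩
      refine Prod.ext ?_ ?_
      · simp only [LinearMap.prod_apply, Function.prod, LinearMap.comp_apply]
        congr 1; ext j; simp [LinearMap.funLeft_apply]
      · simp only [LinearMap.prod_apply, Function.prod, LinearMap.comp_apply]
        congr 1; ext j; simp [LinearMap.funLeft_apply])
    (p.sec, q.sec)

lemma TauPoint.mem_prod {R : Type u} [CommRing R] {n N n' N' : ℕ} (p : TauPoint R n N)
    (q : TauPoint R n' N') (v : Fin (n + n') ⊕ Fin (N + N') → R) :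
    v ∈ (p.prod q).quot.toSubmodule ↔
      (fun j => v (swapIndex n N n' N' (Sum.inl j))) ∈ p.quot.toSubmodule ∧
      (fun j => v (swapIndex n N n' N' (Sum.inr j))) ∈ q.quot.toSubmodule := by
  refine (TauPoint.mem_ofEpi _ _ _ _ _).trans ?_
  rw [Prod.ext_iff]
  refine and_congr ?_ ?_
  · exact Submodule.Quotient.mk_eq_zero _
  · exact Submodule.Quotient.mk_eq_zero _

lemma TauPoint.mkQ_eq_prod_sec {R : Type u} [CommRing R] {n N n' N' : ℕ} (p : TauPoint R n N)
    (q : TauPoint R n' N') (v : Fin (n + n') ⊕ Fin (N + N') → R) :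
    (p.prod q).quot.toSubmodule.mkQ v = (p.prod q).sec ↔
      p.quot.toSubmodule.mkQ (fun j => v (swapIndex n N n' N' (Sum.inl j))) = p.sec ∧
      q.quot.toSubmodule.mkQ (fun j => v (swapIndex n N n' N' (Sum.inr j))) = q.sec := by
  refine (TauPoint.mkQ_eq_ofEpi_sec _ _ _ _ _).trans ?_
  rw [Prod.ext_iff]
  rfl

lemma TauPoint.prod_sec_eq_zero {R : Type u} [CommRing R] {n N n' N' : ℕ} (p : TauPoint R n N)
    (q : TauPoint R n' N') : (p.prod q).sec = 0 ↔ p.sec = 0 ∧ q.sec = 0 :=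
  (TauPoint.ofEpi_sec_eq_zero _ _ _ _).trans Prod.mk_eq_zero

lemma TauPoint.IsBaseChange.prod {R S : Type u} [CommRing R] [CommRing S] {n N n' N' : ℕ}
    {f : R →+* S} {p : TauPoint R n N} {p' : TauPoint S n N} {q : TauPoint R n' N'}
    {q' : TauPoint S n' N'} (hp : p.IsBaseChange f p') (hq : q.IsBaseChange f q') :
    (p.prod q).IsBaseChange f (p'.prod q') := by
  refine ⟨le_antisymm ?_ (Submodule.span_le.2 ?_), fun v hv => ?_⟩
  · intro v hv
    rw [mem_prod] at hv
    let T := swapIndex n N n' N'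
    let il : (Fin n ⊕ Fin N → S) →ₗ[S] (Fin (n + n') ⊕ Fin (N + N') → S) :=
      { toFun := fun w j => Sum.elim w (0 : Fin n' ⊕ Fin N' → S) (T.symm j)
        map_add' := fun a b => by
          ext j
          obtain ⟨j, rfl⟩ := T.surjective j
          rcases j <;> simp
        map_smul' := fun a b => by
          ext j
          obtain ⟨j, rfl⟩ := T.surjective j
          rcases j <;> simp }
    let ir : (Fin n' ⊕ Fin N' → S) →ₗ[S] (Fin (n + n') ⊕ Fin (N + N') → S) :=
      { toFun := fun w j => Sum.elim (0 : Fin n ⊕ Fin N → S) w (T.symm j)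
        map_add' := fun a b => by
          ext j
          obtain ⟨j, rfl⟩ := T.surjective j
          rcases j <;> simp
        map_smul' := fun a b => by
          ext j
          obtain ⟨j, rfl⟩ := T.surjective j
          rcases j <;> simp }
    have hvs : v = il (fun j => v (T (Sum.inl j))) + ir (fun j => v (T (Sum.inr j))) := by
      ext j
      obtain ⟨j, rfl⟩ := T.surjective j
      rcases j with j | j <;> simp [il, ir]
    have h1 : p'.quot.toSubmodule ≤ (Submodule.span S
        ((fun v => f ∘ v) '' (p.prod q).quot.toSubmodule)).comap il := by
      rw [hp.1, Submodule.span_le]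
      rintro _ ⟨w, hw, rfl⟩
      refine Submodule.subset_span ⟨fun j => Sum.elim w (0 : Fin n' ⊕ Fin N' → R) (T.symm j), ?_, ?_⟩
      · rw [SetLike.mem_coe, mem_prod]
        constructor
        · simpa [T] using hw
        · convert Submodule.zero_mem _ using 1
          ext j
          simp [T]
      · ext j
        obtain ⟨j, rfl⟩ := T.surjective j
        rcases j with j | j <;> simp [il]
    have h2 : q'.quot.toSubmodule ≤ (Submodule.span S
        ((fun v => f ∘ v) '' (p.prod q).quot.toSubmodule)).comap ir := by
      rw [hq.1, Submodule.span_le]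
      rintro _ ⟨w, hw, rfl⟩
      refine Submodule.subset_span ⟨fun j => Sum.elim (0 : Fin n ⊕ Fin N → R) w (T.symm j), ?_, ?_⟩
      · rw [SetLike.mem_coe, mem_prod]
        constructor
        · convert Submodule.zero_mem _ using 1
          ext j
          simp [T]
        · simpa [T] using hw
      · ext j
        obtain ⟨j, rfl⟩ := T.surjective j
        rcases j with j | j <;> simp [ir]
    rw [hvs]
    exact Submodule.add_mem _ (h1 hv.1) (h2 hv.2)
  · rintro _ ⟨w, hw, rfl⟩
    rw [SetLike.mem_coe, mem_prod] at hw ⊢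
    rw [hp.1, hq.1]
    exact ⟨Submodule.subset_span ⟨_, hw.1, rfl⟩, Submodule.subset_span ⟨_, hw.2, rfl⟩⟩
  · rw [mkQ_eq_prod_sec] at hv ⊢
    exact ⟨hp.2 _ hv.1, hq.2 _ hv.2⟩

/-- A morphism from `W` to the total space `τ` of the tautological bundle, described on points with
values in rings, that is, as a morphism of functors on affine schemes. -/
structure TauMap (W : Scheme.{u}) (n N : ℕ) where
  pt : ∀ R : CommRingCat.{u}, (Spec R ⟶ W) → TauPoint R n N
  compat : ∀ {R S : CommRingCat.{u}} (f : R ⟶ S) (x : Spec R ⟶ W),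
    (pt R x).IsBaseChange f.hom (pt S (Spec.map f ≫ x))

@[ext] lemma TauMap.ext {W : Scheme.{u}} {n N : ℕ} {φ ψ : TauMap W n N}
    (h : ∀ R x, φ.pt R x = ψ.pt R x) : φ = ψ := by
  cases φ; cases ψ
  congr
  funext R x
  exact h R x

/-- The composite `W' ⟶ W ⟶ τ`. -/
def TauMap.comp {W W' : Scheme.{u}} {n N : ℕ} (φ : TauMap W n N) (h : W' ⟶ W) :
    TauMap W' n N where
  pt R x := φ.pt R (x ≫ h)
  compat f x := by simpa using φ.compat f (x ≫ h)

lemma TauMap.comp_comp {W W' W'' : Scheme.{u}} {n N : ℕ} (φ : TauMap W n N) (h : W' ⟶ W)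
    (h' : W'' ⟶ W') : (φ.comp h).comp h' = φ.comp (h' ≫ h) := by
  ext R x
  simp [comp]

lemma TauMap.comp_id {W : Scheme.{u}} {n N : ℕ} (φ : TauMap W n N) : φ.comp (𝟙 W) = φ := by
  ext R x
  simp [comp]

/-- The composite of `(φ, ψ) : W ⟶ τ × τ` with the direct sum morphism. -/
def TauMap.prod {W : Scheme.{u}} {n N n' N' : ℕ} (φ : TauMap W n N) (ψ : TauMap W n' N') :
    TauMap W (n + n') (N + N') where
  pt R x := (φ.pt R x).prod (ψ.pt R x)
  compat f x := (φ.compat f x).prod (ψ.compat f x)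

lemma TauMap.prod_comp {W W' : Scheme.{u}} {n N n' N' : ℕ} (φ : TauMap W n N)
    (ψ : TauMap W n' N') (h : W' ⟶ W) : (φ.prod ψ).comp h = (φ.comp h).prod (ψ.comp h) := rfl

/-- The value of a function `a` on `W` at an `R`-valued point `x` of `W`. -/
def evalAt {W : Scheme.{u}} {R : CommRingCat.{u}} (x : Spec R ⟶ W) (a : Γ(W, ⊤)) : R :=
  (Scheme.ΓSpecIso R).hom (x.appTop a)

lemma evalAt_map {W : Scheme.{u}} {R S : CommRingCat.{u}} (f : R ⟶ S) (x : Spec R ⟶ W)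
    (a : Γ(W, ⊤)) : evalAt (Spec.map f ≫ x) a = f (evalAt x a) := by
  have := congr($(Scheme.ΓSpecIso_naturality f) (x.appTop a))
  simp only [evalAt, Scheme.Hom.comp_appTop, ConcreteCategory.comp_apply]
  simpa only [ConcreteCategory.comp_apply] using this

lemma evalAt_comp {W W' : Scheme.{u}} {R : CommRingCat.{u}} (x : Spec R ⟶ W') (h : W' ⟶ W)
    (a : Γ(W, ⊤)) : evalAt (x ≫ h) a = evalAt x (h.appTop a) := by
  simp only [evalAt, Scheme.Hom.comp_appTop, ConcreteCategory.comp_apply]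

/-- The trivial line bundle as the quotient `O ^ (1 + 0) = O` of itself, with the section `a`. -/
def TauMap.ofSection {W : Scheme.{u}} (a : Γ(W, ⊤)) : TauMap W 1 0 where
  pt R x := TauPoint.ofEpi (E := Fin 1 → R)
    (fun p => by
      have := p.nontrivial
      rw [Module.rankAtStalk_eq_finrank_of_free]; simp)
    (LinearMap.funLeft R R Sum.inl)
    (LinearMap.funLeft_surjective_of_injective R R _ Sum.inl_injective)
    (fun _ => evalAt x a)
  compat {R S} f x := by
    refine ⟨le_antisymm ?_ (Submodule.span_le.2 ?_), fun v hv => ?_⟩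
    · intro v hv
      rw [TauPoint.mem_ofEpi] at hv
      have : v = 0 := by
        ext j
        rcases j with j | j
        · exact congrFun hv j
        · exact j.elim0
      rw [this]
      exact Submodule.zero_mem _
    · rintro _ ⟨w, hw, rfl⟩
      rw [SetLike.mem_coe, TauPoint.mem_ofEpi] at hw ⊢
      ext j
      have := congrFun hw j
      simp only [LinearMap.funLeft_apply, Function.comp_apply, Pi.zero_apply] at this ⊢
      rw [this, map_zero]
    · rw [TauPoint.mkQ_eq_ofEpi_sec] at hv ⊢
      ext j
      have := congrFun hv j
      simp only [LinearMap.funLeft_apply, Function.comp_apply] at this ⊢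
      rw [this, evalAt_map]

lemma TauMap.ofSection_sec_eq_zero {W : Scheme.{u}} (a : Γ(W, ⊤)) {R : CommRingCat.{u}}
    (x : Spec R ⟶ W) : ((ofSection a).pt R x).sec = 0 ↔ evalAt x a = 0 := by
  unfold ofSection
  rw [TauPoint.ofEpi_sec_eq_zero]
  exact ⟨fun h => congrFun h 0, fun h => funext fun _ => h⟩

lemma TauMap.ofSection_comp {W W' : Scheme.{u}} (a : Γ(W, ⊤)) (h : W' ⟶ W) :
    (ofSection a).comp h = ofSection (h.appTop a) := by
  ext R x
  simp only [ofSection, comp, evalAt_comp]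

/-- The zero bundle, as a quotient of `O ^ (0 + N)`. -/
def TauMap.zero (W : Scheme.{u}) (N : ℕ) : TauMap W 0 N where
  pt R x := TauPoint.ofEpi (E := Fin 0 → R)
    (fun p => by
      have := p.nontrivial
      rw [Module.rankAtStalk_eq_finrank_of_free]; simp)
    (0 : (Fin 0 ⊕ Fin N → R) →ₗ[R] (Fin 0 → R)) (Function.surjective_to_subsingleton _) 0
  compat {R S} f x := by
    refine ⟨le_antisymm ?_ (Submodule.span_le.2 ?_), fun v hv => ?_⟩
    · intro v _
      rw [pi_eq_sum_univ' v]
      refine Submodule.sum_mem _ fun i _ => Submodule.smul_mem _ _ (Submodule.subset_span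
        ⟨Pi.single i 1, ?_, ?_⟩)
      · rw [SetLike.mem_coe, TauPoint.mem_ofEpi]
        rfl
      · ext j
        simp only [Function.comp_apply, Pi.single_apply]
        split_ifs <;> simp
    · rintro _ ⟨w, hw, rfl⟩
      rw [SetLike.mem_coe, TauPoint.mem_ofEpi]
      rfl
    · rw [TauPoint.mkQ_eq_ofEpi_sec]
      rfl

lemma TauMap.zero_sec {W : Scheme.{u}} {N : ℕ} {R : CommRingCat.{u}} (x : Spec R ⟶ W) :
    ((zero W N).pt R x).sec = 0 := by
  unfold zero
  rw [TauPoint.ofEpi_sec_eq_zero]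

lemma TauMap.zero_comp {W W' : Scheme.{u}} (N : ℕ) (h : W' ⟶ W) :
    (zero W N).comp h = zero W' N := rfl

/-- Extension of an epimorphism `O ^ (n + N) ↠ E` by zero on a new last coordinate. -/
def TauMap.stab {W : Scheme.{u}} {n N : ℕ} (φ : TauMap W n N) : TauMap W n (N + 1) :=
  φ.prod (zero W 1)

lemma TauMap.stab_comp {W W' : Scheme.{u}} {n N : ℕ} (φ : TauMap W n N) (h : W' ⟶ W) :
    φ.stab.comp h = (φ.comp h).stab := rfl

lemma TauMap.stab_sec {W : Scheme.{u}} {n N : ℕ} (φ : TauMap W n N) {R : CommRingCat.{u}}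
    (x : Spec R ⟶ W) : (φ.stab.pt R x).sec = 0 ↔ (φ.pt R x).sec = 0 :=
  (TauPoint.prod_sec_eq_zero _ _).trans (and_iff_left (zero_sec x))

/-- The affine space `𝔸ⁿ_X`. -/
abbrev Aff (n : ℕ) (X : Scheme.{u}) : Scheme.{u} := AffineSpace (ULift.{u} (Fin n)) X

namespace Aff

/-- The projection `𝔸ⁿ_X ⟶ X`. -/
abbrev proj (n : ℕ) (X : Scheme.{u}) : Aff n X ⟶ X := Aff n X ↘ X

/-- The morphism `𝔸ⁿ_X' ⟶ 𝔸ⁿ_X` induced by `f : X' ⟶ X`. -/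
abbrev map (n : ℕ) {X X' : Scheme.{u}} (f : X' ⟶ X) : Aff n X' ⟶ Aff n X := AffineSpace.map _ f

lemma map_id (n : ℕ) (X : Scheme.{u}) : map n (𝟙 X) = 𝟙 (Aff n X) := AffineSpace.map_id X

lemma map_comp (n : ℕ) {X X' X'' : Scheme.{u}} (f : X ⟶ X') (g : X' ⟶ X'') :
    map n (f ≫ g) = map n f ≫ map n g := AffineSpace.map_comp f g

/-- The projection to the first `n` coordinates. -/
def left (n n' : ℕ) (X : Scheme.{u}) : Aff (n + n') X ⟶ Aff n X :=
  AffineSpace.reindex (fun i => ⟨Fin.castAdd n' i.down⟩) X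

/-- The projection to the last `n'` coordinates. -/
def right (n n' : ℕ) (X : Scheme.{u}) : Aff (n + n') X ⟶ Aff n' X :=
  AffineSpace.reindex (fun i => ⟨Fin.natAdd n i.down⟩) X

lemma left_proj (n n' : ℕ) (X : Scheme.{u}) : left n n' X ≫ proj n X = proj (n + n') X :=
  AffineSpace.reindex_over _ _

lemma right_proj (n n' : ℕ) (X : Scheme.{u}) : right n n' X ≫ proj n' X = proj (n + n') X :=
  AffineSpace.reindex_over _ _

lemma map_left (n n' : ℕ) {X X' : Scheme.{u}} (f : X' ⟶ X) :
    map (n + n') f ≫ left n n' X = left n n' X' ≫ map n f :=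
  AffineSpace.map_reindex _ _

lemma map_right (n n' : ℕ) {X X' : Scheme.{u}} (f : X' ⟶ X) :
    map (n + n') f ≫ right n n' X = right n n' X' ≫ map n' f :=
  AffineSpace.map_reindex _ _

/-- `𝔸ⁿ⁺ⁿ'_X = 𝔸ⁿ_X ×_X 𝔸ⁿ'_X`. -/
lemma isPullback (n n' : ℕ) (X : Scheme.{u}) :
    IsPullback (left n n' X) (right n n' X) (proj n X) (proj n' X) := by
  refine ⟨⟨by rw [left_proj, right_proj]⟩, ⟨PullbackCone.IsLimit.mk _
    (fun s => AffineSpace.homOfVector (s.fst ≫ proj n X) (fun i => Fin.addCases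
      (fun j => s.fst.appTop (AffineSpace.coord X ⟨j⟩))
      (fun j => s.snd.appTop (AffineSpace.coord X ⟨j⟩)) i.down)) ?_ ?_ ?_⟩⟩
  · intro s
    apply AffineSpace.hom_ext
    · rw [Category.assoc, left_proj, AffineSpace.homOfVector_over]
    · intro i
      rw [Scheme.Hom.comp_appTop, ConcreteCategory.comp_apply, left,
        AffineSpace.reindex_appTop_coord, AffineSpace.homOfVector_appTop_coord]
      simp
  · intro s
    apply AffineSpace.hom_ext
    · rw [Category.assoc, right_proj, AffineSpace.homOfVector_over, s.condition]
    · intro i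
      rw [Scheme.Hom.comp_appTop, ConcreteCategory.comp_apply, right,
        AffineSpace.reindex_appTop_coord, AffineSpace.homOfVector_appTop_coord]
      simp
  · intro s m h₁ h₂
    apply AffineSpace.hom_ext
    · rw [AffineSpace.homOfVector_over, ← h₁, Category.assoc, left_proj]
    · intro i
      obtain ⟨i⟩ := i
      rw [AffineSpace.homOfVector_appTop_coord]
      refine Fin.addCases (fun j => ?_) (fun j => ?_) i
      · rw [Fin.addCases_left, ← h₁, Scheme.Hom.comp_appTop, ConcreteCategory.comp_apply, left,
          AffineSpace.reindex_appTop_coord]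
      · rw [Fin.addCases_right, ← h₂, Scheme.Hom.comp_appTop, ConcreteCategory.comp_apply, right,
          AffineSpace.reindex_appTop_coord]

/-- The morphism `e × e' : W ×_X W' ⟶ 𝔸ⁿ_X ×_X 𝔸ⁿ'_X = 𝔸ⁿ⁺ⁿ'_X`. -/
def pair {n n' : ℕ} {X W W' : Scheme.{u}} (e : W ⟶ Aff n X) (e' : W' ⟶ Aff n' X) :
    pullback (e ≫ proj n X) (e' ≫ proj n' X) ⟶ Aff (n + n') X :=
  (isPullback n n' X).lift (pullback.fst _ _ ≫ e) (pullback.snd _ _ ≫ e')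
    (by rw [Category.assoc, Category.assoc, pullback.condition])

lemma pair_left {n n' : ℕ} {X W W' : Scheme.{u}} (e : W ⟶ Aff n X) (e' : W' ⟶ Aff n' X) :
    pair e e' ≫ left n n' X = pullback.fst _ _ ≫ e :=
  IsPullback.lift_fst _ _ _ _

lemma pair_right {n n' : ℕ} {X W W' : Scheme.{u}} (e : W ⟶ Aff n X) (e' : W' ⟶ Aff n' X) :
    pair e e' ≫ right n n' X = pullback.snd _ _ ≫ e' :=
  IsPullback.lift_snd _ _ _ _

lemma pair_proj {n n' : ℕ} {X W W' : Scheme.{u}} (e : W ⟶ Aff n X) (e' : W' ⟶ Aff n' X) :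
    pair e e' ≫ proj (n + n') X = pullback.fst _ _ ≫ e ≫ proj n X := by
  rw [← left_proj, ← Category.assoc, pair_left, Category.assoc]

/-- The zero section `X ⟶ 𝔸ⁿ_X`. -/
def zeroSection (n : ℕ) (X : Scheme.{u}) : X ⟶ Aff n X :=
  AffineSpace.homOfVector (𝟙 X) 0

lemma zeroSection_proj (n : ℕ) (X : Scheme.{u}) : zeroSection n X ≫ proj n X = 𝟙 X :=
  AffineSpace.homOfVector_over _ _

instance (n : ℕ) (X : Scheme.{u}) : IsClosedImmersion (zeroSection n X) := by
  have : IsClosedImmersion (zeroSection n X ≫ proj n X) := by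
    rw [zeroSection_proj]; infer_instance
  exact IsClosedImmersion.of_comp (zeroSection n X) (proj n X)

lemma map_zeroSection (n : ℕ) {X X' : Scheme.{u}} (f : X' ⟶ X) :
    zeroSection n X' ≫ map n f = f ≫ zeroSection n X := by
  apply AffineSpace.hom_ext
  · rw [Category.assoc, AffineSpace.map_over, ← Category.assoc, zeroSection_proj, Category.assoc,
      zeroSection_proj]
    simp
  · intro i
    rw [Scheme.Hom.comp_appTop, ConcreteCategory.comp_apply, AffineSpace.map_appTop_coord,
      Scheme.Hom.comp_appTop, ConcreteCategory.comp_apply]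
    simp [zeroSection]

lemma mem_range_zeroSection {X : Scheme.{u}} {K : Type u} [Field K]
    (y : Spec (.of K) ⟶ Aff 1 X) (t : Spec (.of K)) :
    y t ∈ Set.range (zeroSection 1 X) ↔ evalAt y (AffineSpace.coord X ⟨0⟩) = 0 := by
  constructor
  · rintro ⟨x, hx⟩
    by_contra hne
    have hu : IsUnit (evalAt y (AffineSpace.coord X ⟨0⟩) : K) := isUnit_iff_ne_zero.2 hne
    have hu' : IsUnit (y.appTop (AffineSpace.coord X ⟨0⟩)) :=
      (isUnit_map_iff (Scheme.ΓSpecIso (.of K)).commRingCatIsoToRingEquiv _).1 hu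
    have h1 : y t ∈ (Aff 1 X).basicOpen (AffineSpace.coord X ⟨0⟩) := by
      have := Scheme.preimage_basicOpen_top y (AffineSpace.coord X ⟨0⟩)
      have h2 : t ∈ y ⁻¹ᵁ (Aff 1 X).basicOpen (AffineSpace.coord X ⟨0⟩) := by
        rw [this, Scheme.basicOpen_of_isUnit _ hu']
        trivial
      exact h2
    rw [← hx] at h1
    have h3 : x ∈ (zeroSection 1 X) ⁻¹ᵁ (Aff 1 X).basicOpen (AffineSpace.coord X ⟨0⟩) := h1
    rw [Scheme.preimage_basicOpen_top, zeroSection, AffineSpace.homOfVector_appTop_coord] at h3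
    simp at h3
  · intro h
    have h0 : y.appTop (AffineSpace.coord X ⟨0⟩) = 0 := by
      have := (map_eq_zero_iff (Scheme.ΓSpecIso (.of K)).commRingCatIsoToRingEquiv
        (RingEquiv.injective _)).1 h
      exact this
    have : y = (y ≫ proj 1 X) ≫ zeroSection 1 X := by
      apply AffineSpace.hom_ext
      · rw [Category.assoc (y ≫ proj 1 X), zeroSection_proj, Category.comp_id]
      · intro i
        have hi : i = ⟨0⟩ := Subsingleton.elim _ _
        subst hi
        rw [h0, Scheme.Hom.comp_appTop, ConcreteCategory.comp_apply, zeroSection,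
          AffineSpace.homOfVector_appTop_coord]
        simp
    rw [this]
    exact ⟨(y ≫ proj 1 X) t, by simp⟩

lemma map_mem_range_zeroSection {X X' : Scheme.{u}} (f : X' ⟶ X) (x : Aff 1 X') :
    map 1 f x ∈ Set.range (zeroSection 1 X) ↔ x ∈ Set.range (zeroSection 1 X') := by
  obtain ⟨K, _, y, t, rfl⟩ : ∃ (K : Type u) (_ : Field K) (y : Spec (.of K) ⟶ Aff 1 X')
      (t : Spec (.of K)), y t = x :=
    ⟨(Aff 1 X').residueField x, inferInstance, (Aff 1 X').fromSpecResidueField x, default,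
      (Aff 1 X').fromSpecResidueField_apply x default⟩
  rw [← Scheme.Hom.comp_apply, mem_range_zeroSection, mem_range_zeroSection, evalAt_comp,
    AffineSpace.map_appTop_coord]

lemma coord_pullback {X X' : Scheme.{u}} (f : X' ⟶ X) :
    (pullback.fst (𝟙 (Aff 1 X)) (map 1 f)).appTop (AffineSpace.coord X ⟨0⟩) =
      (pullback.snd (𝟙 (Aff 1 X)) (map 1 f)).appTop (AffineSpace.coord X' ⟨0⟩) := by
  rw [← AffineSpace.map_appTop_coord f, ← ConcreteCategory.comp_apply, ← Scheme.Hom.comp_appTop,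
    ← pullback.condition, Category.comp_id]

end Aff

/-- An explicit cobordism-framed correspondence of level `(n, n + N)` from `X` to `Y`. That `Z ⊆ W`
is the preimage of the zero section under `φ` is tested on points of `W` with values in fields. -/
structure PreFr (n N : ℕ) (X : Scheme.{u}) (Y : Scheme.{u}ᵒᵖ ⥤ Type u) where
  Z : Closeds (Aff n X)
  finite : IsFinite (redι Z ≫ Aff.proj n X)
  W : Scheme.{u}
  e : W ⟶ Aff n X
  nhd : IsEtaleNhd Z e
  φ : TauMap W n N
  zero_iff : ∀ (K : Type u) [Field K] (y : Spec (.of K) ⟶ W) (t : Spec (.of K)),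
    (y ≫ e) t ∈ Z ↔ (φ.pt (.of K) y).sec = 0
  g : Y.obj (op W)

lemma restr_restr (Y : Scheme.{u}ᵒᵖ ⥤ Type u) {A B C : Scheme.{u}} (i : A ⟶ B) (j : B ⟶ C)
    (g : Y.obj (op C)) : Y.map i.op (Y.map j.op g) = Y.map (i ≫ j).op g := by
  simp

namespace PreFr

variable {n N n' N' : ℕ} {X X' X'' : Scheme.{u}} {Y Y' Y'' : Scheme.{u}ᵒᵖ ⥤ Type u}

/-- Two explicit correspondences are equivalent if they have the same support and agree on a common
refinement `W''` of the two étale neighbourhoods. -/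
def Rel (c d : PreFr n N X Y) : Prop :=
  c.Z = d.Z ∧ ∃ (W'' : Scheme.{u}) (i : W'' ⟶ c.W) (j : W'' ⟶ d.W), i ≫ c.e = j ≫ d.e ∧
    IsEtaleNhd c.Z (i ≫ c.e) ∧ c.φ.comp i = d.φ.comp j ∧ Y.map i.op c.g = Y.map j.op d.g

lemma Rel.of_hom {c d : PreFr n N X Y} (hZ : c.Z = d.Z) (i : c.W ⟶ d.W) (he : i ≫ d.e = c.e)
    (hφ : c.φ = d.φ.comp i) (hg : c.g = Y.map i.op d.g) : Rel c d :=
  ⟨hZ, c.W, 𝟙 _, i, by simp [he], by simpa using c.nhd, by rw [TauMap.comp_id, hφ], by simp [hg]⟩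

lemma Rel.refl (c : PreFr n N X Y) : Rel c c :=
  Rel.of_hom rfl (𝟙 _) (by simp) (by rw [TauMap.comp_id]) (by simp)

/-- The pullback of a correspondence along `f : X' ⟶ X`, i.e. its composite with `f`. -/
abbrev pull (f : X' ⟶ X) (c : PreFr n N X Y) : PreFr n N X' Y where
  Z := c.Z.preimage (Aff.map n f).continuous
  finite := isFinite_pullback (AffineSpace.isPullback_map f) c.Z c.finite _ fun _ h => h
  W := pullback c.e (Aff.map n f)
  e := pullback.snd c.e (Aff.map n f)
  nhd := c.nhd.baseChange (.of_hasPullback _ _) _ fun _ h => h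
  φ := c.φ.comp (pullback.fst c.e (Aff.map n f))
  zero_iff K _ y t := by
    refine Iff.trans ?_ (c.zero_iff K (y ≫ pullback.fst _ _) t)
    rw [Category.assoc, pullback.condition]
    simp only [Scheme.Hom.comp_apply]
    rfl
  g := Y.map (pullback.fst c.e (Aff.map n f)).op c.g

lemma Rel.pull (f : X' ⟶ X) {c d : PreFr n N X Y} (h : Rel c d) : Rel (c.pull f) (d.pull f) := by
  obtain ⟨hZ, W, i, j, he, hn, hφ, hg⟩ := h
  refine ⟨by simp [hZ], CategoryTheory.Limits.pullback (i ≫ c.e) (Aff.map n f),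
    pullback.lift (pullback.fst _ _ ≫ i) (pullback.snd _ _)
      (by rw [Category.assoc, pullback.condition]),
    pullback.lift (pullback.fst _ _ ≫ j) (pullback.snd _ _)
      (by rw [Category.assoc, ← he, pullback.condition]), ?_, ?_, ?_, ?_⟩
  · simp only [PreFr.pull, pullback.lift_snd]
  · simp only [PreFr.pull, pullback.lift_snd]
    exact hn.baseChange (.of_hasPullback _ _) _ fun _ h => h
  · simp only [PreFr.pull, TauMap.comp_comp, pullback.lift_fst]
    rw [← TauMap.comp_comp, hφ, TauMap.comp_comp]
  · simp only [PreFr.pull, ← Functor.map_comp_apply, ← op_comp, pullback.lift_fst]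
    rw [op_comp, op_comp, Functor.map_comp_apply, Functor.map_comp_apply, hg]

lemma pull_id (c : PreFr n N X Y) : Rel (c.pull (𝟙 X)) c := by
  refine Rel.of_hom ?_ (pullback.fst _ _) ?_ rfl rfl
  · ext x
    simp [Closeds.preimage]
  · simp [PreFr.pull, pullback.condition]

lemma pull_comp (f : X' ⟶ X) (f' : X'' ⟶ X') (c : PreFr n N X Y) :
    Rel (c.pull (f' ≫ f)) ((c.pull f).pull f') := by
  refine Rel.of_hom ?_ (pullback.lift (pullback.lift (pullback.fst _ _)
    (pullback.snd _ _ ≫ Aff.map n f') ?_) (pullback.snd _ _) ?_) ?_ ?_ ?_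
  · ext x
    simp [Closeds.preimage]
  · rw [pullback.condition, Category.assoc, ← Aff.map_comp]
  · simp only [PreFr.pull, pullback.lift_snd]
  · simp only [PreFr.pull, pullback.lift_snd]
  · simp only [PreFr.pull, TauMap.comp_comp]
    rw [pullback.lift_fst_assoc, pullback.lift_fst]
  · simp only [PreFr.pull, ← Functor.map_comp_apply, ← op_comp]
    rw [pullback.lift_fst_assoc, pullback.lift_fst]

/-- The composite of a correspondence with a morphism `a : Y ⟶ Y'`. -/
abbrev push (a : Y ⟶ Y') (c : PreFr n N X Y) : PreFr n N X Y' where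
  Z := c.Z
  finite := c.finite
  W := c.W
  e := c.e
  nhd := c.nhd
  φ := c.φ
  zero_iff := c.zero_iff
  g := a.app _ c.g

lemma Rel.push (a : Y ⟶ Y') {c d : PreFr n N X Y} (h : Rel c d) : Rel (c.push a) (d.push a) := by
  obtain ⟨hZ, W, i, j, he, hn, hφ, hg⟩ := h
  refine ⟨hZ, W, i, j, he, hn, hφ, ?_⟩
  simp only [PreFr.push, ← NatTrans.naturality_apply]
  rw [hg]

lemma push_pull (a : Y ⟶ Y') (f : X' ⟶ X) (c : PreFr n N X Y) :
    (c.push a).pull f = (c.pull f).push a := by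
  simp only [PreFr.push, PreFr.pull, NatTrans.naturality_apply]

/-- The external product of two correspondences with the same source `X`, taken relatively to `X`:
for `X = pt` this is the external product `c × d` of correspondences
`pt = pt × pt ⟶ Y × Y'` (and in general it is the pullback of `c × d` along the diagonal of `X`).
-/
abbrev mul (c : PreFr n N X Y) (d : PreFr n' N' X Y') :
    PreFr (n + n') (N + N') X (FunctorToTypes.prod Y Y') where
  Z := c.Z.preimage (Aff.left n n' X).continuous ⊓ d.Z.preimage (Aff.right n n' X).continuous
  finite := by
    have := isFinite_prod (Aff.isPullback n n' X) c.finite d.finite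
      (c.Z.preimage (Aff.left n n' X).continuous ⊓ d.Z.preimage (Aff.right n n' X).continuous)
      fun _ h => h
    rwa [Aff.left_proj] at this
  W := pullback (c.e ≫ Aff.proj n X) (d.e ≫ Aff.proj n' X)
  e := Aff.pair c.e d.e
  nhd := IsEtaleNhd.prod (Aff.isPullback n n' X) c.nhd d.nhd (.of_hasPullback _ _) _
    (Aff.pair_left _ _) (Aff.pair_right _ _) _ fun _ h => h
  φ := (c.φ.comp (pullback.fst _ _)).prod (d.φ.comp (pullback.snd _ _))
  zero_iff K _ y t := by
    refine Iff.trans ?_ (TauPoint.prod_sec_eq_zero _ _).symm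
    refine Iff.trans ?_ (and_congr (c.zero_iff K (y ≫ pullback.fst _ _) t)
      (d.zero_iff K (y ≫ pullback.snd _ _) t))
    refine and_congr ?_ ?_
    · refine Eq.to_iff (congrArg (· ∈ c.Z) ?_)
      rw [← Scheme.Hom.comp_apply, Category.assoc, Category.assoc, Aff.pair_left]
    · refine Eq.to_iff (congrArg (· ∈ d.Z) ?_)
      rw [← Scheme.Hom.comp_apply, Category.assoc, Category.assoc, Aff.pair_right]
  g := (Y.map (pullback.fst _ _).op c.g, Y'.map (pullback.snd _ _).op d.g)

lemma Rel.mul {c c' : PreFr n N X Y} {d d' : PreFr n' N' X Y'} (h : Rel c c') (h' : Rel d d') :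
    Rel (c.mul d) (c'.mul d') := by
  obtain ⟨hZ, W, i, j, he, hn, hφ, hg⟩ := h
  obtain ⟨hZ', W', i', j', he', hn', hφ', hg'⟩ := h'
  have e1 : (pullback.fst (i ≫ c.e ≫ Aff.proj n X) (i' ≫ d.e ≫ Aff.proj n' X) ≫ i) ≫
      c.e ≫ Aff.proj n X = (pullback.snd _ _ ≫ i') ≫ d.e ≫ Aff.proj n' X := by
    simp only [Category.assoc, pullback.condition]
  have e2 : (pullback.fst (i ≫ c.e ≫ Aff.proj n X) (i' ≫ d.e ≫ Aff.proj n' X) ≫ j) ≫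
      c'.e ≫ Aff.proj n X = (pullback.snd _ _ ≫ j') ≫ d'.e ≫ Aff.proj n' X := by
    simp only [Category.assoc]
    rw [← reassoc_of% he, ← reassoc_of% he', pullback.condition]
  refine ⟨by simp [hZ, hZ'], pullback (i ≫ c.e ≫ Aff.proj n X) (i' ≫ d.e ≫ Aff.proj n' X),
    pullback.lift _ _ e1, pullback.lift _ _ e2, ?_, ?_, ?_, ?_⟩
  · apply (Aff.isPullback n n' X).hom_ext
    · rw [Category.assoc, Aff.pair_left, Category.assoc, Aff.pair_left, pullback.lift_fst_assoc,
        pullback.lift_fst_assoc, Category.assoc, he, Category.assoc]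
    · rw [Category.assoc, Aff.pair_right, Category.assoc, Aff.pair_right, pullback.lift_snd_assoc,
        pullback.lift_snd_assoc, Category.assoc, he', Category.assoc]
  · refine IsEtaleNhd.prod (Aff.isPullback n n' X) hn hn' (w₁ := pullback.fst _ _)
      (w₂ := pullback.snd _ _) ?_ _ ?_ ?_ _ fun _ h => h
    · rw [Category.assoc, Category.assoc]
      exact .of_hasPullback _ _
    · rw [Category.assoc, Aff.pair_left, pullback.lift_fst_assoc, Category.assoc]
    · rw [Category.assoc, Aff.pair_right, pullback.lift_snd_assoc, Category.assoc]
  · simp only [TauMap.prod_comp, TauMap.comp_comp, pullback.lift_fst, pullback.lift_snd]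
    rw [← TauMap.comp_comp, ← TauMap.comp_comp, hφ, hφ', TauMap.comp_comp, TauMap.comp_comp]
  · refine Prod.ext ?_ ?_
    · change Y.map _ (Y.map _ c.g) = Y.map _ (Y.map _ c'.g)
      rw [restr_restr, restr_restr, pullback.lift_fst, pullback.lift_fst, ← restr_restr, hg,
        restr_restr]
    · change Y'.map _ (Y'.map _ d.g) = Y'.map _ (Y'.map _ d'.g)
      rw [restr_restr, restr_restr, pullback.lift_snd, pullback.lift_snd, ← restr_restr, hg',
        restr_restr]

lemma mul_pull (f : X' ⟶ X) (c : PreFr n N X Y) (d : PreFr n' N' X Y') :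
    Rel ((c.mul d).pull f) ((c.pull f).mul (d.pull f)) := by
  have h1 : (pullback.fst (Aff.pair c.e d.e) (Aff.map (n + n') f) ≫ pullback.fst _ _) ≫ c.e =
      (pullback.snd _ _ ≫ Aff.left n n' X') ≫ Aff.map n f := by
    rw [Category.assoc, ← Aff.pair_left, pullback.condition_assoc, Aff.map_left, Category.assoc]
  have h2 : (pullback.fst (Aff.pair c.e d.e) (Aff.map (n + n') f) ≫ pullback.snd _ _) ≫ d.e =
      (pullback.snd _ _ ≫ Aff.right n n' X') ≫ Aff.map n' f := by
    rw [Category.assoc, ← Aff.pair_right, pullback.condition_assoc, Aff.map_right, Category.assoc]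
  have h3 : pullback.lift _ _ h1 ≫ pullback.snd c.e (Aff.map n f) ≫ Aff.proj n X' =
      pullback.lift _ _ h2 ≫ pullback.snd d.e (Aff.map n' f) ≫ Aff.proj n' X' := by
    rw [pullback.lift_snd_assoc, pullback.lift_snd_assoc, Category.assoc, Category.assoc,
      Aff.left_proj, Aff.right_proj]
  refine Rel.of_hom ?_ (pullback.lift _ _ h3) ?_ ?_ ?_
  · ext x
    refine and_congr (Eq.to_iff (congrArg (· ∈ c.Z) ?_)) (Eq.to_iff (congrArg (· ∈ d.Z) ?_))
    · rw [← Scheme.Hom.comp_apply, ← Scheme.Hom.comp_apply, Aff.map_left]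
    · rw [← Scheme.Hom.comp_apply, ← Scheme.Hom.comp_apply, Aff.map_right]
  · apply (Aff.isPullback n n' X').hom_ext
    · rw [Category.assoc, Aff.pair_left, pullback.lift_fst_assoc, pullback.lift_snd]
    · rw [Category.assoc, Aff.pair_right, pullback.lift_snd_assoc, pullback.lift_snd]
  · simp only [TauMap.prod_comp, TauMap.comp_comp]
    rw [pullback.lift_fst_assoc, pullback.lift_fst, pullback.lift_snd_assoc, pullback.lift_fst]
  · refine Prod.ext ?_ ?_
    · change Y.map _ (Y.map _ c.g) = Y.map _ (Y.map _ (Y.map _ c.g))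
      rw [restr_restr, restr_restr, restr_restr, pullback.lift_fst, pullback.lift_fst]
    · change Y'.map _ (Y'.map _ d.g) = Y'.map _ (Y'.map _ (Y'.map _ d.g))
      rw [restr_restr, restr_restr, restr_restr, pullback.lift_snd, pullback.lift_fst]

/-- The point `pt`, as a presheaf: the terminal presheaf. -/
def ptPresheaf : Scheme.{u}ᵒᵖ ⥤ Type u := (Functor.const _).obj PUnit

/-- The correspondence of level `(1, 1 + 0)` from `X` to the point with support the zero section of
`𝔸¹_X`, neighbourhood `W = 𝔸¹_X` and map `W ⟶ τ` given by the identity epimorphism `O ↠ O` and the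
coordinate function as its section. -/
def suspension (X : Scheme.{u}) : PreFr 1 0 X ptPresheaf where
  Z := ⟨Set.range (Aff.zeroSection 1 X), (Aff.zeroSection 1 X).isClosedEmbedding.isClosed_range⟩
  finite := isFinite_of_closedImmersion _ _ (Aff.zeroSection 1 X) (fun _ h => h) (by
    rw [Aff.zeroSection_proj]; infer_instance)
  W := Aff 1 X
  e := 𝟙 _
  nhd := ⟨inferInstance, inferInstance⟩
  φ := TauMap.ofSection (AffineSpace.coord X ⟨0⟩)
  zero_iff K _ y t := by
    rw [Category.comp_id]
    exact (Aff.mem_range_zeroSection y t).trans (TauMap.ofSection_sec_eq_zero _ y).symm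
  g := PUnit.unit

lemma suspension_pull (f : X' ⟶ X) : Rel ((suspension X).pull f) (suspension X') := by
  refine Rel.of_hom ?_ (pullback.snd _ _) (Category.comp_id _) ?_ rfl
  · ext x
    exact Aff.map_mem_range_zeroSection f x
  · refine (TauMap.ofSection_comp _ _).trans (Eq.trans ?_ (TauMap.ofSection_comp _ _).symm)
    exact congrArg TauMap.ofSection (Aff.coord_pullback f)

/-- Stabilisation along `n`: `W' = 𝔸¹ × W`, `Z' = {0} × Z`, and `φ'` is given by
`O ⊕ O ^ (n + N) ↠ O ⊕ E` and the section `(x, s)`, where `x` is the new coordinate. -/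
abbrev stabn (c : PreFr n N X Y) : PreFr (1 + n) (0 + N) X Y :=
  ((suspension X).mul c).push FunctorToTypes.prod.snd

/-- Stabilisation along `N`: the epimorphism `O ^ (n + N) ↠ E` is extended by zero on a new last
coordinate. -/
abbrev stabN (c : PreFr n N X Y) : PreFr n (N + 1) X Y where
  Z := c.Z
  finite := c.finite
  W := c.W
  e := c.e
  nhd := c.nhd
  φ := c.φ.stab
  zero_iff K _ y t := (c.zero_iff K y t).trans (TauMap.stab_sec c.φ y).symm
  g := c.g

/-- A morphism `h : X ⟶ Y` as a correspondence of level `(0, 0)`, `W = 𝔸⁰_X = X`. -/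
def ofMap (h : Y.obj (op X)) : PreFr 0 0 X Y where
  Z := ⊤
  finite := isFinite_of_closedImmersion _ _ (𝟙 _) (fun x _ => ⟨x, by simp⟩) (by
    rw [Category.id_comp]; infer_instance)
  W := Aff 0 X
  e := 𝟙 _
  nhd := ⟨inferInstance, inferInstance⟩
  φ := TauMap.zero _ 0
  zero_iff K _ y t := ⟨fun _ => TauMap.zero_sec y, fun _ => trivial⟩
  g := Y.map (Aff.proj 0 X).op h

/-- The explicit correspondence `c` is the disjoint union of `a` and `b`: their supports are
disjoint, `c.Z = a.Z ⊔ b.Z`, and `c.W` is the disjoint union of its open subschemes `a.W` and `b.W`,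
compatibly with all the data. -/
structure IsDisjUnion (a b c : PreFr n N X Y) : Prop where
  disjoint : Disjoint a.Z b.Z
  Z_eq : c.Z = a.Z ⊔ b.Z
  exists_W : ∃ (i : a.W ⟶ c.W) (j : b.W ⟶ c.W), IsOpenImmersion i ∧ IsOpenImmersion j ∧
    IsCompl (Set.range i) (Set.range j) ∧ i ≫ c.e = a.e ∧ j ≫ c.e = b.e ∧
    a.φ = c.φ.comp i ∧ b.φ = c.φ.comp j ∧ a.g = Y.map i.op c.g ∧ b.g = Y.map j.op c.g

end PreFr

namespace PreFr

variable {n N n' N' : ℕ} {X X' X'' : Scheme.{u}} {Y Y' Y'' : Scheme.{u}ᵒᵖ ⥤ Type u}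

lemma Rel.stabN {c d : PreFr n N X Y} (h : Rel c d) : Rel c.stabN d.stabN := by
  obtain ⟨hZ, W, i, j, he, hn, hφ, hg⟩ := h
  exact ⟨hZ, W, i, j, he, hn, by rw [TauMap.stab_comp, hφ, TauMap.stab_comp], hg⟩

lemma Rel.stabn {c d : PreFr n N X Y} (h : Rel c d) : Rel c.stabn d.stabn :=
  Rel.push FunctorToTypes.prod.snd (Rel.mul (Rel.refl (suspension X)) h)

lemma stabN_pull (f : X' ⟶ X) (c : PreFr n N X Y) : c.stabN.pull f = (c.pull f).stabN := rfl

lemma stabN_push (a : Y ⟶ Y') (c : PreFr n N X Y) : c.stabN.push a = (c.push a).stabN := rfl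

lemma stabn_push (a : Y ⟶ Y') (c : PreFr n N X Y) : c.stabn.push a = (c.push a).stabn := by
  have key : a.app _ (Y.map (pullback.snd ((suspension X).e ≫ Aff.proj 1 X)
      (c.e ≫ Aff.proj n X)).op c.g) = Y'.map (pullback.snd ((suspension X).e ≫ Aff.proj 1 X)
      (c.e ≫ Aff.proj n X)).op (a.app _ c.g) := NatTrans.naturality_apply a _ c.g
  exact congrArg (PreFr.mk _ (c.stabn).finite _ _ (c.stabn).nhd _ (c.stabn).zero_iff) key

lemma IsDisjUnion.push (a : Y ⟶ Y') {c₁ c₂ c₃ : PreFr n N X Y} (h : IsDisjUnion c₁ c₂ c₃) :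
    IsDisjUnion (c₁.push a) (c₂.push a) (c₃.push a) := by
  obtain ⟨h1, h2, i, j, hi, hj, hc, he, he', hφ, hφ', hg, hg'⟩ := h
  refine ⟨h1, h2, i, j, hi, hj, hc, he, he', hφ, hφ', ?_, ?_⟩
  · simp only [PreFr.push, hg, NatTrans.naturality_apply]
  · simp only [PreFr.push, hg', NatTrans.naturality_apply]

lemma range_lift {A B B' C : Scheme.{u}} {p : B ⟶ C} {p' : A ⟶ C} {q : B' ⟶ C} {i : A ⟶ B}
    (hi : i ≫ p = p') [IsOpenImmersion i] :
    IsOpenImmersion (pullback.lift (pullback.fst p' q ≫ i) (pullback.snd p' q)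
      (by rw [Category.assoc, hi, pullback.condition]) : pullback p' q ⟶ pullback p q) ∧
    Set.range (pullback.lift (pullback.fst p' q ≫ i) (pullback.snd p' q)
      (by rw [Category.assoc, hi, pullback.condition]) : pullback p' q ⟶ pullback p q) =
      pullback.fst p q ⁻¹' Set.range i := by
  subst hi
  have hp : IsPullback (pullback.fst (i ≫ p) q) (pullback.lift (pullback.fst (i ≫ p) q ≫ i)
      (pullback.snd (i ≫ p) q) (by rw [Category.assoc, pullback.condition])) i
      (pullback.fst p q) := by
    refine IsPullback.of_bot (h₃₁ := q) (v₂₁ := pullback.snd p q) (v₂₂ := p) ?_ ?_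
      (IsPullback.of_hasPullback p q)
    · rw [pullback.lift_snd]
      exact IsPullback.of_hasPullback _ _
    · rw [pullback.lift_fst]
  refine ⟨MorphismProperty.of_isPullback (P := @IsOpenImmersion) hp inferInstance, ?_⟩
  have := Scheme.image_preimage_eq_of_isPullback hp Set.univ
  simpa using this

lemma IsDisjUnion.pull (f : X' ⟶ X) {c₁ c₂ c₃ : PreFr n N X Y} (h : IsDisjUnion c₁ c₂ c₃) :
    IsDisjUnion (c₁.pull f) (c₂.pull f) (c₃.pull f) := by
  obtain ⟨h1, h2, i, j, hi, hj, hc, he, he', hφ, hφ', hg, hg'⟩ := h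
  refine ⟨?_, ?_, _, _, (range_lift he).1, (range_lift he').1, ?_, ?_, ?_, ?_, ?_, ?_, ?_⟩
  · rw [disjoint_iff] at h1 ⊢
    ext x
    have := congrArg (fun S : Closeds (Aff n X) => Aff.map n f x ∈ S) h1
    exact Eq.to_iff this
  · ext x
    change Aff.map n f x ∈ c₃.Z ↔ Aff.map n f x ∈ c₁.Z ∨ Aff.map n f x ∈ c₂.Z
    rw [h2]
    rfl
  · rw [(range_lift he).2, (range_lift he').2]
    rw [← hc.compl_eq, Set.preimage_compl]
    exact isCompl_compl
  · rw [pullback.lift_snd]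
  · rw [pullback.lift_snd]
  · simp only [TauMap.comp_comp, pullback.lift_fst]
    rw [← TauMap.comp_comp, ← hφ]
  · simp only [TauMap.comp_comp, pullback.lift_fst]
    rw [← TauMap.comp_comp, ← hφ']
  · simp only [restr_restr, pullback.lift_fst]
    rw [← restr_restr, ← hg]
  · simp only [restr_restr, pullback.lift_fst]
    rw [← restr_restr, ← hg']

end PreFr

/-- Cobordism-framed correspondences of level `(n, n + N)`: explicit ones up to equivalence. -/
def Fr (n N : ℕ) (X : Scheme.{u}) (Y : Scheme.{u}ᵒᵖ ⥤ Type u) : Type (u + 1) :=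
  Quot (PreFr.Rel (n := n) (N := N) (X := X) (Y := Y))

namespace Fr

variable {n N : ℕ} {X X' X'' : Scheme.{u}} {Y Y' : Scheme.{u}ᵒᵖ ⥤ Type u}

/-- The class of an explicit correspondence. -/
def mk (c : PreFr n N X Y) : Fr n N X Y := Quot.mk _ c

/-- Composition with `f : X' ⟶ X`. -/
def pull (f : X' ⟶ X) : Fr n N X Y → Fr n N X' Y :=
  Quot.map (PreFr.pull f) fun _ _ h => h.pull f

/-- Composition with `a : Y ⟶ Y'`. -/
def push (a : Y ⟶ Y') : Fr n N X Y → Fr n N X Y' :=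
  Quot.map (PreFr.push a) fun _ _ h => h.push a

/-- Stabilisation along `n`. -/
def stabn : Fr n N X Y → Fr (1 + n) (0 + N) X Y := Quot.map PreFr.stabn fun _ _ h => h.stabn

/-- Stabilisation along `N`. -/
def stabN : Fr n N X Y → Fr n (N + 1) X Y := Quot.map PreFr.stabN fun _ _ h => h.stabN

lemma stabn_pull (f : X' ⟶ X) (c : Fr n N X Y) : c.stabn.pull f = (c.pull f).stabn := by
  obtain ⟨c⟩ := c
  exact (Quot.sound (PreFr.Rel.push FunctorToTypes.prod.snd
      (PreFr.mul_pull f (PreFr.suspension X) c))).trans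
    (Quot.sound (PreFr.Rel.push FunctorToTypes.prod.snd
      (PreFr.Rel.mul (PreFr.suspension_pull f) (PreFr.Rel.refl (c.pull f)))))

lemma stabN_pull (f : X' ⟶ X) (c : Fr n N X Y) : c.stabN.pull f = (c.pull f).stabN := by
  obtain ⟨c⟩ := c
  exact congrArg Fr.mk (PreFr.stabN_pull f c)

lemma stabn_push (a : Y ⟶ Y') (c : Fr n N X Y) : c.stabn.push a = (c.push a).stabn := by
  obtain ⟨c⟩ := c
  exact congrArg Fr.mk (PreFr.stabn_push a c)

lemma stabN_push (a : Y ⟶ Y') (c : Fr n N X Y) : c.stabN.push a = (c.push a).stabN := by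
  obtain ⟨c⟩ := c
  exact congrArg Fr.mk (PreFr.stabN_push a c)

end Fr

/-- The relation on correspondences of all levels that identifies each one with its two
stabilisations. -/
inductive StabRel (X : Scheme.{u}) (Y : Scheme.{u}ᵒᵖ ⥤ Type u) :
    (Σ n N : ℕ, Fr n N X Y) → (Σ n N : ℕ, Fr n N X Y) → Prop
  | stabn (n N : ℕ) (c : Fr n N X Y) : StabRel X Y ⟨n, N, c⟩ ⟨1 + n, 0 + N, c.stabn⟩
  | stabN (n N : ℕ) (c : Fr n N X Y) : StabRel X Y ⟨n, N, c⟩ ⟨n, N + 1, c.stabN⟩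

/-- Stable cobordism-framed correspondences: the colimit over all levels. -/
def StableFr (X : Scheme.{u}) (Y : Scheme.{u}ᵒᵖ ⥤ Type u) : Type (u + 1) := Quot (StabRel X Y)

namespace StableFr

variable {n N : ℕ} {X X' X'' : Scheme.{u}} {Y Y' Y'' : Scheme.{u}ᵒᵖ ⥤ Type u}

/-- The stable class of an explicit correspondence. -/
def mk (c : PreFr n N X Y) : StableFr X Y := Quot.mk _ ⟨n, N, Fr.mk c⟩

lemma ind {p : StableFr X Y → Prop} (h : ∀ (n N : ℕ) (c : PreFr n N X Y), p (mk c))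
    (c : StableFr X Y) : p c := by
  obtain ⟨n, N, ⟨c⟩⟩ := c
  exact h n N c

/-- Composition with `f : X' ⟶ X`. -/
def pull (f : X' ⟶ X) : StableFr X Y → StableFr X' Y :=
  Quot.map (fun c => ⟨c.1, c.2.1, c.2.2.pull f⟩) (by
    rintro _ _ (⟨n, N, c⟩ | ⟨n, N, c⟩)
    · simpa only [Fr.stabn_pull] using StabRel.stabn n N (c.pull f)
    · simpa only [Fr.stabN_pull] using StabRel.stabN n N (c.pull f))

/-- Composition with `a : Y ⟶ Y'`. -/
def push (a : Y ⟶ Y') : StableFr X Y → StableFr X Y' :=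
  Quot.map (fun c => ⟨c.1, c.2.1, c.2.2.push a⟩) (by
    rintro _ _ (⟨n, N, c⟩ | ⟨n, N, c⟩)
    · simpa only [Fr.stabn_push] using StabRel.stabn n N (c.push a)
    · simpa only [Fr.stabN_push] using StabRel.stabN n N (c.push a))

lemma pull_mk (f : X' ⟶ X) (c : PreFr n N X Y) : (mk c).pull f = mk (c.pull f) := rfl

lemma push_mk (a : Y ⟶ Y') (c : PreFr n N X Y) : (mk c).push a = mk (c.push a) := rfl

lemma mk_eq_of_rel {c d : PreFr n N X Y} (h : PreFr.Rel c d) : mk c = mk d := by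
  have : Fr.mk c = Fr.mk d := Quot.sound h
  rw [mk, this, mk]

lemma pull_id (c : StableFr X Y) : c.pull (𝟙 X) = c := by
  induction c using ind with
  | h n N c => exact mk_eq_of_rel (PreFr.pull_id c)

lemma pull_comp (f : X' ⟶ X) (f' : X'' ⟶ X') (c : StableFr X Y) :
    c.pull (f' ≫ f) = (c.pull f).pull f' := by
  induction c using ind with
  | h n N c => exact mk_eq_of_rel (PreFr.pull_comp f f' c)

lemma push_pull (a : Y ⟶ Y') (f : X' ⟶ X) (c : StableFr X Y) :
    (c.push a).pull f = (c.pull f).push a := by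
  induction c using ind with
  | h n N c => exact congrArg mk (PreFr.push_pull a f c)

end StableFr

/-- The additivity relations `[a] + [b] = [a ⊔ b]`. -/
def additivity (X : Scheme.{u}) (Y : Scheme.{u}ᵒᵖ ⥤ Type u) :
    AddSubgroup (FreeAbelianGroup (StableFr X Y)) :=
  AddSubgroup.closure {x | ∃ (n N : ℕ) (a b c : PreFr n N X Y), PreFr.IsDisjUnion a b c ∧
    x = .of (StableFr.mk a) + .of (StableFr.mk b) - .of (StableFr.mk c)}

/-- The group `ℤF^cob(X, Y)` of linear cobordism-framed correspondences. -/
abbrev ZF (X : Scheme.{u}) (Y : Scheme.{u}ᵒᵖ ⥤ Type u) : Type (u + 1) :=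
  FreeAbelianGroup (StableFr X Y) ⧸ additivity X Y

namespace ZF

variable {n N : ℕ} {X X' X'' : Scheme.{u}} {Y Y' Y'' : Scheme.{u}ᵒᵖ ⥤ Type u}

/-- The class of an explicit correspondence in `ℤF^cob(X, Y)`. -/
def mk (c : PreFr n N X Y) : ZF X Y := QuotientAddGroup.mk (.of (StableFr.mk c))

lemma hom_ext {A : Type*} [AddCommGroup A] {α β : ZF X Y →+ A}
    (h : ∀ (n N : ℕ) (c : PreFr n N X Y), α (mk c) = β (mk c)) : α = β := by
  refine QuotientAddGroup.addMonoidHom_ext _ (FreeAbelianGroup.lift_ext _ _ fun c => ?_)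
  induction c using StableFr.ind with
  | h n N c => exact h n N c

/-- Composition with `f : X' ⟶ X`. -/
def pull (f : X' ⟶ X) : ZF X Y →+ ZF X' Y :=
  QuotientAddGroup.map _ _ (FreeAbelianGroup.map (StableFr.pull f)) (by
    rw [additivity, AddSubgroup.closure_le]
    rintro _ ⟨n, N, a, b, c, h, rfl⟩
    refine AddSubgroup.subset_closure ⟨n, N, _, _, _, h.pull f, ?_⟩
    simp [StableFr.pull_mk])

/-- Composition with `a : Y ⟶ Y'`. -/
def push (a : Y ⟶ Y') : ZF X Y →+ ZF X Y' :=
  QuotientAddGroup.map _ _ (FreeAbelianGroup.map (StableFr.push a)) (by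
    rw [additivity, AddSubgroup.closure_le]
    rintro _ ⟨n, N, _, _, _, h, rfl⟩
    refine AddSubgroup.subset_closure ⟨n, N, _, _, _, h.push a, ?_⟩
    simp [StableFr.push_mk])

lemma pull_mk (f : X' ⟶ X) (c : PreFr n N X Y) : pull f (mk c) = mk (c.pull f) := by
  simp [pull, mk, StableFr.pull_mk]

lemma push_mk (a : Y ⟶ Y') (c : PreFr n N X Y) : push a (mk c) = mk (c.push a) := by
  simp [push, mk, StableFr.push_mk]

lemma pull_id : pull (𝟙 X) = AddMonoidHom.id (ZF X Y) :=
  hom_ext fun n N c => by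
    rw [pull_mk]
    exact congrArg (fun x => QuotientAddGroup.mk (FreeAbelianGroup.of x))
      (StableFr.pull_id (StableFr.mk c))

lemma pull_comp (f : X' ⟶ X) (f' : X'' ⟶ X') :
    (pull (f' ≫ f) : ZF X Y →+ ZF X'' Y) = (pull f').comp (pull f) :=
  hom_ext fun n N c => by
    rw [AddMonoidHom.comp_apply, pull_mk, pull_mk, pull_mk]
    exact congrArg (fun x => QuotientAddGroup.mk (FreeAbelianGroup.of x))
      (StableFr.pull_comp f f' (StableFr.mk c))

lemma push_pull (a : Y ⟶ Y') (f : X' ⟶ X) (x : ZF X Y) :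
    pull f (push a x) = push a (pull f x) := by
  refine DFunLike.congr_fun (f := (pull f).comp (push a)) (g := (push a).comp (pull f)) ?_ x
  refine hom_ext fun n N c => ?_
  rw [AddMonoidHom.comp_apply, AddMonoidHom.comp_apply, push_mk, pull_mk, pull_mk, push_mk,
    PreFr.push_pull]

end ZF

/-- The pullback of units along `f : W' ⟶ W`. -/
def unitsMap {W W' : Scheme.{u}} (f : W' ⟶ W) : Γ(W, ⊤)ˣ →* Γ(W', ⊤)ˣ :=
  Units.map (f.appTop.hom : Γ(W, ⊤) →* Γ(W', ⊤))

/-- The presheaf `𝔾_m^m`, whose sections over `W` are the `m`-tuples of units on `W`. -/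
def Gm (m : ℕ) : Scheme.{u}ᵒᵖ ⥤ Type u where
  obj W := Fin m → (Γ(W.unop, ⊤))ˣ
  map f := ↾fun g i => unitsMap f.unop (g i)
  map_id W := by
    ext g i
    change (Scheme.Hom.appTop (𝟙 W.unop)).hom (g i) = g i
    rw [Scheme.Hom.id_appTop]
    rfl
  map_comp f f' := by
    ext g i
    change (Scheme.Hom.appTop (f'.unop ≫ f.unop)).hom (g i) =
      f'.unop.appTop.hom (f.unop.appTop.hom (g i))
    rw [Scheme.Hom.comp_appTop]
    rfl

namespace Gm

lemma update_map {A B : Type*} [Monoid A] [Monoid B] (φ : A →* B) {m : ℕ} (g : Fin m → A)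
    (i : Fin m) : (fun j => φ (Function.update g i 1 j)) =
      Function.update (fun j => φ (g j)) i 1 := by
  funext j
  rw [Function.update_apply, Function.update_apply]
  split_ifs
  · rw [map_one]
  · rfl

lemma append_map {A B : Type*} [Monoid A] [Monoid B] (φ : A →* B) {m m' : ℕ} (g : Fin m → A)
    (g' : Fin m' → A) : (fun j => φ (Fin.append g g' j)) =
      Fin.append (fun j => φ (g j)) (fun j => φ (g' j)) := by
  funext j
  refine Fin.addCases (fun i => ?_) (fun i => ?_) j
  · rw [Fin.append_left, Fin.append_left]
  · rw [Fin.append_right, Fin.append_right]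

/-- The endomorphism of `𝔾_m^m` replacing the `i`-th coordinate by `1`. -/
def setOne (m : ℕ) (i : Fin m) : Gm.{u} m ⟶ Gm m where
  app W := ↾fun g => Function.update g i 1
  naturality W W' f := by
    ext g
    exact (update_map (unitsMap f.unop) g i).symm

/-- The isomorphism `𝔾_m^m × 𝔾_m^m' ≅ 𝔾_m^(m + m')`. -/
def append (m m' : ℕ) : FunctorToTypes.prod (Gm.{u} m) (Gm m') ⟶ Gm (m + m') where
  app W := ↾fun g => Fin.append g.1 g.2
  naturality W W' f := by
    ext g
    exact (append_map (unitsMap f.unop) g.1 g.2).symm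

end Gm

/-- The endomorphism `e_i` of `ℤF^cob(X, 𝔾_m^m)` induced by replacing the `i`-th coordinate
by `1`. -/
def eIdem (m : ℕ) (X : Scheme.{u}) (i : Fin m) : AddMonoid.End (ZF X (Gm m)) :=
  ZF.push (Gm.setOne m i)

/-- The idempotent endomorphism `∏ (1 - e_i)` of `ℤF^cob(X, 𝔾_m^m)`. -/
def wedgeIdem (m : ℕ) (X : Scheme.{u}) : AddMonoid.End (ZF X (Gm m)) :=
  (List.ofFn fun i => 1 - eIdem m X i).prod

lemma pull_wedgeIdem (m : ℕ) {X X' : Scheme.{u}} (f : X' ⟶ X) (x : ZF X (Gm m)) :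
    ZF.pull f (wedgeIdem m X x) = wedgeIdem m X' (ZF.pull f x) := by
  rw [wedgeIdem, wedgeIdem, List.ofFn_eq_map, List.ofFn_eq_map]
  induction List.finRange m with
  | nil => rfl
  | cons i l ih =>
    rw [List.map_cons, List.map_cons, List.prod_cons, List.prod_cons]
    set y := (l.map fun i => 1 - eIdem m X i).prod x
    change ZF.pull f (y - ZF.push (Gm.setOne m i) y) = _
    rw [map_sub, ZF.push_pull, ih]
    rfl

/-- The direct summand `ℤF^cob(X, 𝔾_m^∧m)` of `ℤF^cob(X, 𝔾_m^m)`, the image of `∏ (1 - e_i)`. -/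
def ZFWedge (m : ℕ) (X : Scheme.{u}) : AddSubgroup (ZF X (Gm m)) :=
  AddMonoidHom.range (wedgeIdem m X : ZF X (Gm m) →+ ZF X (Gm m))

/-- The projection of `ℤF^cob(X, 𝔾_m^m)` onto its direct summand. -/
def toWedge (m : ℕ) (X : Scheme.{u}) : ZF X (Gm m) →+ ZFWedge m X :=
  AddMonoidHom.rangeRestrict (wedgeIdem m X : ZF X (Gm m) →+ ZF X (Gm m))

/-- Composition with `f : X' ⟶ X` on the direct summands. -/
def ZFWedge.pull (m : ℕ) {X X' : Scheme.{u}} (f : X' ⟶ X) : ZFWedge m X →+ ZFWedge m X' :=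
  ((ZF.pull f).comp (ZFWedge m X).subtype).codRestrict (ZFWedge m X') (by
    rintro ⟨_, x, rfl⟩
    exact ⟨ZF.pull f x, (pull_wedgeIdem m f x).symm⟩)

/-- The presheaf of abelian groups `X ↦ ℤF^cob(X, 𝔾_m^∧m)`. -/
def wedgePresheaf (m : ℕ) : Scheme.{u}ᵒᵖ ⥤ AddCommGrpCat.{u + 1} where
  obj X := AddCommGrpCat.of (ZFWedge m X.unop)
  map f := AddCommGrpCat.ofHom (ZFWedge.pull m f.unop)
  map_id X := by
    ext ⟨x, hx⟩
    exact DFunLike.congr_fun ZF.pull_id x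
  map_comp f f' := by
    ext ⟨x, hx⟩
    exact DFunLike.congr_fun (ZF.pull_comp f.unop f'.unop) x

section Simplex

variable (k : Type u) [Field k]

/-- The coordinate ring `k[x_0, …, x_n] / (x_0 + ⋯ + x_n - 1)` of the algebraic simplex. -/
abbrev SimplexRing (n : ℕ) : Type u :=
  MvPolynomial (Fin (n + 1)) k ⧸ Ideal.span {∑ i, (MvPolynomial.X i : MvPolynomial (Fin (n + 1)) k) - 1}

variable {k} in
/-- The coordinate `x_i` on the algebraic simplex. -/
def simplexCoord {n : ℕ} (i : Fin (n + 1)) : SimplexRing k n :=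
  Ideal.Quotient.mk _ (MvPolynomial.X i)

lemma sum_simplexCoord (n : ℕ) : ∑ i, (simplexCoord i : SimplexRing k n) = 1 := by
  have := Ideal.Quotient.eq.2 (Ideal.subset_span
    (Set.mem_singleton (∑ i, (MvPolynomial.X i : MvPolynomial (Fin (n + 1)) k) - 1)))
  simpa [simplexCoord, map_sum] using this

/-- The `k`-algebra homomorphism `x_j ↦ ∑_{θ i = j} x_i` induced by `θ : [n] → [m]`. -/
def simplexMap {n m : ℕ} (θ : Fin (n + 1) → Fin (m + 1)) : SimplexRing k m →ₐ[k] SimplexRing k n :=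
  Ideal.Quotient.liftₐ _ (MvPolynomial.aeval fun j => ∑ i with θ i = j, simplexCoord i) (by
    have h : Ideal.span {∑ i, (MvPolynomial.X i : MvPolynomial (Fin (m + 1)) k) - 1} ≤
        RingHom.ker (MvPolynomial.aeval (R := k)
          fun j => ∑ i with θ i = j, (simplexCoord i : SimplexRing k n)) := by
      rw [Ideal.span_singleton_le_iff_mem, RingHom.mem_ker]
      simp only [map_sub, map_sum, MvPolynomial.aeval_X, map_one]
      rw [Finset.sum_fiberwise, sum_simplexCoord, sub_self]
    exact fun a ha => h ha)

lemma simplexMap_coord {n m : ℕ} (θ : Fin (n + 1) → Fin (m + 1)) (j : Fin (m + 1)) :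
    simplexMap k θ (simplexCoord j) = ∑ i with θ i = j, simplexCoord i := by
  refine (Ideal.Quotient.liftₐ_apply _ _ _ _).trans ?_
  refine (Ideal.Quotient.lift_mk _ _ _).trans ?_
  exact MvPolynomial.aeval_X _ _

variable {k} in
lemma simplexRing_hom_ext {n : ℕ} {A : Type u} [CommRing A] [Algebra k A]
    {α β : SimplexRing k n →ₐ[k] A} (h : ∀ i, α (simplexCoord i) = β (simplexCoord i)) : α = β :=
  Ideal.Quotient.algHom_ext _ (MvPolynomial.algHom_ext h)

/-- The cosimplicial scheme `Δ^•` over `k`. -/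
def simplex : SimplexCategory ⥤ Scheme.{u} where
  obj n := Spec (.of (SimplexRing k n.len))
  map θ := Spec.map (CommRingCat.ofHom (simplexMap k θ.toOrderHom).toRingHom)
  map_id n := by
    have : simplexMap k (SimplexCategory.Hom.toOrderHom (𝟙 n)) = AlgHom.id k _ :=
      simplexRing_hom_ext fun i => by
        rw [simplexMap_coord]
        simp [Finset.filter_eq']
    rw [this]
    exact Spec.map_id _
  map_comp {n m l} θ θ' := by
    have : simplexMap k (SimplexCategory.Hom.toOrderHom (θ ≫ θ')) =
        (simplexMap k θ.toOrderHom).comp (simplexMap k θ'.toOrderHom) :=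
      simplexRing_hom_ext fun i => by
        rw [AlgHom.comp_apply, simplexMap_coord, simplexMap_coord, map_sum]
        simp only [simplexMap_coord]
        rw [Finset.sum_fiberwise_eq_sum_filter]
        simp
    rw [this, ← Spec.map_comp]
    rfl

/-- The projection `Δ⁰ ⟶ Spec k`. -/
def simplexProj : (simplex k).obj (.mk 0) ⟶ Spec (.of k) :=
  Spec.map (CommRingCat.ofHom (algebraMap k (SimplexRing k 0)))

/-- The complex `C_* ℤF^cob(pt, 𝔾_m^∧m)`, that is, the complex associated to the simplicial
abelian group `n ↦ ℤF^cob(Δⁿ, 𝔾_m^∧m)`, where `pt = Spec k`. -/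
def wedgeComplex (m : ℕ) : ChainComplex AddCommGrpCat.{u + 1} ℕ :=
  (AlgebraicTopology.alternatingFaceMapComplex AddCommGrpCat.{u + 1}).obj
    ((simplex k).op ⋙ wedgePresheaf m)

/-- The group `H⁰(C_* ℤF^cob(pt, 𝔾_m^∧m))`. -/
abbrev H0 (m : ℕ) : Type (u + 1) := (wedgeComplex k m).homology 0

/-- The class in `H⁰(C_* ℤF^cob(pt, 𝔾_m^∧m))` of an element of `ℤF^cob(pt, 𝔾_m^∧m)`. -/
def homologyClass (m : ℕ) : ZFWedge m (Spec (.of k)) →+ H0 k m :=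
  ((wedgeComplex k m).pOpcycles 0 ≫ (wedgeComplex k m).isoHomologyι₀.inv).hom.comp
    (ZFWedge.pull m (simplexProj k))

/-- The class in `H⁰(C_* ℤF^cob(pt, 𝔾_m^∧m))` of an explicit correspondence from `pt` to `𝔾_m^m`:
pass to the stable class, project to the direct summand, and take the homology class. -/
def cls {n N m : ℕ} (c : PreFr n N (Spec (.of k)) (Gm m)) : H0 k m :=
  homologyClass k m (toWedge m _ (ZF.mk c))

end Simplex

section Milnor

variable (k : Type u) [Field k]

/-- The Steinberg relations `a ⊗ b = 0` for units `a`, `b` with `a + b = 1` in the tensor algebra of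
the abelian group `kˣ`. -/
inductive SteinbergRel : TensorAlgebra ℤ (Additive kˣ) → TensorAlgebra ℤ (Additive kˣ) → Prop
  | intro (a b : kˣ) (h : (a : k) + b = 1) : SteinbergRel
      (TensorAlgebra.ι ℤ (Additive.ofMul a) * TensorAlgebra.ι ℤ (Additive.ofMul b)) 0

/-- The Milnor K-theory ring of `k`. -/
def MilnorRing : Type u := RingQuot (SteinbergRel k)

instance : Ring (MilnorRing k) := inferInstanceAs (Ring (RingQuot (SteinbergRel k)))

instance : Algebra ℤ (MilnorRing k) := inferInstanceAs (Algebra ℤ (RingQuot (SteinbergRel k)))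

/-- The homomorphism `a ↦ {a}` from `kˣ`. -/
def milnorι : Additive kˣ →ₗ[ℤ] MilnorRing k :=
  (RingQuot.mkAlgHom ℤ (SteinbergRel k)).toLinearMap ∘ₗ TensorAlgebra.ι ℤ

/-- The `m`-th Milnor K-group, the part of degree `m` of the Milnor K-theory ring. -/
abbrev KM (m : ℕ) : Submodule ℤ (MilnorRing k) := LinearMap.range (milnorι k) ^ m

variable {k} in
/-- The symbol `{g_1, …, g_m}`. -/
def symbol {m : ℕ} (g : Fin m → kˣ) : KM k m :=
  ⟨(List.ofFn fun i => milnorι k (Additive.ofMul (g i))).prod, by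
    have := SetLike.list_prod_ofFn_mem_graded (A := KM k) (fun _ : Fin m => 1)
      (fun i => milnorι k (Additive.ofMul (g i))) (fun i => by
        rw [KM, pow_one]
        exact ⟨_, rfl⟩)
    simpa using this⟩

variable {k} in
/-- The map `pt ⟶ 𝔾_m^m` with coordinates `(g_1, …, g_m)`. -/
def point {m : ℕ} (g : Fin m → kˣ) : (Gm.{u} m).obj (op (Spec (.of k))) :=
  fun i => Units.map (Scheme.ΓSpecIso (.of k)).inv.hom (g i)

end Milnor

end CobFr

end

open CobFr

/-! The group `H⁰` is the quotient of the linear correspondences `pt → 𝔾_m^m` by the degenerate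
ones, in which some coordinate is replaced by `1`, and by homotopies over the interval. One needs
enough homotopies to make the external product well defined, and then the relations of Milnor
K-theory between classes of rational points.

The product. Stabilisation, commutativity and associativity hold only up to reordering coordinates
of the affine space and basis vectors of the free module. Two invariance properties absorb this. The
class does not depend on the epimorphism `q` onto `E` (`cls_reframe`): on twice as many basis
vectors, `(q, 0)` is deformed through `(q, q')` into `(0, q')`. The class does not change when the
affine coordinates are permuted (`cls_move_reorder`): a transposition is a rotation followed by a
sign, a rotation is a product of shears and so homotopic to the identity, and a sign can be rotated
into a stabilisation coordinate, where it is only a change of epimorphism. This yields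
`cls_mul_comm` and `cls_mul_assoc`, and from them the graded ring.

Symbols. A monic polynomial `P` prime to the entries of a tuple `G` gives a correspondence: its
support is the zero set of `P`, its section is `P`, its map is `G`. The class is additive in coprime
factors, and `X - a` gives the point `G(a)`. If each `G i` divides `X - c i`, linear interpolation
shows that the class depends only on the degree of `P` and the nonzero values `P(c i)`
(`exists_polynomial_cls`). For `G = (X, …, X)` the comparison of `(X - a)(X - b)` with `(X - ab)(X -
1)` shows that the class of the diagonal point is a homomorphism in `a`. For `m = 1` this is
additivity of `a ↦ {a}`; for `m = 2` it yields `{a}{b} = -{b}{a}`.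

The Steinberg relation. Put `G = (X, 1 - X)` and `S(a) = {a}{1 - a}`, the class of `X - a`. Let
`f(u, v)` and `f'(u, v)` be the classes of monic polynomials of degree `3` and `4` with values `u`
at `0` and `v` at `1`. Multiplication by `X - a` gives `f'(-a u, (1 - a) v) = S(a) + f(u, v)`. This
equation alone forces `S(a) = c + α(a) + β(1 - a)` with homomorphisms `α`, `β`; bilinearity and
antisymmetry of the product then make `α`, `β` and `c` vanish (`steinberg_of_interpolation`).
Characteristic zero enters through the infinity of the field and through small integers that must be
invertible. -/

noncomputable section
namespace CobFr

/-! ### `H⁰` as the quotient by degenerate correspondences and homotopies. -/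

namespace ZF

variable {X : Scheme.{u}} {Y Y' Y'' : Scheme.{u}ᵒᵖ ⥤ Type u}

lemma push_push (a : Y ⟶ Y') (b : Y' ⟶ Y'') (x : ZF X Y) :
    push b (push a x) = push (a ≫ b) x := by
  refine DFunLike.congr_fun (f := (push b).comp (push a)) (g := push (a ≫ b)) ?_ x
  refine hom_ext fun n N c => ?_
  rw [AddMonoidHom.comp_apply, push_mk, push_mk, push_mk]
  rfl

lemma mk_eq_of_rel {n N : ℕ} {c d : PreFr n N X Y} (h : PreFr.Rel c d) : mk c = mk d := by
  rw [mk, StableFr.mk_eq_of_rel h, mk]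

lemma mk_stabn {n N : ℕ} (c : PreFr n N X Y) : mk c.stabn = mk c :=
  congrArg (fun x => (QuotientAddGroup.mk (FreeAbelianGroup.of x) : ZF X Y))
    (Quot.sound (StabRel.stabn n N (Fr.mk c))).symm

lemma mk_stabN {n N : ℕ} (c : PreFr n N X Y) : mk c.stabN = mk c :=
  congrArg (fun x => (QuotientAddGroup.mk (FreeAbelianGroup.of x) : ZF X Y))
    (Quot.sound (StabRel.stabN n N (Fr.mk c))).symm

lemma mk_add_mk {n N : ℕ} {a b c : PreFr n N X Y} (h : PreFr.IsDisjUnion a b c) :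
    mk a + mk b = mk c := by
  rw [← sub_eq_zero]
  exact (QuotientAddGroup.eq_zero_iff _).2
    (AddSubgroup.subset_closure ⟨n, N, a, b, c, h, rfl⟩)

end ZF

lemma Gm.setOne_setOne_self (m : ℕ) (i : Fin m) :
    Gm.setOne.{u} m i ≫ Gm.setOne m i = Gm.setOne m i := by
  ext W g
  exact Function.update_idem _ _ _

lemma Gm.setOne_comm (m : ℕ) (i j : Fin m) :
    Gm.setOne.{u} m i ≫ Gm.setOne m j = Gm.setOne m j ≫ Gm.setOne m i := by
  rcases eq_or_ne i j with rfl | h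
  · rfl
  · ext W g
    exact Function.update_comm h (1 : Γ(unop W, ⊤)ˣ) 1 g

lemma eIdem_mul_self (m : ℕ) (X : Scheme.{u}) (i : Fin m) :
    eIdem m X i * eIdem m X i = eIdem m X i := by
  ext1 x
  exact (ZF.push_push _ _ x).trans (by rw [Gm.setOne_setOne_self]; rfl)

lemma commute_eIdem (m : ℕ) (X : Scheme.{u}) (i j : Fin m) :
    Commute (eIdem m X i) (eIdem m X j) := by
  ext1 x
  refine (ZF.push_push _ _ x).trans (Eq.trans ?_ (ZF.push_push _ _ x).symm)
  rw [Gm.setOne_comm]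

/-- The `eIdem` are commuting idempotents, so `eIdem m X i` can be moved next to the factor `1 -
eIdem m X i`, which it annihilates. -/
lemma wedgeIdem_mul_eIdem (m : ℕ) (X : Scheme.{u}) (i : Fin m) :
    wedgeIdem m X * eIdem m X i = 0 := by
  rw [wedgeIdem, List.ofFn_eq_map]
  have key : ∀ l : List (Fin m), i ∈ l → (l.map fun j => 1 - eIdem m X j).prod * eIdem m X i = 0 := by
    intro l hl
    induction l with
    | nil => simp at hl
    | cons j l ih =>
      rw [List.map_cons, List.prod_cons]
      by_cases hil : i ∈ l
      · rw [mul_assoc, ih hil, mul_zero]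
      · obtain rfl : i = j := by simpa [hil] using hl
        have hc : Commute (l.map fun j => 1 - eIdem m X j).prod (eIdem m X i) :=
          (Commute.list_prod_right _ _ fun y hy => by
            obtain ⟨j, -, rfl⟩ := List.mem_map.1 hy
            exact (Commute.one_right _).sub_right (commute_eIdem m X i j)).symm
        rw [mul_assoc, hc.eq, ← mul_assoc, sub_mul, one_mul, eIdem_mul_self, sub_self, zero_mul]
  exact key _ (List.mem_finRange i)

section

variable (k : Type u) [Field k]

/-- The homology class of the projection to the direct summand, on all of `ℤF^cob(pt, 𝔾_m^m)`. -/
def clsHom (m : ℕ) : ZF (Spec (.of k)) (Gm m) →+ H0 k m :=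
  (homologyClass k m).comp (toWedge m _)

lemma cls_eq {n N m : ℕ} (c : PreFr n N (Spec (.of k)) (Gm m)) :
    cls k c = clsHom k m (ZF.mk c) := rfl

/-- Degenerate correspondences die in the projection to the summand. This is why symbols with an
entry `1` vanish. -/
lemma clsHom_push_setOne (m : ℕ) (i : Fin m) (x : ZF (Spec (.of k)) (Gm m)) :
    clsHom k m (ZF.push (Gm.setOne m i) x) = 0 := by
  have h : toWedge m (Spec (.of k)) (ZF.push (Gm.setOne m i) x) = 0 :=
    Subtype.ext (DFunLike.congr_fun (wedgeIdem_mul_eIdem m (Spec (.of k)) i) x)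
  rw [clsHom, AddMonoidHom.comp_apply, h, map_zero]

lemma simplexCoord_zero_eq_one (i : Fin 1) : (simplexCoord i : SimplexRing k 0) = 1 := by
  have := sum_simplexCoord (k := k) 0
  rw [Fin.sum_univ_one] at this
  rw [Subsingleton.elim i 0, this]

/-- The inverse of the structure map `k ⟶ k[x_0] / (x_0 - 1)`. -/
def simplexEval : SimplexRing k 0 →ₐ[k] k :=
  Ideal.Quotient.liftₐ _ (MvPolynomial.aeval fun _ => 1) (by
    have h : Ideal.span {∑ i, (MvPolynomial.X i : MvPolynomial (Fin 1) k) - 1} ≤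
        RingHom.ker (MvPolynomial.aeval (R := k) fun _ : Fin 1 => (1 : k)) := by
      rw [Ideal.span_singleton_le_iff_mem, RingHom.mem_ker]
      simp
    exact fun a ha => h ha)

lemma simplexEval_coord (i : Fin 1) : simplexEval k (simplexCoord i) = 1 := by
  rw [simplexCoord_zero_eq_one, map_one]

lemma ofId_comp_simplexEval : (Algebra.ofId k (SimplexRing k 0)).comp (simplexEval k) =
    AlgHom.id k _ :=
  simplexRing_hom_ext fun i => by
    rw [AlgHom.comp_apply, simplexEval_coord, map_one, AlgHom.id_apply, simplexCoord_zero_eq_one]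

/-- The inverse of the projection `Δ⁰ ⟶ Spec k`. -/
def simplexSection : Spec (.of k) ⟶ (simplex k).obj (.mk 0) :=
  Spec.map (CommRingCat.ofHom (simplexEval k).toRingHom)

lemma simplexProj_simplexSection : simplexProj k ≫ simplexSection k = 𝟙 _ := by
  refine (Spec.map_comp _ _).symm.trans (Eq.trans ?_ (Spec.map_id _))
  exact congrArg (fun f : SimplexRing k 0 →ₐ[k] SimplexRing k 0 =>
    Spec.map (CommRingCat.ofHom f.toRingHom)) (ofId_comp_simplexEval k)

lemma simplexSection_simplexProj : simplexSection k ≫ simplexProj k = 𝟙 _ := by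
  refine (Spec.map_comp _ _).symm.trans (Eq.trans ?_ (Spec.map_id _))
  congr 1
  ext x
  exact (simplexEval k).commutes x

/-- The coordinate ring of the interval. -/
abbrev IntervalRing : CommRingCat.{u} := .of (SimplexRing k 1)

/-- The coordinate function on the interval. -/
abbrev intervalCoord : IntervalRing k := (simplexCoord 1 : SimplexRing k 1)

/-- The endpoint of the interval opposite to the vertex `i`. -/
def intervalEval (i : Fin 2) : SimplexRing k 1 →ₐ[k] k :=
  (simplexEval k).comp (simplexMap k (SimplexCategory.δ i).toOrderHom)

/-- The face `δ 0` lands on the vertex `1`. Hence the parameter `x_1` is `1` at endpoint `0` and `0`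
at endpoint `1`, and the homotopies below run from parameter value `1` to `0`. -/
lemma intervalEval_zero_coord : intervalEval k 0 (intervalCoord k) = 1 := by
  rw [intervalEval, AlgHom.comp_apply, intervalCoord, simplexMap_coord, map_sum]
  simp only [simplexEval_coord]
  rw [Finset.sum_const, Finset.card_eq_one.2 ⟨0, ?_⟩, one_smul]
  decide

lemma intervalEval_one_coord : intervalEval k 1 (intervalCoord k) = 0 := by
  rw [intervalEval, AlgHom.comp_apply, intervalCoord, simplexMap_coord, map_sum]
  simp only [simplexEval_coord]
  rw [Finset.sum_const, Finset.card_eq_zero.2, zero_smul]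
  decide

/-- The endpoints of the interval, as morphisms of schemes. -/
def endpoint (i : Fin 2) : Spec (.of k) ⟶ Spec (IntervalRing k) :=
  Spec.map (CommRingCat.ofHom (intervalEval k i).toRingHom)

lemma simplexProj_endpoint (i : Fin 2) :
    simplexProj k ≫ endpoint k i = (simplex k).map (SimplexCategory.δ i) := by
  have : endpoint k i = simplexSection k ≫ (simplex k).map (SimplexCategory.δ i) :=
    Spec.map_comp (CommRingCat.ofHom (simplexMap k (SimplexCategory.δ i).toOrderHom).toRingHom)
      (CommRingCat.ofHom (simplexEval k).toRingHom)
  refine (congrArg (simplexProj k ≫ ·) this).trans ?_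
  refine (Category.assoc _ _ _).symm.trans ?_
  refine (congrArg (· ≫ (simplex k).map (SimplexCategory.δ i))
    (simplexProj_simplexSection k)).trans ?_
  exact Category.id_comp _

lemma simplexSection_map (i : Fin 2) :
    simplexSection k ≫ (simplex k).map (SimplexCategory.δ i) = endpoint k i :=
  (Spec.map_comp (CommRingCat.ofHom (simplexMap k (SimplexCategory.δ i).toOrderHom).toRingHom)
    (CommRingCat.ofHom (simplexEval k).toRingHom)).symm

lemma wedgeComplex_d (m : ℕ) (x : ZFWedge m (Spec (IntervalRing k))) :
    ((wedgeComplex k m).d 1 0).hom x = ZFWedge.pull m ((simplex k).map (SimplexCategory.δ 0)) x -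
      ZFWedge.pull m ((simplex k).map (SimplexCategory.δ 1)) x := by
  have : (wedgeComplex k m).d 1 0 = AlgebraicTopology.AlternatingFaceMapComplex.objD
    ((simplex k).op ⋙ wedgePresheaf m) 0 := AlgebraicTopology.AlternatingFaceMapComplex.obj_d_eq _ 0
  rw [this, AlgebraicTopology.AlternatingFaceMapComplex.objD]
  simp [Fin.sum_univ_two, sub_eq_add_neg]
  rfl

/-- Once `Δ⁰` is identified with the point, the difference of the two sides is the class of the
boundary of the `1`-chain `x`. -/
lemma homologyClass_pull_endpoint (m : ℕ) (x : ZFWedge m (Spec (IntervalRing k))) :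
    homologyClass k m (ZFWedge.pull m (endpoint k 0) x) =
      homologyClass k m (ZFWedge.pull m (endpoint k 1) x) := by
  have key : ∀ i, ZFWedge.pull m (simplexProj k) (ZFWedge.pull m (endpoint k i) x) =
      ZFWedge.pull m ((simplex k).map (SimplexCategory.δ i)) x := fun i => by
    rw [← simplexProj_endpoint]
    exact Subtype.ext (DFunLike.congr_fun (ZF.pull_comp _ _) x.1).symm
  have hd : ((wedgeComplex k m).d 1 0 ≫ (wedgeComplex k m).pOpcycles 0 ≫
      (wedgeComplex k m).isoHomologyι₀.inv).hom x = 0 := by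
    rw [HomologicalComplex.d_pOpcycles_assoc, zero_comp]
    rfl
  rw [← sub_eq_zero, ← map_sub]
  refine Eq.trans (congrArg ((wedgeComplex k m).pOpcycles 0 ≫
    (wedgeComplex k m).isoHomologyι₀.inv).hom ?_) hd
  refine Eq.trans ?_ (wedgeComplex_d k m x).symm
  exact (map_sub (ZFWedge.pull m (simplexProj k)) _ _).trans (congrArg₂ (· - ·) (key 0) (key 1))

lemma toWedge_pull (m : ℕ) {X X' : Scheme.{u}} (f : X' ⟶ X) (x : ZF X (Gm m)) :
    toWedge m X' (ZF.pull f x) = ZFWedge.pull m f (toWedge m X x) :=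
  Subtype.ext (pull_wedgeIdem m f x).symm

/-- Homotopic correspondences have the same class. -/
lemma clsHom_pull_endpoint (m : ℕ) (x : ZF (Spec (IntervalRing k)) (Gm m)) :
    clsHom k m (ZF.pull (endpoint k 0) x) = clsHom k m (ZF.pull (endpoint k 1) x) := by
  rw [clsHom, AddMonoidHom.comp_apply, AddMonoidHom.comp_apply, toWedge_pull, toWedge_pull,
    homologyClass_pull_endpoint]

/-- In degree `0` homology is chains modulo boundaries, and every chain over `Δ⁰` comes from `pt`
because `simplexSection` is inverse to `simplexProj`. -/
lemma homologyClass_surjective (m : ℕ) : Function.Surjective (homologyClass k m) := by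
  have h : Function.Surjective ((wedgeComplex k m).pOpcycles 0 ≫
      (wedgeComplex k m).isoHomologyι₀.inv).hom :=
    (AddCommGrpCat.epi_iff_surjective _).1 inferInstance
  intro y
  obtain ⟨x, rfl⟩ := h y
  refine ⟨ZFWedge.pull m (simplexSection k) x, ?_⟩
  refine congrArg ((wedgeComplex k m).pOpcycles 0 ≫ (wedgeComplex k m).isoHomologyι₀.inv).hom
    (Subtype.ext ?_)
  refine (DFunLike.congr_fun (ZF.pull_comp (simplexSection k) (simplexProj k)) _).symm.trans ?_
  refine (congrArg (fun f => ZF.pull f x.1) (simplexProj_simplexSection k)).trans ?_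
  exact DFunLike.congr_fun ZF.pull_id _

lemma clsHom_surjective (m : ℕ) : Function.Surjective (clsHom k m) :=
  (homologyClass_surjective k m).comp (AddMonoidHom.rangeRestrict_surjective _)

/-- Each factor `1 - e_i` changes its argument by an element of the image of `e_i`, where `ψ`
vanishes. -/
lemma wedgeIdem_apply_of_kills {m : ℕ} {X : Scheme.{u}} {M : Type*} [AddCommGroup M]
    (ψ : ZF X (Gm m) →+ M) (h : ∀ i x, ψ (ZF.push (Gm.setOne m i) x) = 0) (x : ZF X (Gm m)) :
    ψ (wedgeIdem m X x) = ψ x := by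
  rw [wedgeIdem, List.ofFn_eq_map]
  induction List.finRange m with
  | nil => rfl
  | cons i l ih =>
    rw [List.map_cons, List.prod_cons, ← ih]
    change ψ (_ - ZF.push (Gm.setOne m i) _) = _
    rw [map_sub, h, sub_zero]
    rfl

/-- `H⁰` is the universal quotient in which the degenerate summands vanish and homotopic
correspondences agree. -/
lemma exists_lift_clsHom {m : ℕ} {M : Type (u + 1)} [AddCommGroup M]
    (ψ : ZF (Spec (.of k)) (Gm m) →+ M)
    (h₁ : ∀ i x, ψ (ZF.push (Gm.setOne m i) x) = 0)
    (h₂ : ∀ x, ψ (ZF.pull (endpoint k 0) x) = ψ (ZF.pull (endpoint k 1) x)) :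
    ∃ ψ' : H0 k m →+ M, ∀ x, ψ' (clsHom k m x) = ψ x := by
  -- The chains are only the direct summand over `Δ⁰`; `ψ` is restricted to it and transported along
  -- `Δ⁰ ≅ pt`.
  let ψ₀ : (wedgeComplex k m).X 0 ⟶ AddCommGrpCat.of M := AddCommGrpCat.ofHom
    ((ψ.comp (ZF.pull (simplexSection k))).comp (ZFWedge m ((simplex k).obj (.mk 0))).subtype)
  have hψ₀ : (wedgeComplex k m).d 1 0 ≫ ψ₀ = 0 := by
    ext x
    change ψ₀.hom (((wedgeComplex k m).d 1 0).hom x) = 0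
    refine (congrArg ψ₀.hom (wedgeComplex_d k m x)).trans ?_
    refine (map_sub ψ₀.hom _ _).trans (sub_eq_zero.2 ?_)
    have key : ∀ i, ψ₀.hom (ZFWedge.pull m ((simplex k).map (SimplexCategory.δ i)) x) =
        ψ (ZF.pull (endpoint k i) x.1) := fun i => by
      change ψ (ZF.pull _ (ZF.pull _ x.1)) = _
      refine congrArg ψ ((DFunLike.congr_fun (ZF.pull_comp _ _) x.1).symm.trans ?_)
      exact congrArg (fun f => ZF.pull f x.1) (simplexSection_map k i)
    exact (key 0).trans ((h₂ _).trans (key 1).symm)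
  refine ⟨((wedgeComplex k m).isoHomologyι₀.hom ≫
    (wedgeComplex k m).descOpcycles ψ₀ 1 (by simp) hψ₀).hom, fun x => ?_⟩
  have hp : ((wedgeComplex k m).pOpcycles 0 ≫ (wedgeComplex k m).isoHomologyι₀.inv) ≫
      (wedgeComplex k m).isoHomologyι₀.hom ≫
      (wedgeComplex k m).descOpcycles ψ₀ 1 (by simp) hψ₀ = ψ₀ := by
    simp only [Category.assoc, Iso.inv_hom_id_assoc, HomologicalComplex.p_descOpcycles]
  refine (congrArg (fun f => f.hom (ZFWedge.pull m (simplexProj k) (toWedge m _ x))) hp).trans ?_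
  -- The projection to the summand remains; `ψ` does not see it because it kills degenerate
  -- elements.
  change ψ (ZF.pull _ (ZF.pull _ (wedgeIdem m _ x))) = _
  rw [← AddMonoidHom.comp_apply (ZF.pull _), ← ZF.pull_comp, simplexSection_simplexProj,
    ZF.pull_id, AddMonoidHom.id_apply, wedgeIdem_apply_of_kills ψ h₁]

/-- Every element of `H⁰` comes from `ℤF^cob(pt, 𝔾_m^m)`, which is generated by explicit
correspondences. -/
lemma H0_hom_ext {m : ℕ} {M : Type*} [AddCommGroup M] {α β : H0 k m →+ M}
    (h : ∀ (n N : ℕ) (c : PreFr n N (Spec (.of k)) (Gm m)), α (cls k c) = β (cls k c)) :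
    α = β := by
  have : α.comp (clsHom k m) = β.comp (clsHom k m) := ZF.hom_ext h
  ext x
  obtain ⟨x, rfl⟩ := clsHom_surjective k m x
  exact DFunLike.congr_fun this x

end

end CobFr
end

/-! ### Independence of the class from the epimorphism onto the bundle. -/

noncomputable section
namespace CobFr

namespace TauPoint

variable {R S : Type u} [CommRing R] [CommRing S] {n N N' : ℕ}

lemma ext_of_forall {p q : TauPoint R n N}
    (h₁ : ∀ v, v ∈ p.quot.toSubmodule ↔ v ∈ q.quot.toSubmodule)
    (h₂ : ∀ v, p.quot.toSubmodule.mkQ v = p.sec → q.quot.toSubmodule.mkQ v = q.sec) : p = q := by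
  obtain ⟨⟨K, a, b, c⟩, s⟩ := p
  obtain ⟨⟨K', a', b', c'⟩, s'⟩ := q
  obtain rfl : K = K' := Submodule.ext h₁
  obtain ⟨v, rfl⟩ := Submodule.mkQ_surjective _ s
  have h : K.mkQ v = s' := h₂ v rfl
  exact congrArg (TauPoint.mk _) h

lemma IsBaseChange.mkQ_eq {f : R →+* S} {p : TauPoint R n N} {p' : TauPoint S n N}
    (h : p.IsBaseChange f p') {v w : Fin n ⊕ Fin N → R}
    (hvw : p.quot.toSubmodule.mkQ v = p.quot.toSubmodule.mkQ w) :
    p'.quot.toSubmodule.mkQ (f ∘ v) = p'.quot.toSubmodule.mkQ (f ∘ w) := by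
  have hm : v - w ∈ p.quot.toSubmodule := (Submodule.Quotient.eq _).1 hvw
  refine (Submodule.Quotient.eq _).2 ?_
  rw [h.1]
  refine Submodule.subset_span ⟨v - w, hm, ?_⟩
  ext j
  simp

/-- The same vector bundle and section with another epimorphism from a free module. -/
def reframe (p : TauPoint R n N)
    (q : (Fin n ⊕ Fin N' → R) →ₗ[R] ((Fin n ⊕ Fin N → R) ⧸ p.quot.toSubmodule))
    (hq : Function.Surjective q) : TauPoint R n N' :=
  ofEpi p.quot.rankAtStalk_eq q hq p.sec

lemma mem_reframe (p : TauPoint R n N)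
    (q : (Fin n ⊕ Fin N' → R) →ₗ[R] ((Fin n ⊕ Fin N → R) ⧸ p.quot.toSubmodule))
    (hq : Function.Surjective q) (v : Fin n ⊕ Fin N' → R) :
    v ∈ (p.reframe q hq).quot.toSubmodule ↔ q v = 0 := Iff.rfl

lemma mkQ_eq_reframe_sec (p : TauPoint R n N)
    (q : (Fin n ⊕ Fin N' → R) →ₗ[R] ((Fin n ⊕ Fin N → R) ⧸ p.quot.toSubmodule))
    (hq : Function.Surjective q) (v : Fin n ⊕ Fin N' → R) :
    (p.reframe q hq).quot.toSubmodule.mkQ v = (p.reframe q hq).sec ↔ q v = p.sec :=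
  mkQ_eq_ofEpi_sec _ _ _ _ _

lemma reframe_sec_eq_zero (p : TauPoint R n N)
    (q : (Fin n ⊕ Fin N' → R) →ₗ[R] ((Fin n ⊕ Fin N → R) ⧸ p.quot.toSubmodule))
    (hq : Function.Surjective q) : (p.reframe q hq).sec = 0 ↔ p.sec = 0 :=
  ofEpi_sec_eq_zero _ _ _ _

/-- Right exactness of base change: the kernel of `q'` must be generated by the kernel of `q`. Let
`K` be the submodule so generated. A map `E' → S ^ (n + N') / K` is constructed whose composite with
`q'` is the projection, and this gives `ker q' ≤ K`. -/
lemma IsBaseChange.reframe {f : R →+* S} {p : TauPoint R n N} {p' : TauPoint S n N}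
    (h : p.IsBaseChange f p')
    {q : (Fin n ⊕ Fin N' → R) →ₗ[R] ((Fin n ⊕ Fin N → R) ⧸ p.quot.toSubmodule)}
    {q' : (Fin n ⊕ Fin N' → S) →ₗ[S] ((Fin n ⊕ Fin N → S) ⧸ p'.quot.toSubmodule)}
    (hq : Function.Surjective q) (hq' : Function.Surjective q')
    (hc : ∀ v w, q v = p.quot.toSubmodule.mkQ w → q' (f ∘ v) = p'.quot.toSubmodule.mkQ (f ∘ w)) :
    (p.reframe q hq).IsBaseChange f (p'.reframe q' hq') := by
  have hK : ∀ v, q v = 0 → q' (f ∘ v) = 0 := fun v hv => by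
    rw [hc v 0 (by rw [hv, map_zero])]
    have : f ∘ (0 : Fin n ⊕ Fin N → R) = 0 := by ext j; simp
    rw [this, map_zero]
  refine ⟨le_antisymm (fun w hw => ?_) (Submodule.span_le.2 ?_), fun v hv => ?_⟩
  · rw [mem_reframe] at hw
    set K := Submodule.span S ((fun v => f ∘ v) '' ((p.reframe q hq).quot.toSubmodule :
      Set (Fin n ⊕ Fin N' → R)))
    -- `β` lifts the given projection onto `E` through the new epimorphism `q`; free modules are
    -- projective.
    obtain ⟨β, hβ⟩ := Module.projective_lifting_property q p.quot.toSubmodule.mkQ hq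
    have hβ' : ∀ v, q (β v) = p.quot.toSubmodule.mkQ v := fun v => DFunLike.congr_fun hβ v
    -- `B` is the base change of `β` modulo `K`, defined by mapping the entries of its matrix. It
    -- factors through `E'` because the kernel of the projection onto `E'` is generated by vectors
    -- coming from `R`.
    let B : (Fin n ⊕ Fin N → S) →ₗ[S] ((Fin n ⊕ Fin N' → S) ⧸ K) :=
      K.mkQ ∘ₗ Matrix.toLin' ((LinearMap.toMatrix' β).map f)
    have hB : ∀ v, B (f ∘ v) = K.mkQ (f ∘ β v) := fun v => by
      simp only [B, LinearMap.comp_apply, Matrix.toLin'_apply]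
      congr 1
      ext i
      rw [← RingHom.map_mulVec, LinearMap.toMatrix'_mulVec]
      rfl
    have hBK : p'.quot.toSubmodule ≤ LinearMap.ker B := by
      rw [h.1, Submodule.span_le]
      rintro _ ⟨v, hv, rfl⟩
      refine LinearMap.mem_ker.2 ((hB v).trans ?_)
      refine (Submodule.Quotient.mk_eq_zero _).2 (Submodule.subset_span ⟨β v, ?_, rfl⟩)
      refine (mem_reframe _ _ _ _).2 ((hβ' v).trans ?_)
      exact (Submodule.Quotient.mk_eq_zero _).2 hv
    -- Both sides are linear, so standard basis vectors suffice, and these come from `R`.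
    have key : (p'.quot.toSubmodule.liftQ B hBK) ∘ₗ q' = K.mkQ := by
      refine LinearMap.pi_ext' fun j => LinearMap.ext_ring ?_
      simp only [LinearMap.comp_apply, LinearMap.coe_single]
      have hj : (Pi.single j 1 : Fin n ⊕ Fin N' → S) = f ∘ (Pi.single j 1) := by
        ext i
        simp only [Function.comp_apply, Pi.single_apply]
        split_ifs <;> simp
      obtain ⟨w, hw⟩ := Submodule.mkQ_surjective _ (q (Pi.single j 1))
      rw [hj, hc _ w hw.symm, Submodule.mkQ_apply, Submodule.liftQ_apply, hB]
      refine (Submodule.Quotient.eq _).2 (Submodule.subset_span ⟨β w - Pi.single j 1, ?_, ?_⟩)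
      · refine (mem_reframe _ _ _ _).2 ?_
        rw [map_sub, hβ', hw, sub_self]
      · ext i
        simp
    have := DFunLike.congr_fun key w
    rw [LinearMap.comp_apply, hw, map_zero] at this
    exact (Submodule.Quotient.mk_eq_zero _).1 this.symm
  · rintro _ ⟨v, hv, rfl⟩
    exact (mem_reframe _ _ _ _).2 (hK v ((mem_reframe _ _ _ _).1 hv))
  · rw [mkQ_eq_reframe_sec] at hv ⊢
    obtain ⟨w, hw⟩ := Submodule.mkQ_surjective _ p.sec
    rw [hc v w (by rw [hv, hw])]
    exact h.2 w hw

end TauPoint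

/-- An epimorphism `O ^ (n + N') ↠ E` onto the bundle `E` of the map `φ : W ⟶ τ`. -/
structure Framing {W : Scheme.{u}} {n N : ℕ} (φ : TauMap W n N) (N' : ℕ) where
  q : ∀ (R : CommRingCat.{u}) (x : Spec R ⟶ W),
    (Fin n ⊕ Fin N' → R) →ₗ[R] ((Fin n ⊕ Fin N → R) ⧸ (φ.pt R x).quot.toSubmodule)
  surjective : ∀ R x, Function.Surjective (q R x)
  compat : ∀ {R S : CommRingCat.{u}} (f : R ⟶ S) (x : Spec R ⟶ W) (v w),
    q R x v = (φ.pt R x).quot.toSubmodule.mkQ w →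
    q S (Spec.map f ≫ x) (f.hom ∘ v) =
      (φ.pt S (Spec.map f ≫ x)).quot.toSubmodule.mkQ (f.hom ∘ w)

namespace TauMap

variable {W W' : Scheme.{u}} {n N N' : ℕ}

lemma mem_zero {R : CommRingCat.{u}} (x : Spec R ⟶ W) (v : Fin 0 ⊕ Fin N → R) :
    v ∈ ((zero W N).pt R x).quot.toSubmodule := by
  unfold zero
  rw [TauPoint.mem_ofEpi]
  rfl

lemma mkQ_eq_zero_sec {R : CommRingCat.{u}} (x : Spec R ⟶ W) (v : Fin 0 ⊕ Fin N → R) :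
    ((zero W N).pt R x).quot.toSubmodule.mkQ v = ((zero W N).pt R x).sec := by
  unfold zero
  rw [TauPoint.mkQ_eq_ofEpi_sec]
  rfl

/-- The map given by the same bundle and section and another epimorphism. -/
def reframe (φ : TauMap W n N) (r : Framing φ N') : TauMap W n N' where
  pt R x := (φ.pt R x).reframe (r.q R x) (r.surjective R x)
  compat f x := (φ.compat f x).reframe _ _ (r.compat f x)

lemma mem_reframe {φ : TauMap W n N} (r : Framing φ N') {R : CommRingCat.{u}} (x : Spec R ⟶ W)
    (v : Fin n ⊕ Fin N' → R) :
    v ∈ ((φ.reframe r).pt R x).quot.toSubmodule ↔ r.q R x v = 0 := Iff.rfl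

lemma mkQ_eq_reframe_sec {φ : TauMap W n N} (r : Framing φ N') {R : CommRingCat.{u}}
    (x : Spec R ⟶ W) (v : Fin n ⊕ Fin N' → R) :
    ((φ.reframe r).pt R x).quot.toSubmodule.mkQ v = ((φ.reframe r).pt R x).sec ↔
      r.q R x v = (φ.pt R x).sec :=
  TauPoint.mkQ_eq_reframe_sec _ _ _ _

/-- Two epimorphisms onto the same bundle with equal values give the same map. -/
lemma reframe_congr {φ : TauMap W n N} {r s : Framing φ N'}
    (h : ∀ R x v, r.q R x v = s.q R x v) : φ.reframe r = φ.reframe s :=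
  TauMap.ext fun R x => TauPoint.ext_of_forall
    (fun v => by rw [mem_reframe, mem_reframe, h])
    (fun v hv => by
      rw [mkQ_eq_reframe_sec] at hv ⊢
      rw [← h, hv])

end TauMap

lemma evalAt_one {W : Scheme.{u}} {R : CommRingCat.{u}} (x : Spec R ⟶ W) : evalAt x 1 = 1 := by
  simp [evalAt]

lemma evalAt_zero {W : Scheme.{u}} {R : CommRingCat.{u}} (x : Spec R ⟶ W) : evalAt x 0 = 0 := by
  simp [evalAt]

lemma evalAt_mul {W : Scheme.{u}} {R : CommRingCat.{u}} (x : Spec R ⟶ W) (a b : Γ(W, ⊤)) :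
    evalAt x (a * b) = evalAt x a * evalAt x b := by
  simp [evalAt]

lemma evalAt_neg {W : Scheme.{u}} {R : CommRingCat.{u}} (x : Spec R ⟶ W) (a : Γ(W, ⊤)) :
    evalAt x (-a) = -evalAt x a := by
  simp [evalAt]

lemma isUnit_evalAt {W : Scheme.{u}} {R : CommRingCat.{u}} (x : Spec R ⟶ W) {a : Γ(W, ⊤)}
    (h : IsUnit a) : IsUnit (evalAt x a) := by
  obtain ⟨b, hb⟩ := h.exists_right_inv
  exact IsUnit.of_mul_eq_one (evalAt x b) (by rw [← evalAt_mul, hb, evalAt_one])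

/-- Two blocks of `n + N` basis vectors inside a basis with `n + (N + (n + N))` elements. -/
def doubleIndex (n N : ℕ) : (Fin n ⊕ Fin N) ⊕ (Fin n ⊕ Fin N) ≃ Fin n ⊕ Fin (N + (n + N)) :=
  (Equiv.sumAssoc _ _ _).trans (Equiv.sumCongr (Equiv.refl _)
    ((Equiv.sumCongr (Equiv.refl _) finSumFinEquiv).trans finSumFinEquiv))

namespace Framing

variable {W W' : Scheme.{u}} {n N : ℕ} {φ : TauMap W n N}

/-- The given epimorphism. -/
def refl (φ : TauMap W n N) : Framing φ N where
  q R x := (φ.pt R x).quot.toSubmodule.mkQ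
  surjective _ _ := Submodule.mkQ_surjective _
  compat f x _ _ h := (φ.compat f x).mkQ_eq h

lemma reframe_refl (φ : TauMap W n N) : φ.reframe (refl φ) = φ :=
  TauMap.ext fun _ _ => TauPoint.ext_of_forall
    (fun v => (TauPoint.mem_reframe _ _ _ v).trans (Submodule.Quotient.mk_eq_zero _))
    (fun v h => (TauPoint.mkQ_eq_reframe_sec _ _ _ v).1 h)

/-- The restriction along `h : W' ⟶ W`. -/
def comp {N' : ℕ} (r : Framing φ N') (h : W' ⟶ W) : Framing (φ.comp h) N' where
  q R x := r.q R (x ≫ h)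
  surjective R x := r.surjective R (x ≫ h)
  compat f x v w hv := by
    have h1 := r.compat f (x ≫ h) v w hv
    have h2 : Spec.map f ≫ x ≫ h = (Spec.map f ≫ x) ≫ h := (Category.assoc _ _ _).symm
    change r.q _ ((Spec.map f ≫ x) ≫ h) _ = (φ.pt _ ((Spec.map f ≫ x) ≫ h)).quot.toSubmodule.mkQ _
    rwa [← h2]

/-- The linear map `(v, w) ↦ a q(v) + b q'(w)`. -/
def pairMap (r s : Framing φ N) {R : CommRingCat.{u}} (x : Spec R ⟶ W) (a b : R) :
    (Fin n ⊕ Fin (N + (n + N)) → R) →ₗ[R]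
      ((Fin n ⊕ Fin N → R) ⧸ (φ.pt R x).quot.toSubmodule) :=
  a • (r.q R x ∘ₗ LinearMap.funLeft R R (doubleIndex n N ∘ Sum.inl)) +
    b • (s.q R x ∘ₗ LinearMap.funLeft R R (doubleIndex n N ∘ Sum.inr))

lemma pairMap_apply (r s : Framing φ N) {R : CommRingCat.{u}} (x : Spec R ⟶ W) (a b : R)
    (v : Fin n ⊕ Fin (N + (n + N)) → R) : pairMap r s x a b v =
      a • r.q R x (v ∘ doubleIndex n N ∘ Sum.inl) + b • s.q R x (v ∘ doubleIndex n N ∘ Sum.inr) :=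
  rfl

lemma pairMap_surjective (r s : Framing φ N) {R : CommRingCat.{u}} (x : Spec R ⟶ W) (a b : R)
    (h : IsUnit a ∨ IsUnit b) : Function.Surjective (pairMap r s x a b) := by
  intro y
  have key : ∀ v w : Fin n ⊕ Fin N → R,
      pairMap r s x a b (fun j => Sum.elim v w ((doubleIndex n N).symm j)) =
        a • r.q R x v + b • s.q R x w := fun v w => by
    rw [pairMap_apply]
    congr 3 <;> ext j <;> simp
  rcases h with ⟨c, rfl⟩ | ⟨c, rfl⟩
  · obtain ⟨v, hv⟩ := r.surjective R x ((↑c⁻¹ : R) • y)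
    exact ⟨_, (key v 0).trans (by rw [hv, smul_smul, map_zero, smul_zero, add_zero]; simp)⟩
  · obtain ⟨v, hv⟩ := s.surjective R x ((↑c⁻¹ : R) • y)
    exact ⟨_, (key 0 v).trans (by rw [hv, smul_smul, map_zero, smul_zero, zero_add]; simp)⟩

/-- The epimorphism `(a q, b q')` onto `E`, for functions `a`, `b` on `W` one of which is
invertible. -/
def pair (r s : Framing φ N) (a b : Γ(W, ⊤)) (h : IsUnit a ∨ IsUnit b) :
    Framing φ (N + (n + N)) where
  q R x := pairMap r s x (evalAt x a) (evalAt x b)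
  surjective R x := pairMap_surjective r s x _ _ (h.imp (isUnit_evalAt x) (isUnit_evalAt x))
  compat {R S} f x v w hv := by
    obtain ⟨w₁, hw₁⟩ := Submodule.mkQ_surjective _ (r.q R x (v ∘ doubleIndex n N ∘ Sum.inl))
    obtain ⟨w₂, hw₂⟩ := Submodule.mkQ_surjective _ (s.q R x (v ∘ doubleIndex n N ∘ Sum.inr))
    rw [pairMap_apply, ← hw₁, ← hw₂, ← map_smul, ← map_smul, ← map_add] at hv
    rw [← (φ.compat f x).mkQ_eq hv, pairMap_apply, Function.comp_assoc, Function.comp_assoc,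
      r.compat f x _ w₁ hw₁.symm, s.compat f x _ w₂ hw₂.symm, ← map_smul, ← map_smul, ← map_add,
      evalAt_map, evalAt_map]
    congr 1
    ext j
    simp

end Framing

namespace PreFr

variable {n N N' : ℕ} {X X' : Scheme.{u}} {Y : Scheme.{u}ᵒᵖ ⥤ Type u}

/-- The correspondence with the same bundle and section and another epimorphism. -/
abbrev reframe (c : PreFr n N X Y) (r : Framing c.φ N') : PreFr n N' X Y where
  Z := c.Z
  finite := c.finite
  W := c.W
  e := c.e
  nhd := c.nhd
  φ := c.φ.reframe r
  zero_iff K _ y t := (c.zero_iff K y t).trans (TauPoint.reframe_sec_eq_zero _ _ _).symm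
  g := c.g

/-- Functions on `X` as functions on the neighbourhood `W`. -/
def coeff (c : PreFr n N X Y) (a : Γ(X, ⊤)) : Γ(c.W, ⊤) := (c.e ≫ Aff.proj n X).appTop a

lemma coeff_one (c : PreFr n N X Y) : c.coeff 1 = 1 := by
  simp [coeff]

lemma coeff_zero (c : PreFr n N X Y) : c.coeff 0 = 0 := by
  simp [coeff]

lemma isUnit_coeff (c : PreFr n N X Y) {a : Γ(X, ⊤)} (h : IsUnit a) : IsUnit (c.coeff a) :=
  h.map ((c.e ≫ Aff.proj n X).appTop.hom)


/-- The homotopy `(a q, b q')` of epimorphisms, for functions `a` and `b` on the base. -/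
abbrev reframePair (c : PreFr n N X Y) (r s : Framing c.φ N) (a b : Γ(X, ⊤))
    (h : IsUnit a ∨ IsUnit b) : PreFr n (N + (n + N)) X Y :=
  c.reframe (.pair r s (c.coeff a) (c.coeff b) (h.imp c.isUnit_coeff c.isUnit_coeff))

/-- Pulling back along a section `f` of `p : X' ⟶ X` a family of epimorphisms over `X'`. -/
lemma reframePair_pull (c : PreFr n N X Y) (r s : Framing c.φ N) (p : X' ⟶ X) (f : X ⟶ X')
    (hf : f ≫ p = 𝟙 X) (a b : Γ(X', ⊤)) (h : IsUnit a ∨ IsUnit b) (a' b' : Γ(X, ⊤))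
    (h' : IsUnit a' ∨ IsUnit b') (ha : f.appTop a = a') (hb : f.appTop b = b') :
    Rel (((c.pull p).reframePair (r.comp (pullback.fst c.e (Aff.map n p)))
      (s.comp (pullback.fst c.e (Aff.map n p))) a b h).pull f) (c.reframePair r s a' b' h') := by
  -- The twice pulled back neighbourhood maps to `W` over the identity of `𝔸ⁿ_X`, because `f` is a
  -- section of `p`.
  let i : pullback (pullback.snd c.e (Aff.map n p)) (Aff.map n f) ⟶ c.W :=
    pullback.fst _ _ ≫ pullback.fst _ _
  have hi : i ≫ c.e = pullback.snd _ _ := by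
    rw [Category.assoc, pullback.condition, pullback.condition_assoc, ← Aff.map_comp, hf,
      Aff.map_id, Category.comp_id]
  -- On this neighbourhood a coefficient over `X'` becomes its restriction along `f`, so the family
  -- specialises to the pair with coefficients `a'`, `b'`.
  have hcoeff : ∀ d : Γ(X', ⊤), (pullback.fst (pullback.snd c.e (Aff.map n p))
      (Aff.map n f)).appTop ((c.pull p).coeff d) = i.appTop (c.coeff (f.appTop d)) := fun d => by
    simp only [coeff, ← ConcreteCategory.comp_apply, ← Scheme.Hom.comp_appTop]
    congr 3
    rw [← Category.assoc i, ← Category.assoc i, hi, pullback.condition_assoc, Category.assoc,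
      AffineSpace.map_over]
  refine Rel.of_hom ?_ i hi ?_ ?_
  · ext x
    change Aff.map n p (Aff.map n f x) ∈ c.Z ↔ x ∈ c.Z
    rw [← Scheme.Hom.comp_apply, ← Aff.map_comp, hf, Aff.map_id]
    rfl
  · subst ha hb
    refine TauMap.ext fun R x => ?_
    have h1 : ∀ d, evalAt (x ≫ pullback.fst _ _) ((c.pull p).coeff d) =
        evalAt (x ≫ i) (c.coeff (f.appTop d)) := fun d => by
      rw [evalAt_comp, hcoeff, ← evalAt_comp]
    have h2 : (x ≫ pullback.fst _ _) ≫ pullback.fst _ _ = x ≫ i := Category.assoc _ _ _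
    change TauPoint.reframe _ (Framing.pairMap r s ((x ≫ pullback.fst _ _) ≫ pullback.fst _ _)
      (evalAt _ _) (evalAt _ _)) _ = TauPoint.reframe _ (Framing.pairMap r s (x ≫ i) _ _) _
    simp only [h1]
    congr 1
  · simp only [restr_restr]
    rfl


end PreFr

namespace Framing

variable {W : Scheme.{u}} {n N N' : ℕ} {φ : TauMap W n N}

/-- The extension of an epimorphism by zero on `a` new last coordinates. -/
def extend (r : Framing φ N') (a : ℕ) : Framing φ (N' + a) where
  q R x := r.q R x ∘ₗ LinearMap.funLeft R R (Sum.map id (Fin.castAdd a))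
  surjective R x := (r.surjective R x).comp (LinearMap.funLeft_surjective_of_injective R R _
    (Function.injective_id.sumMap (Fin.castAdd_injective _ _)))
  compat f x _ w hv := r.compat f x _ w hv

lemma reframe_extend_zero (r : Framing φ N') : φ.reframe (r.extend 0) = φ.reframe r :=
  TauMap.reframe_congr (s := r) fun R x v => congrArg (r.q R x) (by
    ext j
    rcases j with j | j <;> rfl)

/-- A single new zero is the direct sum with the zero bundle as a quotient of `O ^ (0 + 1)`, and
`swapIndex` puts its basis vector in the last place. -/
lemma reframe_extend_succ (r : Framing φ N') (a : ℕ) :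
    φ.reframe (r.extend (a + 1)) = (φ.reframe (r.extend a)).stab := by
  refine TauMap.ext fun R x => ?_
  have key : ∀ v : Fin n ⊕ Fin (N' + (a + 1)) → R, (r.extend (a + 1)).q R x v =
      (r.extend a).q R x fun j => v (swapIndex n (N' + a) 0 1 (Sum.inl j)) := fun v => by
    simp only [extend, LinearMap.comp_apply]
    congr 1
    ext j
    rcases j with j | j <;> rfl
  refine TauPoint.ext_of_forall (fun v => ?_) (fun v hv => ?_)
  · refine Iff.trans ?_ (TauPoint.mem_prod _ _ _).symm
    rw [TauMap.mem_reframe, TauMap.mem_reframe, key]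
    exact (and_iff_left (TauMap.mem_zero _ _)).symm
  · refine (TauPoint.mkQ_eq_prod_sec _ _ _).2 ?_
    rw [TauMap.mkQ_eq_reframe_sec, key] at hv
    exact ⟨(TauMap.mkQ_eq_reframe_sec _ _ _).2 hv, TauMap.mkQ_eq_zero_sec _ _⟩

end Framing

namespace PreFr

variable {n N N' : ℕ} {X : Scheme.{u}} {Y : Scheme.{u}ᵒᵖ ⥤ Type u}

lemma reframe_congr (c : PreFr n N X Y) {r s : Framing c.φ N'}
    (h : c.φ.reframe r = c.φ.reframe s) : c.reframe r = c.reframe s := by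
  have key : ∀ (φ : TauMap c.W n N') (h₁ : c.φ.reframe r = φ)
      (h₂ : ∀ (K : Type u) [Field K] (y : Spec (.of K) ⟶ c.W) (t : Spec (.of K)),
        (y ≫ c.e) t ∈ c.Z ↔ (φ.pt (.of K) y).sec = 0),
      c.reframe r = ⟨c.Z, c.finite, c.W, c.e, c.nhd, φ, h₂, c.g⟩ := by
    rintro _ rfl _
    rfl
  exact key _ h (c.reframe s).zero_iff

lemma mk_reframe_extend (c : PreFr n N X Y) (r : Framing c.φ N') (a : ℕ) :
    ZF.mk (c.reframe (r.extend a)) = ZF.mk (c.reframe r) := by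
  induction a with
  | zero => exact ZF.mk_eq_of_rel (.of_hom rfl (𝟙 _) (Category.id_comp _)
      ((Framing.reframe_extend_zero r).trans (TauMap.comp_id _).symm) (by simp))
  | succ a ih =>
    rw [← ih, ← ZF.mk_stabN (c.reframe (r.extend a))]
    exact ZF.mk_eq_of_rel (.of_hom (c := c.reframe (r.extend (a + 1)))
      (d := (c.reframe (r.extend a)).stabN) rfl (𝟙 _) (Category.id_comp _)
      ((Framing.reframe_extend_succ r a).trans (TauMap.comp_id _).symm) (by simp))

/-- The epimorphism `(q, 0)` is `q` extended by zero on the `n + N` vectors of the second block,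
hence an iterated stabilisation. -/
lemma mk_reframePair_one_zero (c : PreFr n N X Y) (r s : Framing c.φ N) :
    ZF.mk (c.reframePair r s 1 0 (.inl isUnit_one)) = ZF.mk (c.reframe r) := by
  rw [← mk_reframe_extend c r (n + N)]
  refine congrArg ZF.mk (reframe_congr c (TauMap.reframe_congr fun R x v => ?_))
  refine (Framing.pairMap_apply _ _ _ _ _ _).trans ?_
  rw [coeff_one, coeff_zero, evalAt_one, evalAt_zero, one_smul, zero_smul, add_zero]
  refine congrArg (r.q R x) ?_
  ext j
  rcases j with j | j <;> rfl

/-- The epimorphism `(0, s)` forgets its first entry. Its zeros stand in front and not at the end,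
so it is not visibly a stabilisation of `s`; exchanging the first entry avoids permuting the two
blocks. -/
lemma reframePair_zero_one_congr (c : PreFr n N X Y) (r r' s : Framing c.φ N) :
    c.reframePair r s 0 1 (.inr isUnit_one) = c.reframePair r' s 0 1 (.inr isUnit_one) := by
  refine reframe_congr c (TauMap.reframe_congr fun R x v => ?_)
  refine (Framing.pairMap_apply _ _ _ _ _ _).trans
    (Eq.trans ?_ (Framing.pairMap_apply _ _ _ _ _ _).symm)
  rw [coeff_zero, evalAt_zero, zero_smul, zero_smul]

end PreFr

section

variable (k : Type u) [Field k]

/-- The coordinate function on the interval, as a global section. -/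
def intervalSection : Γ(Spec (IntervalRing k), ⊤) :=
  (Scheme.ΓSpecIso (IntervalRing k)).inv (intervalCoord k)

lemma appTop_ΓSpecIso_inv {A B : CommRingCat.{u}} (f : A ⟶ B) (a : A) :
    (Spec.map f).appTop ((Scheme.ΓSpecIso A).inv a) = (Scheme.ΓSpecIso B).inv (f a) :=
  congr($(Scheme.ΓSpecIso_inv_naturality f) a).symm

lemma endpoint_zero_section : (endpoint k 0).appTop (intervalSection k) = 1 := by
  refine (appTop_ΓSpecIso_inv _ _).trans ?_
  refine (congrArg (Scheme.ΓSpecIso (.of k)).inv (intervalEval_zero_coord k)).trans ?_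
  exact map_one (Scheme.ΓSpecIso (.of k)).inv.hom

lemma endpoint_one_section : (endpoint k 1).appTop (intervalSection k) = 0 := by
  refine (appTop_ΓSpecIso_inv _ _).trans ?_
  refine (congrArg (Scheme.ΓSpecIso (.of k)).inv (intervalEval_one_coord k)).trans ?_
  exact map_zero (Scheme.ΓSpecIso (.of k)).inv.hom

/-- The projection of the interval to the base field. -/
def intervalProj : Spec (IntervalRing k) ⟶ Spec (.of k) :=
  Spec.map (CommRingCat.ofHom (algebraMap k (SimplexRing k 1)))

lemma endpoint_intervalProj (i : Fin 2) : endpoint k i ≫ intervalProj k = 𝟙 _ := by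
  refine (Spec.map_comp _ _).symm.trans (Eq.trans ?_ (Spec.map_id _))
  congr 1
  ext x
  exact (intervalEval k i).commutes x

lemma cls_eq_of_homotopy {n N m : ℕ} (c : PreFr n N (Spec (IntervalRing k)) (Gm m))
    {c₀ c₁ : PreFr n N (Spec (.of k)) (Gm m)} (h₀ : PreFr.Rel (c.pull (endpoint k 0)) c₀)
    (h₁ : PreFr.Rel (c.pull (endpoint k 1)) c₁) : cls k c₀ = cls k c₁ := by
  rw [cls_eq, cls_eq, ← ZF.mk_eq_of_rel h₀, ← ZF.mk_eq_of_rel h₁, ← ZF.pull_mk, ← ZF.pull_mk,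
    clsHom_pull_endpoint]

variable {k}
variable {n N m : ℕ}

lemma cls_eq_of_rel {c d : PreFr n N (Spec (.of k)) (Gm m)} (h : PreFr.Rel c d) :
    cls k c = cls k d := by
  rw [cls_eq, cls_eq, ZF.mk_eq_of_rel h]

/-- The homotopies `(q, t q')` and `(t q, q')` consist of epimorphisms for every value of `t`, since
one coefficient is `1`. They join `(q, 0)` and `(0, q')` to `(q, q')`. -/
lemma cls_reframePair (c : PreFr n N (Spec (.of k)) (Gm m)) (r s : Framing c.φ N) :
    cls k (c.reframePair r s 1 0 (.inl isUnit_one)) =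
      cls k (c.reframePair r s 0 1 (.inr isUnit_one)) := by
  have h₁ : cls k (c.reframePair r s 1 1 (.inl isUnit_one)) =
      cls k (c.reframePair r s 1 0 (.inl isUnit_one)) :=
    cls_eq_of_homotopy k ((c.pull (intervalProj k)).reframePair (r.comp _) (s.comp _) 1
      (intervalSection k) (.inl isUnit_one))
      (PreFr.reframePair_pull c r s _ _ (endpoint_intervalProj k 0) _ _ _ _ _ _ (map_one _)
        (endpoint_zero_section k))
      (PreFr.reframePair_pull c r s _ _ (endpoint_intervalProj k 1) _ _ _ _ _ _ (map_one _)
        (endpoint_one_section k))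
  have h₂ : cls k (c.reframePair r s 1 1 (.inr isUnit_one)) =
      cls k (c.reframePair r s 0 1 (.inr isUnit_one)) :=
    cls_eq_of_homotopy k ((c.pull (intervalProj k)).reframePair (r.comp _) (s.comp _)
      (intervalSection k) 1 (.inr isUnit_one))
      (PreFr.reframePair_pull c r s _ _ (endpoint_intervalProj k 0) _ _ _ _ _ _
        (endpoint_zero_section k) (map_one _))
      (PreFr.reframePair_pull c r s _ _ (endpoint_intervalProj k 1) _ _ _ _ _ _
        (endpoint_one_section k) (map_one _))
  exact h₁.symm.trans h₂

/-- The class of a correspondence depends on its bundle and section, but not on the choice of an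
epimorphism onto the bundle. -/
lemma cls_reframe (c : PreFr n N (Spec (.of k)) (Gm m)) (r : Framing c.φ N) :
    cls k (c.reframe r) = cls k c := by
  -- The chain is `r`, `(r, 0)`, then `(0, s)` seen as an instance of the pair `(r, s)` and as one
  -- of the pair `(s, s)`, then `(s, 0)` and `s`.
  have h : ∀ r s : Framing c.φ N, cls k (c.reframe r) = cls k (c.reframe s) := fun r s => by
    rw [cls_eq, ← PreFr.mk_reframePair_one_zero c r s, ← cls_eq, cls_reframePair,
      PreFr.reframePair_zero_one_congr c r s, ← cls_reframePair, cls_eq,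
      PreFr.mk_reframePair_one_zero, ← cls_eq]
  rw [h r (.refl c.φ)]
  exact cls_eq_of_rel (.of_hom rfl (𝟙 _) (Category.id_comp _)
    ((Framing.reframe_refl _).trans (TauMap.comp_id _).symm) (by simp))

end

end CobFr
end

/-! ### Linear automorphisms of affine space and their homotopies. -/

noncomputable section
namespace CobFr

namespace Aff

variable {n : ℕ} {X X' : Scheme.{u}}

/-- The `i`-th coordinate function on `𝔸ⁿ_X`. -/
abbrev x (X : Scheme.{u}) (i : Fin n) : Γ(Aff n X, ⊤) := AffineSpace.coord X ⟨i⟩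

lemma hom_ext_coord {W : Scheme.{u}} {f g : W ⟶ Aff n X} (h : f ≫ proj n X = g ≫ proj n X)
    (h' : ∀ i : Fin n, f.appTop (x X i) = g.appTop (x X i)) : f = g :=
  AffineSpace.hom_ext h fun i => h' i.down

lemma comp_appTop_apply {U V W : Scheme.{u}} (f : U ⟶ V) (g : V ⟶ W) (a : Γ(W, ⊤)) :
    (f ≫ g).appTop a = f.appTop (g.appTop a) := by
  rw [Scheme.Hom.comp_appTop, ConcreteCategory.comp_apply]

/-- The endomorphism `x_i ↦ x_i + a x_j` of `𝔸ⁿ_X`. -/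
def shear (i j : Fin n) (a : Γ(X, ⊤)) : Aff n X ⟶ Aff n X :=
  AffineSpace.homOfVector (proj n X) fun l =>
    if l.down = i then x X i + (proj n X).appTop a * x X j else x X l.down

lemma shear_proj (i j : Fin n) (a : Γ(X, ⊤)) : shear i j a ≫ proj n X = proj n X :=
  AffineSpace.homOfVector_over _ _

lemma shear_appTop_x (i j : Fin n) (a : Γ(X, ⊤)) (l : Fin n) : (shear i j a).appTop (x X l) =
    if l = i then x X i + (proj n X).appTop a * x X j else x X l :=
  AffineSpace.homOfVector_appTop_coord _ _ _

lemma shear_appTop_proj (i j : Fin n) (a b : Γ(X, ⊤)) :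
    (shear i j a).appTop ((proj n X).appTop b) = (proj n X).appTop b := by
  rw [← comp_appTop_apply, shear_proj]

lemma shear_comp {i j : Fin n} (h : i ≠ j) (a b : Γ(X, ⊤)) :
    shear i j a ≫ shear i j b = shear i j (a + b) := by
  refine hom_ext_coord (by simp only [Category.assoc, shear_proj]) fun l => ?_
  rw [comp_appTop_apply, shear_appTop_x, shear_appTop_x]
  split_ifs
  · rw [map_add, map_mul, shear_appTop_proj, shear_appTop_x, shear_appTop_x, if_pos rfl,
      if_neg h.symm, map_add]
    ring
  · rw [shear_appTop_x, if_neg ‹_›]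

lemma shear_zero (i j : Fin n) : shear (X := X) i j 0 = 𝟙 _ := by
  refine hom_ext_coord (by rw [shear_proj, Category.id_comp]) fun l => ?_
  rw [shear_appTop_x]
  split_ifs with h
  · simp [h]
  · simp

lemma isIso_shear {i j : Fin n} (h : i ≠ j) (a : Γ(X, ⊤)) : IsIso (shear i j a) :=
  ⟨shear i j (-a), by rw [shear_comp h, add_neg_cancel, shear_zero],
    by rw [shear_comp h, neg_add_cancel, shear_zero]⟩

lemma map_appTop_x (f : X' ⟶ X) (i : Fin n) : (map n f).appTop (x X i) = x X' i :=
  AffineSpace.map_appTop_coord _ _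

lemma shear_map (f : X' ⟶ X) (i j : Fin n) (a : Γ(X, ⊤)) :
    shear i j (f.appTop a) ≫ map n f = map n f ≫ shear i j a := by
  refine hom_ext_coord ?_ fun l => ?_
  · rw [Category.assoc, AffineSpace.map_over, ← Category.assoc, shear_proj, Category.assoc,
      shear_proj, AffineSpace.map_over]
  · rw [comp_appTop_apply, comp_appTop_apply, map_appTop_x, shear_appTop_x, shear_appTop_x]
    split_ifs
    · rw [map_add, map_mul, map_appTop_x, map_appTop_x, ← comp_appTop_apply, ← comp_appTop_apply,
        AffineSpace.map_over]
    · rw [map_appTop_x]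

/-- The automorphism `x_i ↦ - x_i` of `𝔸ⁿ_X`. -/
def neg (X : Scheme.{u}) (i : Fin n) : Aff n X ⟶ Aff n X :=
  AffineSpace.homOfVector (proj n X) fun l => if l.down = i then - x X i else x X l.down

lemma neg_proj (i : Fin n) : neg X i ≫ proj n X = proj n X :=
  AffineSpace.homOfVector_over _ _

lemma neg_appTop_x (i l : Fin n) :
    (neg X i).appTop (x X l) = if l = i then - x X i else x X l :=
  AffineSpace.homOfVector_appTop_coord _ _ _

lemma neg_neg (i : Fin n) : neg X i ≫ neg X i = 𝟙 _ := by
  refine hom_ext_coord (by rw [Category.assoc, neg_proj, neg_proj, Category.id_comp]) fun l => ?_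
  rw [comp_appTop_apply, neg_appTop_x]
  split_ifs with h
  · rw [map_neg, neg_appTop_x, if_pos rfl, h]
    simp
  · rw [neg_appTop_x, if_neg h]
    simp

instance (i : Fin n) : IsIso (neg X i) := ⟨neg X i, neg_neg i, neg_neg i⟩

/-- The rotation `x_i ↦ x_j`, `x_j ↦ - x_i`. -/
def rot (X : Scheme.{u}) (i j : Fin n) : Aff n X ⟶ Aff n X :=
  shear i j 1 ≫ shear j i (-1) ≫ shear i j 1

lemma rot_proj (i j : Fin n) : rot X i j ≫ proj n X = proj n X := by
  simp only [rot, Category.assoc, shear_proj]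

lemma rot_appTop_x {i j : Fin n} (h : i ≠ j) (l : Fin n) : (rot X i j).appTop (x X l) =
    if l = i then x X j else if l = j then - x X i else x X l := by
  have h' := h.symm
  rw [rot, comp_appTop_apply, comp_appTop_apply, shear_appTop_x]
  split_ifs with h₁ h₂
  · simp only [map_add, map_mul, map_one, map_neg, shear_appTop_x, h, h', if_true, if_false]
    ring
  · subst h₂
    simp only [map_add, map_mul, map_one, map_neg, shear_appTop_x, h', if_true, if_false]
    ring
  · simp only [shear_appTop_x, h₁, h₂, if_false]

/-- The reordering of the coordinates of `𝔸ⁿ_X`. -/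
abbrev reorder {n' : ℕ} (X : Scheme.{u}) (π : Fin n' → Fin n) : Aff n X ⟶ Aff n' X :=
  AffineSpace.reindex (fun l => ⟨π l.down⟩) X

lemma reorder_proj {n' : ℕ} (π : Fin n' → Fin n) : reorder X π ≫ proj n' X = proj n X :=
  AffineSpace.reindex_over _ _

lemma reorder_appTop_x {n' : ℕ} (π : Fin n' → Fin n) (l : Fin n') :
    (reorder X π).appTop (x X l) = x X (π l) :=
  AffineSpace.reindex_appTop_coord _ _ _

lemma reorder_comp {n' n'' : ℕ} (π : Fin n' → Fin n) (π' : Fin n'' → Fin n') :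
    reorder X π ≫ reorder X π' = reorder X (π ∘ π') := by
  refine hom_ext_coord (by simp only [Category.assoc, reorder_proj]) fun l => ?_
  simp only [comp_appTop_apply, reorder_appTop_x, Function.comp_apply]

lemma reorder_id : reorder X (id : Fin n → Fin n) = 𝟙 _ :=
  hom_ext_coord (by rw [reorder_proj, Category.id_comp]) fun l => by
    rw [reorder_appTop_x]
    simp

instance (π : Equiv.Perm (Fin n)) : IsIso (reorder X π) :=
  ⟨reorder X π.symm, by rw [reorder_comp, Equiv.self_comp_symm, reorder_id],
    by rw [reorder_comp, Equiv.symm_comp_self, reorder_id]⟩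

/-- A transposition has determinant `-1`, so besides shears it needs one sign change. -/
lemma rot_neg {i j : Fin n} (h : i ≠ j) :
    rot X i j ≫ neg X j = reorder X (Equiv.swap i j) := by
  refine hom_ext_coord (by rw [Category.assoc, neg_proj, rot_proj, reorder_proj]) fun l => ?_
  rw [comp_appTop_apply, neg_appTop_x, reorder_appTop_x]
  split_ifs with h₁
  · rw [map_neg, rot_appTop_x h, if_neg h.symm, if_pos rfl, h₁, Equiv.swap_apply_right, _root_.neg_neg]
  · rw [rot_appTop_x h, if_neg h₁]
    split_ifs with h₂
    · rw [h₂, Equiv.swap_apply_left]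
    · rw [Equiv.swap_apply_of_ne_of_ne h₂ h₁]

/-- The square of the rotation negates both coordinates; it therefore carries a sign from the
coordinate `j` to the coordinate `i`. -/
lemma neg_rot_rot {i j : Fin n} (h : i ≠ j) :
    neg X j ≫ rot X i j ≫ rot X i j = neg X i := by
  refine hom_ext_coord (by simp only [Category.assoc, neg_proj, rot_proj]) fun l => ?_
  rw [comp_appTop_apply, comp_appTop_apply, rot_appTop_x h, neg_appTop_x]
  split_ifs with h₁ h₂
  · rw [rot_appTop_x h, if_neg h.symm, if_pos rfl, map_neg, neg_appTop_x, if_neg h]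
  · rw [map_neg, rot_appTop_x h, if_pos rfl, map_neg, neg_appTop_x, if_pos rfl, h₂, _root_.neg_neg]
  · rw [rot_appTop_x h, if_neg h₁, if_neg h₂, neg_appTop_x, if_neg h₂]

end Aff

namespace PreFr

variable {n N N' : ℕ} {X X' : Scheme.{u}} {Y : Scheme.{u}ᵒᵖ ⥤ Type u}

/-- The transport of a correspondence along an automorphism of `𝔸ⁿ_X` over `X`. -/
abbrev move (c : PreFr n N X Y) (α : Aff n X ⟶ Aff n X) [IsIso α]
    (hα : α ≫ Aff.proj n X = Aff.proj n X) : PreFr n N X Y where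
  Z := c.Z.preimage (inv α).continuous
  finite := isFinite_pullback (f' := inv α) (f := 𝟙 X)
    (IsPullback.of_horiz_isIso ⟨by simp [hα]⟩) c.Z c.finite _ fun _ h => h
  W := c.W
  e := c.e ≫ α
  nhd := c.nhd.baseChange (q := 𝟙 _) (f := inv α) (IsPullback.of_horiz_isIso ⟨by simp⟩) _
    fun _ h => h
  φ := c.φ
  zero_iff K _ y t := by
    refine Iff.trans (Eq.to_iff (congrArg (· ∈ c.Z) ?_)) (c.zero_iff K y t)
    rw [← Scheme.Hom.comp_apply, Category.assoc, Category.assoc, IsIso.hom_inv_id,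
      Category.comp_id]
  g := c.g

lemma Rel.move {c d : PreFr n N X Y} (h : Rel c d) (α : Aff n X ⟶ Aff n X) [IsIso α]
    (hα : α ≫ Aff.proj n X = Aff.proj n X) : Rel (c.move α hα) (d.move α hα) := by
  obtain ⟨hZ, W, i, j, he, hn, hφ, hg⟩ := h
  refine ⟨by simp [hZ], W, i, j, by simp [reassoc_of% he], ?_, hφ, hg⟩
  exact hn.baseChange (q := 𝟙 _) (f := inv α) (IsPullback.of_horiz_isIso ⟨by simp⟩) _
    fun _ h => h

lemma move_move (c : PreFr n N X Y) (α β : Aff n X ⟶ Aff n X) [IsIso α] [IsIso β]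
    (hα : α ≫ Aff.proj n X = Aff.proj n X) (hβ : β ≫ Aff.proj n X = Aff.proj n X) :
    Rel ((c.move α hα).move β hβ) (c.move (α ≫ β) (by rw [Category.assoc, hβ, hα])) := by
  refine Rel.of_hom ?_ (𝟙 _) (by simp) (TauMap.comp_id _).symm (by simp)
  ext x
  change inv α (inv β x) ∈ c.Z ↔ inv (α ≫ β) x ∈ c.Z
  rw [← Scheme.Hom.comp_apply, IsIso.inv_comp]

lemma move_id (c : PreFr n N X Y) : Rel (c.move (𝟙 _) (Category.id_comp _)) c := by
  refine Rel.of_hom ?_ (𝟙 _) (by simp) (TauMap.comp_id _).symm (by simp)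
  ext x
  change inv (𝟙 (Aff n X)) x ∈ c.Z ↔ x ∈ c.Z
  rw [IsIso.inv_id]
  rfl

lemma move_pull (c : PreFr n N X Y) (f : X' ⟶ X) (α : Aff n X ⟶ Aff n X) [IsIso α]
    (hα : α ≫ Aff.proj n X = Aff.proj n X) (α' : Aff n X' ⟶ Aff n X') [IsIso α']
    (hα' : α' ≫ Aff.proj n X' = Aff.proj n X') (h : α' ≫ Aff.map n f = Aff.map n f ≫ α) :
    Rel ((c.move α hα).pull f) ((c.pull f).move α' hα') := by
  have h' : inv α' ≫ Aff.map n f = Aff.map n f ≫ inv α := by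
    rw [IsIso.inv_comp_eq, ← Category.assoc, IsIso.eq_comp_inv, h]
  refine Rel.of_hom ?_ (pullback.lift (pullback.fst _ _) (pullback.snd _ _ ≫ inv α') ?_) ?_ ?_ ?_
  · ext x
    change inv α (Aff.map n f x) ∈ c.Z ↔ Aff.map n f (inv α' x) ∈ c.Z
    rw [← Scheme.Hom.comp_apply, ← h', Scheme.Hom.comp_apply]
  · rw [Category.assoc, h', ← pullback.condition_assoc]
    simp
  · rw [pullback.lift_snd_assoc]
    simp
  · simp only [TauMap.comp_comp, pullback.lift_fst]
  · simp only [restr_restr, pullback.lift_fst]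

/-- Used for constant families over the interval, whose restriction to either endpoint must give
back `c`. -/
lemma rel_pull_pull_of_section (c : PreFr n N X Y) {p : X' ⟶ X} {f : X ⟶ X'} (hf : f ≫ p = 𝟙 X) :
    Rel ((c.pull p).pull f) c := by
  refine .of_hom ?_ (pullback.fst _ _ ≫ pullback.fst _ _) ?_ ?_ ?_
  · ext x
    change Aff.map n _ (Aff.map n _ x) ∈ c.Z ↔ x ∈ c.Z
    rw [← Scheme.Hom.comp_apply, ← Aff.map_comp, hf, Aff.map_id]
    rfl
  · rw [Category.assoc, pullback.condition, pullback.condition_assoc, ← Aff.map_comp, hf,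
      Aff.map_id, Category.comp_id]
  · exact TauMap.comp_comp _ _ _
  · exact restr_restr _ _ _ _

end PreFr

section

variable {k : Type u} [Field k] {n N m : ℕ}

/-- The shear by a function on the interval with values `b` and `0` at the endpoints is a homotopy
from the shear by `b` to the identity. -/
lemma cls_move_shear (c : PreFr n N (Spec (.of k)) (Gm m)) {i j : Fin n} (h : i ≠ j)
    (a : Γ(Spec (IntervalRing k), ⊤)) (b : Γ(Spec (.of k), ⊤)) (h₀ : (endpoint k 0).appTop a = b)
    (h₁ : (endpoint k 1).appTop a = 0) :
    haveI := Aff.isIso_shear h b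
    cls k (c.move (Aff.shear i j b) (Aff.shear_proj i j b)) = cls k c := by
  have := Aff.isIso_shear h a
  have key : ∀ (s : Fin 2) (b : Γ(Spec (.of k), ⊤)), (endpoint k s).appTop a = b →
      haveI := Aff.isIso_shear h b
      ZF.mk (((c.pull (intervalProj k)).move (Aff.shear i j a) (Aff.shear_proj i j a)).pull
        (endpoint k s)) = ZF.mk (c.move (Aff.shear i j b) (Aff.shear_proj i j b)) := by
    intro s b hb
    have := Aff.isIso_shear h b
    rw [ZF.mk_eq_of_rel (PreFr.move_pull _ (endpoint k s) _ _ (Aff.shear i j b)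
      (Aff.shear_proj i j b) (by rw [← hb, Aff.shear_map]))]
    have h3 := c.rel_pull_pull_of_section (endpoint_intervalProj k s)
    exact ZF.mk_eq_of_rel (h3.move _ _)
  have := Aff.isIso_shear h b
  have h0 := Aff.isIso_shear h (0 : Γ(Spec (.of k), ⊤))
  rw [cls_eq, ← key 0 b h₀, ← ZF.pull_mk, clsHom_pull_endpoint, ZF.pull_mk, key 1 0 h₁, ← cls_eq,
    ← cls_eq_of_rel c.move_id]
  congr 2
  exact Aff.shear_zero i j

end

end CobFr
end

/-! ### Invariance of the class under signs and permutations. -/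

noncomputable section
namespace CobFr

lemma TauMap.mem_ofSection {W : Scheme.{u}} (a : Γ(W, ⊤)) {R : CommRingCat.{u}} (x : Spec R ⟶ W)
    (v : Fin 1 ⊕ Fin 0 → R) :
    v ∈ ((ofSection a).pt R x).quot.toSubmodule ↔ v (Sum.inl 0) = 0 := by
  unfold ofSection
  rw [TauPoint.mem_ofEpi]
  exact ⟨fun h => congrFun h 0, fun h => funext fun i => by rw [Subsingleton.elim i 0]; exact h⟩

lemma TauMap.mkQ_eq_ofSection_sec {W : Scheme.{u}} (a : Γ(W, ⊤)) {R : CommRingCat.{u}}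
    (x : Spec R ⟶ W) (v : Fin 1 ⊕ Fin 0 → R) :
    ((ofSection a).pt R x).quot.toSubmodule.mkQ v = ((ofSection a).pt R x).sec ↔
      v (Sum.inl 0) = evalAt x a := by
  unfold ofSection
  rw [TauPoint.mkQ_eq_ofEpi_sec]
  exact ⟨fun h => congrFun h 0, fun h => funext fun i => by rw [Subsingleton.elim i 0]; exact h⟩

namespace Framing

variable {W : Scheme.{u}} {n N N' : ℕ} {φ : TauMap W n N}

/-- The composite of an epimorphism with an automorphism permuting the basis vectors up to sign. -/
def monomial (φ : TauMap W n N) (σ : Fin n ⊕ Fin N ≃ Fin n ⊕ Fin N) (ε : Fin n ⊕ Fin N → ℤˣ) :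
    Framing φ N where
  q R x := (φ.pt R x).quot.toSubmodule.mkQ ∘ₗ
    LinearMap.pi fun j => ((ε j : ℤ) : R) • LinearMap.proj (σ j)
  surjective R x := (Submodule.mkQ_surjective _).comp fun v => by
    refine ⟨fun j => ((ε (σ.symm j) : ℤ) : R) * v (σ.symm j), ?_⟩
    ext j
    have : ((ε j : ℤ) : R) * ((ε j : ℤ) : R) = 1 := by
      rw [← Int.cast_mul, ← Units.val_mul, Int.units_mul_self, Units.val_one, Int.cast_one]
    simp [← mul_assoc, this]
  compat {R S} f x v w hv := by
    rw [LinearMap.comp_apply] at hv ⊢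
    rw [← (φ.compat f x).mkQ_eq hv]
    congr 1
    ext j
    simp

lemma monomial_apply (σ : Fin n ⊕ Fin N ≃ Fin n ⊕ Fin N) (ε : Fin n ⊕ Fin N → ℤˣ)
    {R : CommRingCat.{u}} (x : Spec R ⟶ W) (v : Fin n ⊕ Fin N → R) :
    (monomial φ σ ε).q R x v =
      (φ.pt R x).quot.toSubmodule.mkQ fun j => ((ε j : ℤ) : R) * v (σ j) := rfl

end Framing

/-- The signs by which the first basis vector is negated. -/
def negFirst (n N : ℕ) : Fin (1 + n) ⊕ Fin (0 + N) → ℤˣ :=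
  Function.update 1 (Sum.inl (Fin.castAdd n 0)) (-1)

lemma negFirst_inl (n N : ℕ) (j : Fin 1 ⊕ Fin 0) :
    negFirst n N (swapIndex 1 0 n N (Sum.inl j)) = -1 := by
  rcases j with j | j
  · obtain rfl : j = 0 := Subsingleton.elim _ _
    exact Function.update_self _ _ _
  · exact j.elim0

lemma negFirst_inr (n N : ℕ) (j : Fin n ⊕ Fin N) :
    negFirst n N (swapIndex 1 0 n N (Sum.inr j)) = 1 := by
  refine Function.update_of_ne (fun h => ?_) _ _
  have hl' : swapIndex 1 0 n N (Sum.inl (Sum.inl 0)) = Sum.inl (Fin.castAdd n 0) := rfl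
  rw [← hl'] at h
  simp at h

lemma TauMap.reframe_monomial_comp {W W' : Scheme.{u}} {n N : ℕ} (φ : TauMap W n N)
    (σ : Fin n ⊕ Fin N ≃ Fin n ⊕ Fin N) (ε : Fin n ⊕ Fin N → ℤˣ) (h : W' ⟶ W) :
    (φ.reframe (.monomial φ σ ε)).comp h = (φ.comp h).reframe (.monomial _ σ ε) := rfl

/-- Multiplication by `-1` is an automorphism of the trivial summand that exchanges the sections `a`
and `-a`. It leaves its trace only in the epimorphism, as a sign on the first basis vector. -/
lemma TauMap.prod_ofSection_neg {W : Scheme.{u}} {n N : ℕ} (a : Γ(W, ⊤)) (φ : TauMap W n N) :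
    (ofSection a).prod φ =
      ((ofSection (-a)).prod φ).reframe (.monomial _ (Equiv.refl _) (negFirst n N)) := by
  refine TauMap.ext fun R x => TauPoint.ext_of_forall (fun v => ?_) (fun v hv => ?_)
  · refine (TauPoint.mem_prod _ _ _).trans (Iff.trans ?_ (mem_reframe _ _ _).symm)
    rw [Framing.monomial_apply]
    refine Iff.trans ?_ (Submodule.Quotient.mk_eq_zero _).symm
    refine Iff.trans ?_ (TauPoint.mem_prod _ _ _).symm
    simp only [Equiv.refl_apply, negFirst_inl, negFirst_inr, mem_ofSection]
    simp
  · rw [mkQ_eq_reframe_sec, Framing.monomial_apply]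
    refine (TauPoint.mkQ_eq_prod_sec _ _ _).2 ?_
    have hv' := (TauPoint.mkQ_eq_prod_sec _ _ _).1 hv
    refine ⟨(mkQ_eq_ofSection_sec _ _ _).2 ?_, ?_⟩
    · have := (mkQ_eq_ofSection_sec _ _ _).1 hv'.1
      simp only [Equiv.refl_apply, negFirst_inl]
      rw [evalAt_neg, ← this]
      simp
    · simp only [Equiv.refl_apply, negFirst_inr]
      simpa using hv'.2

lemma TauMap.ofSection_comp_prod_neg {W W' : Scheme.{u}} {n N : ℕ} (a : Γ(W, ⊤)) (h : W' ⟶ W)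
    (φ : TauMap W' n N) : ((ofSection a).comp h).prod φ =
      (((ofSection (-a)).comp h).prod φ).reframe
        (.monomial _ (Equiv.refl _) (negFirst n N)) := by
  rw [ofSection_comp, ofSection_comp, map_neg, ← prod_ofSection_neg]

namespace PreFr

variable {n N N' : ℕ} {X X' : Scheme.{u}} {Y : Scheme.{u}ᵒᵖ ⥤ Type u}

/-- The morphism of neighbourhoods of external products induced by a pair of morphisms. -/
def mulMap {n' N' : ℕ} {Y' : Scheme.{u}ᵒᵖ ⥤ Type u} {c c₁ : PreFr n N X Y}
    {d d₁ : PreFr n' N' X Y'} (i : c.W ⟶ c₁.W) (j : d.W ⟶ d₁.W)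
    (hi : i ≫ c₁.e ≫ Aff.proj n X = c.e ≫ Aff.proj n X)
    (hj : j ≫ d₁.e ≫ Aff.proj n' X = d.e ≫ Aff.proj n' X) :
    pullback (c.e ≫ Aff.proj n X) (d.e ≫ Aff.proj n' X) ⟶
      pullback (c₁.e ≫ Aff.proj n X) (d₁.e ≫ Aff.proj n' X) :=
  pullback.lift (pullback.fst _ _ ≫ i) (pullback.snd _ _ ≫ j)
    (by rw [Category.assoc, Category.assoc, hi, hj, pullback.condition])

section

variable {n' N' : ℕ} {Y' : Scheme.{u}ᵒᵖ ⥤ Type u} {c c₁ : PreFr n N X Y}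
    {d d₁ : PreFr n' N' X Y'} (i : c.W ⟶ c₁.W) (j : d.W ⟶ d₁.W)
    (hi : i ≫ c₁.e ≫ Aff.proj n X = c.e ≫ Aff.proj n X)
    (hj : j ≫ d₁.e ≫ Aff.proj n' X = d.e ≫ Aff.proj n' X)

lemma mulMap_fst : mulMap i j hi hj ≫ pullback.fst _ _ = pullback.fst _ _ ≫ i :=
  pullback.lift_fst _ _ _

lemma mulMap_snd : mulMap i j hi hj ≫ pullback.snd _ _ = pullback.snd _ _ ≫ j :=
  pullback.lift_snd _ _ _

lemma mulMap_e {α : Aff n X ⟶ Aff n X} {β : Aff n' X ⟶ Aff n' X}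
    {γ : Aff (n + n') X ⟶ Aff (n + n') X} (hα : γ ≫ Aff.left n n' X = Aff.left n n' X ≫ α)
    (hβ : γ ≫ Aff.right n n' X = Aff.right n n' X ≫ β) (hi' : i ≫ c₁.e = c.e ≫ α)
    (hj' : j ≫ d₁.e = d.e ≫ β) :
    mulMap i j hi hj ≫ Aff.pair c₁.e d₁.e = Aff.pair c.e d.e ≫ γ := by
  apply (Aff.isPullback n n' X).hom_ext
  · rw [Category.assoc, Aff.pair_left, Category.assoc, hα, ← Category.assoc, ← Category.assoc,
      mulMap_fst, Aff.pair_left, Category.assoc, Category.assoc, hi']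
  · rw [Category.assoc, Aff.pair_right, Category.assoc, hβ, ← Category.assoc, ← Category.assoc,
      mulMap_snd, Aff.pair_right, Category.assoc, Category.assoc, hj']

lemma mulMap_φ : ((c₁.φ.comp (pullback.fst (c₁.e ≫ Aff.proj n X) (d₁.e ≫ Aff.proj n' X))).prod
    (d₁.φ.comp (pullback.snd _ _))).comp (mulMap i j hi hj) =
      ((c₁.φ.comp i).comp (pullback.fst _ _)).prod ((d₁.φ.comp j).comp (pullback.snd _ _)) := by
  rw [TauMap.prod_comp, TauMap.comp_comp, TauMap.comp_comp, mulMap_fst, mulMap_snd,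
    TauMap.comp_comp, TauMap.comp_comp]

lemma mulMap_g : Y'.map (mulMap i j hi hj).op (Y'.map (pullback.snd (c₁.e ≫ Aff.proj n X)
    (d₁.e ≫ Aff.proj n' X)).op d₁.g) = Y'.map (pullback.snd _ _).op (Y'.map j.op d₁.g) := by
  rw [restr_restr, mulMap_snd, restr_restr]

end

/-- Here `β` is the product of the identity on the new coordinate with `α`; stabilisation is
compatible with such products. -/
lemma stabn_move (c : PreFr n N X Y) (α : Aff n X ⟶ Aff n X) [IsIso α]
    (hα : α ≫ Aff.proj n X = Aff.proj n X) (β : Aff (1 + n) X ⟶ Aff (1 + n) X) [IsIso β]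
    (hβ : β ≫ Aff.proj (1 + n) X = Aff.proj (1 + n) X)
    (hl : β ≫ Aff.left 1 n X = Aff.left 1 n X)
    (hr : β ≫ Aff.right 1 n X = Aff.right 1 n X ≫ α) :
    Rel (c.stabn.move β hβ) (c.move α hα).stabn := by
  have hi : 𝟙 _ ≫ (suspension X).e ≫ Aff.proj 1 X = (suspension X).e ≫ Aff.proj 1 X :=
    Category.id_comp _
  have hj : 𝟙 c.W ≫ (c.move α hα).e ≫ Aff.proj n X = c.e ≫ Aff.proj n X := by
    rw [Category.id_comp, Category.assoc, hα]
  refine .of_hom ?_ (mulMap (c := suspension X) (c₁ := suspension X) (d := c) (d₁ := c.move α hα)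
    (𝟙 _) (𝟙 _) hi hj) ?_ ?_ ?_
  · have hl' : inv β ≫ Aff.left 1 n X = Aff.left 1 n X := by
      rw [IsIso.inv_comp_eq, hl]
    have hr' : inv β ≫ Aff.right 1 n X = Aff.right 1 n X ≫ inv α := by
      rw [IsIso.inv_comp_eq, ← Category.assoc, IsIso.eq_comp_inv, hr]
    ext x
    refine and_congr (Eq.to_iff (congrArg (· ∈ (suspension X).Z) ?_))
      (Eq.to_iff (congrArg (· ∈ c.Z) ?_))
    · rw [← Scheme.Hom.comp_apply, hl']
    · rw [← Scheme.Hom.comp_apply, hr', Scheme.Hom.comp_apply]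
  · exact mulMap_e (α := 𝟙 _) _ _ hi hj (hl.trans (Category.comp_id _).symm) hr
      ((Category.id_comp _).trans (Category.comp_id _).symm) (Category.id_comp _)
  · have h := mulMap_φ (c := suspension X) (c₁ := suspension X) (d := c) (d₁ := c.move α hα)
      (𝟙 _) (𝟙 _) hi hj
    rw [TauMap.comp_id, TauMap.comp_id] at h
    exact h.symm
  · have h := mulMap_g (c := suspension X) (c₁ := suspension X) (d := c) (d₁ := c.move α hα)
      (𝟙 _) (𝟙 _) hi hj
    exact (h.trans (by simp)).symm

lemma neg_mem_suspension {X : Scheme.{u}} (y : Aff 1 X) (h : y ∈ (suspension X).Z) :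
    Aff.neg X 0 y ∈ (suspension X).Z := by
  obtain ⟨z, rfl⟩ := h
  refine ⟨z, ?_⟩
  have h : Aff.zeroSection 1 X ≫ Aff.neg X 0 = Aff.zeroSection 1 X := by
    refine Aff.hom_ext_coord (by rw [Category.assoc, Aff.neg_proj]) fun l => ?_
    obtain rfl : l = 0 := Subsingleton.elim _ _
    rw [Aff.comp_appTop_apply, Aff.neg_appTop_x, if_pos rfl, map_neg, Aff.zeroSection,
      AffineSpace.homOfVector_appTop_coord]
    simp
  rw [← Scheme.Hom.comp_apply, h]

lemma suspension_φ_comp_neg (X : Scheme.{u}) :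
    (suspension X).φ.comp (Aff.neg X 0) = TauMap.ofSection (-Aff.x X 0) :=
  (TauMap.ofSection_comp _ _).trans
    (congrArg TauMap.ofSection ((Aff.neg_appTop_x 0 0).trans (if_pos rfl)))

/-- The support of the suspension is stable under the sign, and its section `x` becomes `-x`. By
`TauMap.prod_ofSection_neg` this amounts to a sign in the epimorphism. -/
lemma stabn_move_neg (c : PreFr n N X Y) :
    Rel (c.stabn.move (Aff.neg X (Fin.castAdd n 0)) (Aff.neg_proj _))
      (c.stabn.reframe (.monomial _ (Equiv.refl _) (negFirst n N))) := by
  have hl : Aff.neg X (Fin.castAdd n 0) ≫ Aff.left 1 n X = Aff.left 1 n X ≫ Aff.neg X 0 := by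
    refine Aff.hom_ext_coord (by simp only [Category.assoc, Aff.left_proj, Aff.neg_proj])
      fun l => ?_
    obtain rfl : l = 0 := Subsingleton.elim _ _
    have h0 : (Aff.left 1 n X).appTop (Aff.x X 0) = Aff.x X (Fin.castAdd n 0) :=
      AffineSpace.reindex_appTop_coord _ _ _
    rw [Aff.comp_appTop_apply, Aff.comp_appTop_apply, Aff.neg_appTop_x, if_pos rfl, map_neg, h0,
      Aff.neg_appTop_x, if_pos rfl]
  have hr : Aff.neg X (Fin.castAdd n 0) ≫ Aff.right 1 n X = Aff.right 1 n X := by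
    refine Aff.hom_ext_coord (by simp only [Category.assoc, Aff.right_proj, Aff.neg_proj])
      fun l => ?_
    have h0 : (Aff.right 1 n X).appTop (Aff.x X l) = Aff.x X (Fin.natAdd 1 l) :=
      AffineSpace.reindex_appTop_coord _ _ _
    rw [Aff.comp_appTop_apply, h0, Aff.neg_appTop_x, if_neg]
    intro h
    have := congrArg Fin.val h
    simp at this
  let ν : (suspension X).W ⟶ (suspension X).W := Aff.neg X 0
  have hν : ν ≫ (suspension X).e = (suspension X).e ≫ Aff.neg X 0 :=
    (Category.comp_id _).trans (Category.id_comp _).symm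
  have hi : ν ≫ (suspension X).e ≫ Aff.proj 1 X = (suspension X).e ≫ Aff.proj 1 X := by
    rw [← Category.assoc, hν, Category.assoc, Aff.neg_proj]
  have hj : 𝟙 c.W ≫ c.e ≫ Aff.proj n X = c.e ≫ Aff.proj n X := Category.id_comp _
  refine .of_hom ?_ (mulMap (c := suspension X) (c₁ := suspension X) (d := c) (d₁ := c)
    ν (𝟙 _) hi hj) ?_ ?_ ?_
  · have hinv : inv (Aff.neg X (Fin.castAdd n (0 : Fin 1))) = Aff.neg X (Fin.castAdd n 0) :=
      IsIso.inv_eq_of_hom_inv_id (Aff.neg_neg _)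
    ext x
    refine and_congr ?_ (Eq.to_iff (congrArg (· ∈ c.Z) ?_))
    · change Aff.left 1 n X _ ∈ (suspension X).Z ↔ Aff.left 1 n X x ∈ (suspension X).Z
      rw [hinv, ← Scheme.Hom.comp_apply, hl, Scheme.Hom.comp_apply]
      refine ⟨fun h => ?_, neg_mem_suspension _⟩
      have h2 := neg_mem_suspension _ h
      rwa [← Scheme.Hom.comp_apply, Aff.neg_neg] at h2
    · rw [hinv, ← Scheme.Hom.comp_apply, hr]
  · exact mulMap_e (β := 𝟙 _) _ _ hi hj hl (hr.trans (Category.comp_id _).symm) hν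
      ((Category.id_comp _).trans (Category.comp_id _).symm)
  · have h := mulMap_φ (c := suspension X) (c₁ := suspension X) (d := c) (d₁ := c) ν (𝟙 _) hi hj
    have hν' : (suspension X).φ.comp ν =
        TauMap.ofSection (-(Aff.x X 0 : Γ((suspension X).W, ⊤))) := suspension_φ_comp_neg X
    rw [TauMap.comp_id, hν'] at h
    refine Eq.trans ?_ (TauMap.reframe_monomial_comp _ _ _ _).symm
    refine Eq.trans ?_ (congrArg (fun φ : TauMap (pullback ((suspension X).e ≫ Aff.proj 1 X)
      (c.e ≫ Aff.proj n X)) (1 + n) (0 + N) =>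
        φ.reframe (.monomial _ (Equiv.refl _) (negFirst n N))) h.symm)
    exact TauMap.ofSection_comp_prod_neg _ _ _
  · have h := mulMap_g (c := suspension X) (c₁ := suspension X) (d := c) (d₁ := c) ν (𝟙 _) hi hj
    exact (h.trans (by simp)).symm

end PreFr

section

variable {k : Type u} [Field k] {n N m : ℕ}

lemma cls_stabn (c : PreFr n N (Spec (.of k)) (Gm m)) : cls k c.stabn = cls k c := by
  rw [cls_eq, ZF.mk_stabn, ← cls_eq]

lemma cls_stabN (c : PreFr n N (Spec (.of k)) (Gm m)) : cls k c.stabN = cls k c := by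
  rw [cls_eq, ZF.mk_stabN, ← cls_eq]

lemma isIso_rot {X : Scheme.{u}} {i j : Fin n} (h : i ≠ j) : IsIso (Aff.rot X i j) := by
  have := Aff.isIso_shear (X := X) h 1
  have := Aff.isIso_shear (X := X) h.symm (-1)
  unfold Aff.rot
  infer_instance

lemma cls_move_congr (c : PreFr n N (Spec (.of k)) (Gm m)) {α β : Aff n (Spec (.of k)) ⟶ Aff n _}
    [IsIso α] [IsIso β] (hα : α ≫ Aff.proj n _ = Aff.proj n _)
    (hβ : β ≫ Aff.proj n _ = Aff.proj n _) (h : α = β) :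
    cls k (c.move α hα) = cls k (c.move β hβ) := by
  subst h
  rfl

lemma cls_move_comp (c : PreFr n N (Spec (.of k)) (Gm m)) (α β : Aff n (Spec (.of k)) ⟶ Aff n _)
    [IsIso α] [IsIso β] (hα : α ≫ Aff.proj n _ = Aff.proj n _)
    (hβ : β ≫ Aff.proj n _ = Aff.proj n _) :
    cls k (c.move (α ≫ β) (by rw [Category.assoc, hβ, hα])) =
      cls k ((c.move α hα).move β hβ) :=
  (cls_eq_of_rel (c.move_move α β hα hβ)).symm

/-- The rotation is a product of three shears, each homotopic to the identity. -/
lemma cls_move_rot (c : PreFr n N (Spec (.of k)) (Gm m)) {i j : Fin n} (h : i ≠ j) :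
    haveI := isIso_rot (X := Spec (.of k)) h
    cls k (c.move (Aff.rot _ i j) (Aff.rot_proj i j)) = cls k c := by
  have := Aff.isIso_shear (X := Spec (.of k)) h 1
  have := Aff.isIso_shear (X := Spec (.of k)) h.symm (-1)
  have := isIso_rot (X := Spec (.of k)) h
  have h₁ : ∀ c : PreFr n N (Spec (.of k)) (Gm m),
      cls k (c.move (Aff.shear i j 1) (Aff.shear_proj i j 1)) = cls k c := fun c =>
    cls_move_shear c h _ _ (endpoint_zero_section k) (endpoint_one_section k)
  have h₂ : ∀ c : PreFr n N (Spec (.of k)) (Gm m),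
      cls k (c.move (Aff.shear j i (-1)) (Aff.shear_proj j i _)) = cls k c := fun c =>
    cls_move_shear c h.symm (-intervalSection k) _
      (by rw [map_neg, endpoint_zero_section]) (by rw [map_neg, endpoint_one_section, neg_zero])
  have h₃ := cls_move_comp c (Aff.shear i j 1) (Aff.shear j i (-1) ≫ Aff.shear i j 1)
    (Aff.shear_proj i j _) (by simp only [Category.assoc, Aff.shear_proj])
  refine h₃.trans ?_
  rw [cls_move_comp _ _ _ (Aff.shear_proj _ _ _) (Aff.shear_proj _ _ _), h₁, h₂, h₁]

/-- A sign is not available from shears alone. After a stabilisation two rotations move it from the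
coordinate `j` to the new coordinate, where it is a change of epimorphism and `cls_reframe` applies.
-/
lemma cls_move_neg (c : PreFr n N (Spec (.of k)) (Gm m)) (j : Fin n) :
    cls k (c.move (Aff.neg _ j) (Aff.neg_proj j)) = cls k c := by
  have hne : (Fin.castAdd n 0 : Fin (1 + n)) ≠ Fin.natAdd 1 j := by
    intro h
    have := congrArg Fin.val h
    simp at this
    omega
  have := isIso_rot (X := Spec (.of k)) hne
  have hl : Aff.neg (Spec (.of k)) (Fin.natAdd 1 j) ≫ Aff.left 1 n _ = Aff.left 1 n _ := by
    refine Aff.hom_ext_coord (by simp only [Category.assoc, Aff.left_proj, Aff.neg_proj])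
      fun l => ?_
    have h0 : (Aff.left 1 n (Spec (.of k))).appTop (Aff.x _ l) = Aff.x _ (Fin.castAdd n l) :=
      AffineSpace.reindex_appTop_coord _ _ _
    rw [Aff.comp_appTop_apply, h0, Aff.neg_appTop_x, if_neg]
    intro h
    have := congrArg Fin.val h
    simp at this
    omega
  have hr : Aff.neg (Spec (.of k)) (Fin.natAdd 1 j) ≫ Aff.right 1 n _ =
      Aff.right 1 n _ ≫ Aff.neg _ j := by
    refine Aff.hom_ext_coord (by simp only [Category.assoc, Aff.right_proj, Aff.neg_proj])
      fun l => ?_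
    have h0 : ∀ l, (Aff.right 1 n (Spec (.of k))).appTop (Aff.x _ l) = Aff.x _ (Fin.natAdd 1 l) :=
      fun l => AffineSpace.reindex_appTop_coord _ _ _
    rw [Aff.comp_appTop_apply, Aff.comp_appTop_apply, h0, Aff.neg_appTop_x, Aff.neg_appTop_x]
    have : Fin.natAdd 1 l = Fin.natAdd 1 j ↔ l = j := by
      rw [Fin.ext_iff, Fin.ext_iff]
      simp
    simp only [this]
    split_ifs
    · rw [map_neg, h0]
    · rw [h0]
  -- `h₁` and `h₂` decompose the composite in `Aff.neg_rot_rot`; `h₃` identifies the result with the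
  -- sign of the new coordinate.
  have h₁ := cls_move_comp c.stabn (Aff.neg _ (Fin.natAdd 1 j))
    (Aff.rot _ (Fin.castAdd n 0) (Fin.natAdd 1 j) ≫ Aff.rot _ (Fin.castAdd n 0) (Fin.natAdd 1 j))
    (Aff.neg_proj _) (by simp only [Category.assoc, Aff.rot_proj])
  have h₂ := cls_move_comp (c.stabn.move (Aff.neg _ (Fin.natAdd 1 j)) (Aff.neg_proj _))
    (Aff.rot _ (Fin.castAdd n 0) (Fin.natAdd 1 j)) (Aff.rot _ (Fin.castAdd n 0) (Fin.natAdd 1 j))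
    (Aff.rot_proj _ _) (Aff.rot_proj _ _)
  have h₃ := cls_move_congr c.stabn (by simp only [Category.assoc, Aff.neg_proj, Aff.rot_proj])
    (Aff.neg_proj (Fin.castAdd n 0)) (Aff.neg_rot_rot (X := Spec (.of k)) hne)
  rw [← cls_stabn, ← cls_eq_of_rel (c.stabn_move _ _ _ (Aff.neg_proj (Fin.natAdd 1 j)) hl hr),
    ← cls_move_rot _ hne, ← cls_move_rot _ hne, ← h₂, ← h₁, h₃,
    cls_eq_of_rel c.stabn_move_neg, cls_reframe, cls_stabn]

/-- Transpositions generate all permutations, and each is a rotation followed by a sign. -/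
lemma cls_move_reorder (π : Equiv.Perm (Fin n)) (c : PreFr n N (Spec (.of k)) (Gm m)) :
    cls k (c.move (Aff.reorder _ π) (Aff.reorder_proj π)) = cls k c := by
  induction π using Equiv.Perm.swap_induction_on generalizing c with
  | one =>
    exact (cls_move_congr c (α := Aff.reorder _ (1 : Equiv.Perm (Fin n))) (β := 𝟙 _) _
      (Category.id_comp _) Aff.reorder_id).trans
      (cls_eq_of_rel c.move_id)
  | swap_mul π i j hij ih =>
    have := isIso_rot (X := Spec (.of k)) hij
    rw [cls_move_congr (β := Aff.reorder _ (Equiv.swap i j) ≫ Aff.reorder _ π) _ _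
      (by simp only [Category.assoc, Aff.reorder_proj])
      (by rw [Aff.reorder_comp, Equiv.Perm.coe_mul]),
      cls_move_comp _ _ _ (Aff.reorder_proj _) (Aff.reorder_proj _), ih,
      cls_move_congr (β := Aff.rot _ i j ≫ Aff.neg _ j) _ _
      (by simp only [Category.assoc, Aff.neg_proj, Aff.rot_proj]) (Aff.rot_neg hij).symm,
      cls_move_comp _ _ _ (Aff.rot_proj _ _) (Aff.neg_proj _), cls_move_neg, cls_move_rot _ hij]

/-- The class of a correspondence does not change when the coordinates of the affine space and the
basis vectors of the free module are reordered. -/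
lemma cls_eq_of_reorder {n' N' : ℕ} (c : PreFr n N (Spec (.of k)) (Gm m))
    (d : PreFr n' N' (Spec (.of k)) (Gm m)) (π : Fin n' ≃ Fin n)
    (σ : Fin n' ⊕ Fin N' ≃ Fin n ⊕ Fin N) (i : c.W ⟶ d.W) (he : i ≫ d.e = c.e ≫ Aff.reorder _ π)
    (hZ : ∀ x, x ∈ c.Z ↔ Aff.reorder _ π x ∈ d.Z)
    (h₁ : ∀ (R : CommRingCat.{u}) (x : Spec R ⟶ c.W) (v : Fin n ⊕ Fin N → R),
      v ∈ (c.φ.pt R x).quot.toSubmodule ↔ v ∘ σ ∈ (d.φ.pt R (x ≫ i)).quot.toSubmodule)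
    (h₂ : ∀ (R : CommRingCat.{u}) (x : Spec R ⟶ c.W) (v : Fin n ⊕ Fin N → R),
      (c.φ.pt R x).quot.toSubmodule.mkQ v = (c.φ.pt R x).sec →
        (d.φ.pt R (x ≫ i)).quot.toSubmodule.mkQ (v ∘ σ) = (d.φ.pt R (x ≫ i)).sec)
    (hg : c.g = (Gm m).map i.op d.g) : cls k c = cls k d := by
  -- The bijections force equal levels. Then `d` is compared with `c` after moving its coordinates
  -- by `π` and permuting its basis vectors by `σ`.
  obtain rfl : n' = n := by simpa using Fintype.card_congr π
  obtain rfl : N' = N := by simpa using Fintype.card_congr σ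
  rw [← cls_move_reorder π c, ← cls_reframe (c.move (Aff.reorder _ π) (Aff.reorder_proj π))
    (.monomial _ σ.symm 1)]
  have hm : ∀ (R : CommRingCat.{u}) (x : Spec R ⟶ c.W) (v : Fin n' ⊕ Fin N' → R),
      (Framing.monomial c.φ σ.symm 1).q R x v =
        (c.φ.pt R x).quot.toSubmodule.mkQ (v ∘ σ.symm) := fun R x v => by
    rw [Framing.monomial_apply]
    congr 1
    ext j
    simp
  refine cls_eq_of_rel (.of_hom ?_ i he (TauMap.ext fun R x => ?_) hg)
  · ext x
    change inv (Aff.reorder _ π) x ∈ c.Z ↔ x ∈ d.Z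
    rw [hZ, ← Scheme.Hom.comp_apply, IsIso.inv_hom_id]
    rfl
  · refine TauPoint.ext_of_forall (fun v => ?_) (fun v hv => ?_)
    · refine (TauMap.mem_reframe _ _ _).trans ?_
      rw [hm]
      refine (Submodule.Quotient.mk_eq_zero _).trans ((h₁ R x _).trans ?_)
      rw [Function.comp_assoc, Equiv.symm_comp_self]
      rfl
    · rw [TauMap.mkQ_eq_reframe_sec, hm] at hv
      have := h₂ R x _ hv
      rwa [Function.comp_assoc, Equiv.symm_comp_self] at this

end

end CobFr
end

/-! ### Commutativity and associativity of the external product. -/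

noncomputable section
namespace CobFr

/-- The maps `φ` and `ψ` are given by the same bundle and section, and their epimorphisms differ by
a reordering of the basis vectors. -/
structure TauMap.Reorders {W : Scheme.{u}} {n N n' N' : ℕ} (σ : Fin n' ⊕ Fin N' ≃ Fin n ⊕ Fin N)
    (φ : TauMap W n N) (ψ : TauMap W n' N') : Prop where
  mem : ∀ (R : CommRingCat.{u}) (x : Spec R ⟶ W) (v : Fin n ⊕ Fin N → R),
    v ∈ (φ.pt R x).quot.toSubmodule ↔ v ∘ σ ∈ (ψ.pt R x).quot.toSubmodule
  sec : ∀ (R : CommRingCat.{u}) (x : Spec R ⟶ W) (v : Fin n ⊕ Fin N → R),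
    (φ.pt R x).quot.toSubmodule.mkQ v = (φ.pt R x).sec →
      (ψ.pt R x).quot.toSubmodule.mkQ (v ∘ σ) = (ψ.pt R x).sec

lemma TauMap.Reorders.congr {W : Scheme.{u}} {n N n' N' : ℕ}
    {σ : Fin n' ⊕ Fin N' ≃ Fin n ⊕ Fin N} {φ φ' : TauMap W n N} {ψ ψ' : TauMap W n' N'}
    (h : Reorders σ φ ψ) (hφ : φ' = φ) (hψ : ψ' = ψ) : Reorders σ φ' ψ' := by
  rwa [hφ, hψ]

section swapIndex

variable {n N n' N' : ℕ}

lemma swapIndex_inl_inl (i : Fin n) :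
    swapIndex n N n' N' (.inl (.inl i)) = .inl (Fin.castAdd n' i) := rfl

lemma swapIndex_inl_inr (i : Fin N) :
    swapIndex n N n' N' (.inl (.inr i)) = .inr (Fin.castAdd N' i) := rfl

lemma swapIndex_inr_inl (i : Fin n') :
    swapIndex n N n' N' (.inr (.inl i)) = .inl (Fin.natAdd n i) := rfl

lemma swapIndex_inr_inr (i : Fin N') :
    swapIndex n N n' N' (.inr (.inr i)) = .inr (Fin.natAdd N i) := rfl

end swapIndex

namespace TauMap

variable {W : Scheme.{u}} {n N n' N' n'' N'' : ℕ}

lemma Reorders.prod_comm (φ : TauMap W n N) (ψ : TauMap W n' N') :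
    Reorders (Equiv.sumCongr finAddFlip finAddFlip) (φ.prod ψ) (ψ.prod φ) := by
  have h₁ : ∀ j, Equiv.sumCongr finAddFlip finAddFlip (swapIndex n' N' n N (.inl j)) =
      swapIndex n N n' N' (.inr j) := by
    rintro (j | j)
    · rw [swapIndex_inl_inl, swapIndex_inr_inl]
      exact congrArg Sum.inl (finAddFlip_apply_castAdd _ _)
    · rw [swapIndex_inl_inr, swapIndex_inr_inr]
      exact congrArg Sum.inr (finAddFlip_apply_castAdd _ _)
  have h₂ : ∀ j, Equiv.sumCongr finAddFlip finAddFlip (swapIndex n' N' n N (.inr j)) =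
      swapIndex n N n' N' (.inl j) := by
    rintro (j | j)
    · rw [swapIndex_inl_inl, swapIndex_inr_inl]
      exact congrArg Sum.inl (finAddFlip_apply_natAdd _ _)
    · rw [swapIndex_inl_inr, swapIndex_inr_inr]
      exact congrArg Sum.inr (finAddFlip_apply_natAdd _ _)
  refine ⟨fun R x v => ?_, fun R x v hv => ?_⟩
  · refine (TauPoint.mem_prod _ _ _).trans (Iff.trans ?_ (TauPoint.mem_prod _ _ _).symm)
    simp only [Function.comp_apply, h₁, h₂]
    exact and_comm
  · refine (TauPoint.mkQ_eq_prod_sec _ _ _).2 ?_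
    simp only [Function.comp_apply, h₁, h₂]
    exact ((TauPoint.mkQ_eq_prod_sec _ _ _).1 hv).symm

lemma Reorders.prod_assoc (φ : TauMap W n N) (ψ : TauMap W n' N') (χ : TauMap W n'' N'') :
    Reorders (Equiv.sumCongr (finCongr (Nat.add_assoc _ _ _).symm)
      (finCongr (Nat.add_assoc _ _ _).symm)) ((φ.prod ψ).prod χ) (φ.prod (ψ.prod χ)) := by
  have h₁ : ∀ j, Equiv.sumCongr (finCongr (Nat.add_assoc n n' n'').symm)
      (finCongr (Nat.add_assoc N N' N'').symm) (swapIndex n N (n' + n'') (N' + N'') (.inl j)) =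
      swapIndex (n + n') (N + N') n'' N'' (.inl (swapIndex n N n' N' (.inl j))) := by
    rintro (j | j) <;> rfl
  have h₂ : ∀ j, Equiv.sumCongr (finCongr (Nat.add_assoc n n' n'').symm)
      (finCongr (Nat.add_assoc N N' N'').symm) (swapIndex n N (n' + n'') (N' + N'')
        (.inr (swapIndex n' N' n'' N'' (.inl j)))) =
      swapIndex (n + n') (N + N') n'' N'' (.inl (swapIndex n N n' N' (.inr j))) := by
    rintro (j | j) <;> rfl
  have h₃ : ∀ j, Equiv.sumCongr (finCongr (Nat.add_assoc n n' n'').symm)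
      (finCongr (Nat.add_assoc N N' N'').symm) (swapIndex n N (n' + n'') (N' + N'')
        (.inr (swapIndex n' N' n'' N'' (.inr j)))) =
      swapIndex (n + n') (N + N') n'' N'' (.inr j) := by
    rintro (j | j)
    · refine congrArg Sum.inl (Fin.ext ?_)
      simp [Nat.add_assoc]
    · refine congrArg Sum.inr (Fin.ext ?_)
      simp [Nat.add_assoc]
  refine ⟨fun R x v => ?_, fun R x v hv => ?_⟩
  · refine (TauPoint.mem_prod _ _ _).trans (Iff.trans ?_ (TauPoint.mem_prod _ _ _).symm)
    refine (and_congr_left' (TauPoint.mem_prod _ _ _)).trans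
      (Iff.trans ?_ (and_congr_right' (TauPoint.mem_prod _ _ _)).symm)
    simp only [Function.comp_apply, h₁, h₂, h₃]
    exact and_assoc
  · have h := (TauPoint.mkQ_eq_prod_sec _ _ _).1 hv
    have h' := (TauPoint.mkQ_eq_prod_sec _ _ _).1 h.1
    refine (TauPoint.mkQ_eq_prod_sec _ _ _).2 ⟨?_, (TauPoint.mkQ_eq_prod_sec _ _ _).2 ⟨?_, ?_⟩⟩
    · simp only [Function.comp_apply, h₁]
      exact h'.1
    · simp only [Function.comp_apply, h₂]
      exact h'.2
    · simp only [Function.comp_apply, h₃]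
      exact h.2

lemma Reorders.prod_zero (φ : TauMap W n N) :
    Reorders (Equiv.refl _) (φ.prod (zero W 0)) φ := by
  have h : ∀ j, swapIndex n N 0 0 (.inl j) = j := by
    rintro (j | j) <;> rfl
  refine ⟨fun R x v => ?_, fun R x v hv => ?_⟩
  · refine (TauPoint.mem_prod _ _ _).trans ((and_iff_left (mem_zero _ _)).trans ?_)
    simp only [h]
    rfl
  · have := ((TauPoint.mkQ_eq_prod_sec _ _ _).1 hv).1
    simp only [h] at this
    exact this

end TauMap

namespace PreFr

variable {n N n' N' : ℕ} {X : Scheme.{u}} {Y Y' : Scheme.{u}ᵒᵖ ⥤ Type u}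

/-- The correspondence with the same framed support and another map to a presheaf. -/
abbrev withMap (c : PreFr n N X Y) (g : Y'.obj (op c.W)) : PreFr n N X Y' where
  Z := c.Z
  finite := c.finite
  W := c.W
  e := c.e
  nhd := c.nhd
  φ := c.φ
  zero_iff := c.zero_iff
  g := g

/-- The neighbourhood of a product is a fibre product over `X`, so the decomposition of `c.W` into
two open parts pulls back to it. -/
lemma IsDisjUnion.mul_right {a b c : PreFr n N X Y} (h : IsDisjUnion a b c)
    (d : PreFr n' N' X Y') : IsDisjUnion (a.mul d) (b.mul d) (c.mul d) := by
  obtain ⟨h1, h2, i, j, hi, hj, hc, he, he', hφ, hφ', hg, hg'⟩ := h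
  have hi' : i ≫ c.e ≫ Aff.proj n X = a.e ≫ Aff.proj n X := by rw [← he, Category.assoc]
  have hj' : j ≫ c.e ≫ Aff.proj n X = b.e ≫ Aff.proj n X := by rw [← he', Category.assoc]
  refine ⟨?_, ?_, _, _, (range_lift hi').1, (range_lift hj').1, ?_, ?_, ?_, ?_, ?_, ?_, ?_⟩
  · rw [disjoint_iff] at h1 ⊢
    ext x
    have := congrArg (fun S : Closeds (Aff n X) => Aff.left n n' X x ∈ S) h1
    refine ⟨fun h => ?_, False.elim⟩
    exact (Eq.to_iff this).1 ⟨h.1.1, h.2.1⟩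
  · ext x
    change Aff.left n n' X x ∈ c.Z ∧ Aff.right n n' X x ∈ d.Z ↔
      (Aff.left n n' X x ∈ a.Z ∧ Aff.right n n' X x ∈ d.Z) ∨
        (Aff.left n n' X x ∈ b.Z ∧ Aff.right n n' X x ∈ d.Z)
    rw [h2, ← or_and_right]
    rfl
  · rw [(range_lift hi').2, (range_lift hj').2]
    rw [← hc.compl_eq, Set.preimage_compl]
    exact isCompl_compl
  · apply (Aff.isPullback n n' X).hom_ext
    · rw [Category.assoc, Aff.pair_left, Aff.pair_left, pullback.lift_fst_assoc, Category.assoc, he]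
    · rw [Category.assoc, Aff.pair_right, Aff.pair_right, pullback.lift_snd_assoc]
  · apply (Aff.isPullback n n' X).hom_ext
    · rw [Category.assoc, Aff.pair_left, Aff.pair_left, pullback.lift_fst_assoc, Category.assoc,
        he']
    · rw [Category.assoc, Aff.pair_right, Aff.pair_right, pullback.lift_snd_assoc]
  · rw [TauMap.prod_comp, TauMap.comp_comp, TauMap.comp_comp, pullback.lift_fst, pullback.lift_snd,
      ← TauMap.comp_comp, ← hφ]
  · rw [TauMap.prod_comp, TauMap.comp_comp, TauMap.comp_comp, pullback.lift_fst, pullback.lift_snd,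
      ← TauMap.comp_comp, ← hφ']
  · refine Prod.ext ?_ ?_
    · change _ = Y.map _ (Y.map _ c.g)
      rw [restr_restr, pullback.lift_fst, ← restr_restr, ← hg]
    · change _ = Y'.map _ (Y'.map _ d.g)
      rw [restr_restr, pullback.lift_snd]
  · refine Prod.ext ?_ ?_
    · change _ = Y.map _ (Y.map _ c.g)
      rw [restr_restr, pullback.lift_fst, ← restr_restr, ← hg']
    · change _ = Y'.map _ (Y'.map _ d.g)
      rw [restr_restr, pullback.lift_snd]

end PreFr

section

variable {k : Type u} [Field k] {n N n' N' n'' N'' m : ℕ}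
  {Y Y' Y'' : Scheme.{u}ᵒᵖ ⥤ Type u}

lemma cls_eq_of_reorders (c : PreFr n N (Spec (.of k)) (Gm m))
    (d : PreFr n' N' (Spec (.of k)) (Gm m)) (π : Fin n' ≃ Fin n)
    (σ : Fin n' ⊕ Fin N' ≃ Fin n ⊕ Fin N) (i : c.W ⟶ d.W) (he : i ≫ d.e = c.e ≫ Aff.reorder _ π)
    (hZ : ∀ x, x ∈ c.Z ↔ Aff.reorder _ π x ∈ d.Z) (hφ : TauMap.Reorders σ c.φ (d.φ.comp i))
    (hg : c.g = (Gm m).map i.op d.g) : cls k c = cls k d :=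
  cls_eq_of_reorder c d π σ i he hZ hφ.mem hφ.sec hg

/-- Commutativity of the external product. -/
lemma cls_mul_comm (a : PreFr n N (Spec (.of k)) Y) (b : PreFr n' N' (Spec (.of k)) Y')
    (s : FunctorToTypes.prod Y Y' ⟶ Gm m) (t : FunctorToTypes.prod Y' Y ⟶ Gm m)
    (h : ∀ W y y', s.app W (y, y') = t.app W (y', y)) :
    cls k ((a.mul b).push s) = cls k ((b.mul a).push t) := by
  have hl : Aff.reorder (Spec (.of k)) (finAddFlip (m := n') (n := n)) ≫ Aff.left n' n _ =
      Aff.right n n' _ := by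
    refine (Aff.reorder_comp _ _).trans (congrArg (Aff.reorder _) (funext fun j => ?_))
    exact finAddFlip_apply_castAdd _ _
  have hr : Aff.reorder (Spec (.of k)) (finAddFlip (m := n') (n := n)) ≫ Aff.right n' n _ =
      Aff.left n n' _ := by
    refine (Aff.reorder_comp _ _).trans (congrArg (Aff.reorder _) (funext fun j => ?_))
    exact finAddFlip_apply_natAdd _ _
  let i : pullback (a.e ≫ Aff.proj n _) (b.e ≫ Aff.proj n' _) ⟶
    pullback (b.e ≫ Aff.proj n' _) (a.e ≫ Aff.proj n _) :=
      pullback.lift (pullback.snd _ _) (pullback.fst _ _) pullback.condition.symm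
  have i₁ : i ≫ pullback.fst _ _ = pullback.snd _ _ := pullback.lift_fst _ _ _
  have i₂ : i ≫ pullback.snd _ _ = pullback.fst _ _ := pullback.lift_snd _ _ _
  -- Exchanging the factors flips the two blocks of affine coordinates and the blocks of basis
  -- vectors, which does not affect the class.
  refine cls_eq_of_reorders _ _ finAddFlip (Equiv.sumCongr finAddFlip finAddFlip) i ?_ ?_ ?_ ?_
  · apply (Aff.isPullback n' n _).hom_ext
    · rw [Category.assoc, Aff.pair_left, Category.assoc, hl, Aff.pair_right, ← Category.assoc, i₁]
    · rw [Category.assoc, Aff.pair_right, Category.assoc, hr, Aff.pair_left, ← Category.assoc, i₂]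
  · intro x
    refine and_comm.trans (and_congr (Eq.to_iff (congrArg (· ∈ b.Z) ?_))
      (Eq.to_iff (congrArg (· ∈ a.Z) ?_)))
    · rw [← Scheme.Hom.comp_apply, hl]
    · rw [← Scheme.Hom.comp_apply, hr]
  · have := TauMap.Reorders.prod_comm (a.φ.comp (pullback.fst (a.e ≫ Aff.proj n _)
      (b.e ≫ Aff.proj n' _))) (b.φ.comp (pullback.snd _ _))
    have h' : ((b.φ.comp (pullback.fst (b.e ≫ Aff.proj n' _) (a.e ≫ Aff.proj n _))).prod
        (a.φ.comp (pullback.snd _ _))).comp i = (b.φ.comp (pullback.snd _ _)).prod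
          (a.φ.comp (pullback.fst _ _)) := by
      rw [TauMap.prod_comp, TauMap.comp_comp, TauMap.comp_comp, i₁, i₂]
    rw [← h'] at this
    exact this
  · change s.app _ _ = (Gm m).map i.op (t.app _ _)
    rw [h, ← NatTrans.naturality_apply]
    refine congrArg _ (Prod.ext ?_ ?_)
    · exact (congrArg (fun f => Y'.map f.op b.g) i₁).symm.trans (restr_restr _ _ _ _).symm
    · exact (congrArg (fun f => Y.map f.op a.g) i₂).symm.trans (restr_restr _ _ _ _).symm

/-- Associativity of the external product. -/
lemma cls_mul_assoc (a : PreFr n N (Spec (.of k)) Y) (b : PreFr n' N' (Spec (.of k)) Y')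
    (c : PreFr n'' N'' (Spec (.of k)) Y'')
    (s : FunctorToTypes.prod (FunctorToTypes.prod Y Y') Y'' ⟶ Gm m)
    (t : FunctorToTypes.prod Y (FunctorToTypes.prod Y' Y'') ⟶ Gm m)
    (h : ∀ W y y' y'', s.app W ((y, y'), y'') = t.app W (y, (y', y''))) :
    cls k (((a.mul b).mul c).push s) = cls k ((a.mul (b.mul c)).push t) := by
  -- All blocks stay in the same order on both sides, so the reordering is only a cast between index
  -- types.
  let π : Fin (n + (n' + n'')) ≃ Fin (n + n' + n'') := finCongr (Nat.add_assoc _ _ _).symm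
  have h₁ : Aff.reorder (Spec (.of k)) π ≫ Aff.left n (n' + n'') _ =
      Aff.left (n + n') n'' _ ≫ Aff.left n n' _ := by
    refine (Aff.reorder_comp _ _).trans (Eq.trans ?_ (Aff.reorder_comp _ _).symm)
    exact congrArg (Aff.reorder _) (funext fun j => rfl)
  have h₂ : Aff.reorder (Spec (.of k)) π ≫ Aff.right n (n' + n'') _ ≫ Aff.left n' n'' _ =
      Aff.left (n + n') n'' _ ≫ Aff.right n n' _ := by
    refine (congrArg (Aff.reorder _ _ ≫ ·) (Aff.reorder_comp _ _)).trans ?_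
    refine (Aff.reorder_comp _ _).trans (Eq.trans ?_ (Aff.reorder_comp _ _).symm)
    exact congrArg (Aff.reorder _) (funext fun j => rfl)
  have h₃ : Aff.reorder (Spec (.of k)) π ≫ Aff.right n (n' + n'') _ ≫ Aff.right n' n'' _ =
      Aff.right (n + n') n'' _ := by
    refine (congrArg (Aff.reorder _ _ ≫ ·) (Aff.reorder_comp _ _)).trans ?_
    refine (Aff.reorder_comp _ _).trans ?_
    refine congrArg (Aff.reorder _) (funext fun j => Fin.ext ?_)
    simp [π, Nat.add_assoc]
  have e₁ : Aff.pair (Aff.pair a.e b.e) c.e ≫ Aff.reorder _ π ≫ Aff.left n (n' + n'') _ =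
      pullback.fst _ _ ≫ pullback.fst _ _ ≫ a.e := by
    rw [h₁, ← Category.assoc, Aff.pair_left, Category.assoc, Aff.pair_left]
  have e₂ : Aff.pair (Aff.pair a.e b.e) c.e ≫ Aff.reorder _ π ≫ Aff.right n (n' + n'') _ ≫
      Aff.left n' n'' _ = pullback.fst _ _ ≫ pullback.snd _ _ ≫ b.e := by
    rw [h₂, ← Category.assoc, Aff.pair_left, Category.assoc, Aff.pair_right]
  have e₃ : Aff.pair (Aff.pair a.e b.e) c.e ≫ Aff.reorder _ π ≫ Aff.right n (n' + n'') _ ≫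
      Aff.right n' n'' _ = pullback.snd _ _ ≫ c.e := by
    rw [h₃, Aff.pair_right]
  let V := pullback (Aff.pair a.e b.e ≫ Aff.proj (n + n') _) (c.e ≫ Aff.proj n'' _)
  have hp := pullback.condition (f := Aff.pair a.e b.e ≫ Aff.proj (n + n') _)
    (g := c.e ≫ Aff.proj n'' _)
  have hp' := pullback.condition (f := a.e ≫ Aff.proj n _) (g := b.e ≫ Aff.proj n' _)
  have w₁ : (pullback.fst _ _ ≫ pullback.snd _ _ : V ⟶ b.W) ≫ b.e ≫ Aff.proj n' _ =
      pullback.snd _ _ ≫ c.e ≫ Aff.proj n'' _ :=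
    (Category.assoc _ _ _).trans ((congrArg (pullback.fst _ _ ≫ ·)
      (hp'.symm.trans (Aff.pair_proj _ _).symm)).trans hp)
  let j : V ⟶ pullback (b.e ≫ Aff.proj n' _) (c.e ≫ Aff.proj n'' _) :=
    pullback.lift (pullback.fst _ _ ≫ pullback.snd _ _) (pullback.snd _ _) w₁
  have j₁ : j ≫ pullback.fst _ _ = pullback.fst _ _ ≫ pullback.snd _ _ := pullback.lift_fst _ _ _
  have j₂ : j ≫ pullback.snd _ _ = pullback.snd _ _ := pullback.lift_snd _ _ _
  have w₂ : (pullback.fst _ _ ≫ pullback.fst _ _ : V ⟶ a.W) ≫ a.e ≫ Aff.proj n _ =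
      j ≫ Aff.pair b.e c.e ≫ Aff.proj (n' + n'') _ := by
    refine (Category.assoc _ _ _).trans ((congrArg (pullback.fst _ _ ≫ ·) hp').trans ?_)
    rw [Aff.pair_proj b.e c.e, ← Category.assoc j, j₁, Category.assoc]
  let i : V ⟶ pullback (a.e ≫ Aff.proj n _) (Aff.pair b.e c.e ≫ Aff.proj (n' + n'') _) :=
    pullback.lift (pullback.fst _ _ ≫ pullback.fst _ _) j w₂
  have i₁ : i ≫ pullback.fst _ _ = pullback.fst _ _ ≫ pullback.fst _ _ := pullback.lift_fst _ _ _
  have i₂ : i ≫ pullback.snd _ _ = j := pullback.lift_snd _ _ _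
  refine cls_eq_of_reorders _ _ π
    (Equiv.sumCongr (finCongr (Nat.add_assoc _ _ _).symm) (finCongr (Nat.add_assoc _ _ _).symm))
    i ?_ ?_ ?_ ?_
  · apply (Aff.isPullback n (n' + n'') _).hom_ext
    · rw [Category.assoc, Category.assoc, e₁, Aff.pair_left, ← Category.assoc, i₁, Category.assoc]
    · rw [Category.assoc, Aff.pair_right, ← Category.assoc, i₂]
      apply (Aff.isPullback n' n'' _).hom_ext
      · simp only [Category.assoc]
        rw [e₂, Aff.pair_left, ← Category.assoc, j₁, Category.assoc]
      · simp only [Category.assoc]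
        rw [e₃, Aff.pair_right, ← Category.assoc, j₂]
  · intro x
    refine and_assoc.trans (and_congr (Eq.to_iff (congrArg (· ∈ a.Z) ?_))
      (and_congr (Eq.to_iff (congrArg (· ∈ b.Z) ?_)) (Eq.to_iff (congrArg (· ∈ c.Z) ?_))))
    · rw [← Scheme.Hom.comp_apply, ← Scheme.Hom.comp_apply, h₁]
    · rw [← Scheme.Hom.comp_apply, ← Scheme.Hom.comp_apply, ← Scheme.Hom.comp_apply,
        h₂]
    · rw [← Scheme.Hom.comp_apply, ← Scheme.Hom.comp_apply, h₃]
  · have := TauMap.Reorders.prod_assoc (W := V)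
      (a.φ.comp (pullback.fst _ _ ≫ pullback.fst _ _))
      (b.φ.comp (pullback.fst _ _ ≫ pullback.snd _ _)) (c.φ.comp (pullback.snd _ _))
    have h₁ : (a.φ.comp (pullback.fst (a.e ≫ Aff.proj n _)
        (Aff.pair b.e c.e ≫ Aff.proj (n' + n'') _))).comp i =
        a.φ.comp (pullback.fst _ _ ≫ pullback.fst _ _) := by rw [TauMap.comp_comp, i₁]
    have h₂ : (((b.φ.comp (pullback.fst _ _)).prod (c.φ.comp (pullback.snd _ _))).comp
        (pullback.snd (a.e ≫ Aff.proj n _) (Aff.pair b.e c.e ≫ Aff.proj (n' + n'') _))).comp i =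
        (b.φ.comp (pullback.fst _ _ ≫ pullback.snd _ _)).prod (c.φ.comp (pullback.snd _ _)) := by
      rw [TauMap.comp_comp, i₂, TauMap.prod_comp, TauMap.comp_comp, TauMap.comp_comp, j₁, j₂]
    have h₃ : ((a.φ.comp (pullback.fst (a.e ≫ Aff.proj n _) (b.e ≫ Aff.proj n' _))).prod
        (b.φ.comp (pullback.snd _ _))).comp (pullback.fst (Aff.pair a.e b.e ≫ Aff.proj (n + n') _)
          (c.e ≫ Aff.proj n'' _)) = (a.φ.comp (pullback.fst _ _ ≫ pullback.fst _ _)).prod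
      (b.φ.comp (pullback.fst _ _ ≫ pullback.snd _ _)) := by
      rw [TauMap.prod_comp, TauMap.comp_comp, TauMap.comp_comp]
    have h₄ := congrArg₂ TauMap.prod h₁ h₂
    have h₅ := congrArg (fun φ : TauMap V _ _ => φ.prod (c.φ.comp (pullback.snd _ _))) h₃
    exact this.congr h₅ h₄
  · change s.app _ _ = (Gm m).map i.op (t.app _ _)
    refine (h _ (Y.map (pullback.fst _ _).op (Y.map (pullback.fst _ _).op a.g))
      (Y'.map (pullback.fst _ _).op (Y'.map (pullback.snd _ _).op b.g)) _).trans ?_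
    rw [← NatTrans.naturality_apply]
    refine congrArg _ (Prod.ext ?_ (Prod.ext ?_ ?_))
    · exact (restr_restr Y _ _ a.g).trans ((congrArg (fun f => Y.map f.op a.g) i₁).symm.trans
        (restr_restr _ _ _ _).symm)
    · have k₁ : i ≫ pullback.snd _ _ ≫ pullback.fst _ _ = pullback.fst _ _ ≫ pullback.snd _ _ := by
        rw [← Category.assoc, i₂, j₁]
      exact (restr_restr Y' _ _ b.g).trans ((congrArg (fun f => Y'.map f.op b.g) k₁).symm.trans
        ((restr_restr _ _ _ _).symm.trans (congrArg (Y'.map i.op) (restr_restr _ _ _ _).symm)))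
    · have k₂ : i ≫ pullback.snd _ _ ≫ pullback.snd _ _ = pullback.snd _ _ := by
        rw [← Category.assoc, i₂, j₂]
      exact (congrArg (fun f => Y''.map f.op c.g) k₂).symm.trans
        ((restr_restr _ _ _ _).symm.trans (congrArg (Y''.map i.op) (restr_restr _ _ _ _).symm))

/-- The external product with a correspondence given by a map. -/
lemma cls_mul_ofMap (c : PreFr n N (Spec (.of k)) Y) (y : Y'.obj (op (Spec (.of k))))
    (s : FunctorToTypes.prod Y Y' ⟶ Gm m) : cls k ((c.mul (PreFr.ofMap y)).push s) =
      cls k (c.withMap (s.app _ (c.g, Y'.map (c.e ≫ Aff.proj n _).op y))) := by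
  refine cls_eq_of_reorders _ _ (Equiv.refl _) (Equiv.refl _) (pullback.fst _ _) ?_ ?_ ?_ ?_
  · exact (Aff.pair_left _ _).symm
  · intro x
    exact and_iff_left trivial
  · exact TauMap.Reorders.prod_zero _
  · refine Eq.trans ?_ (NatTrans.naturality_apply s (pullback.fst _ _).op _)
    refine congrArg (s.app _) (Prod.ext rfl ?_)
    have h : pullback.snd (c.e ≫ Aff.proj n _) ((PreFr.ofMap y).e ≫ Aff.proj 0 _) ≫ Aff.proj 0 _ =
        pullback.fst (c.e ≫ Aff.proj n _) ((PreFr.ofMap y).e ≫ Aff.proj 0 _) ≫ c.e ≫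
          Aff.proj n _ :=
      (congrArg (pullback.snd _ _ ≫ ·) (Category.id_comp (Aff.proj 0 (Spec (.of k)))).symm).trans
        pullback.condition.symm
    exact (restr_restr Y' _ _ y).trans ((congrArg (fun f => Y'.map f.op y) h).trans
      (restr_restr Y' _ _ y).symm)

end

end CobFr
end

/-! ### Multiplication by a fixed correspondence on `H⁰`. -/

noncomputable section
namespace CobFr

section

variable {k : Type u} [Field k] {n N n' N' m l : ℕ} {Y : Scheme.{u}ᵒᵖ ⥤ Type u}

/-- The class of the external product does not change under stabilisation of the first factor. -/
lemma cls_stabn_mul (c : PreFr n N (Spec (.of k)) (Gm m)) (d : PreFr n' N' (Spec (.of k)) Y)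
    (s : FunctorToTypes.prod (Gm m) Y ⟶ Gm l) :
    cls k ((c.stabn.mul d).push s) = cls k ((c.mul d).push s) := by
  -- The stabilisation is the product with the suspension, whose target is a point. The maps `s₁`
  -- and `s₂` ignore that factor, so associativity moves the suspension out of the product.
  let s₁ : FunctorToTypes.prod (FunctorToTypes.prod PreFr.ptPresheaf (Gm m)) Y ⟶ Gm l :=
    FunctorToTypes.prod.lift (FunctorToTypes.prod.fst ≫ FunctorToTypes.prod.snd)
      FunctorToTypes.prod.snd ≫ s
  let s₂ : FunctorToTypes.prod PreFr.ptPresheaf (FunctorToTypes.prod (Gm m) Y) ⟶ Gm l :=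
    FunctorToTypes.prod.snd ≫ s
  refine Eq.trans ?_ ((cls_mul_assoc (PreFr.suspension _) c d s₁ s₂ fun _ _ _ _ => rfl).trans
    (Eq.trans ?_ (cls_stabn ((c.mul d).push s))))
  · rfl
  · exact congrArg (cls k) (PreFr.stabn_push s (c.mul d))

/-- The zero appended to the first factor ends up in the middle of the basis of the product. With
the factors exchanged it stands at the end, and there only associativity of direct sums with the
zero bundle is needed. -/
lemma cls_stabN_mul (c : PreFr n N (Spec (.of k)) (Gm m)) (d : PreFr n' N' (Spec (.of k)) Y)
    (s : FunctorToTypes.prod (Gm m) Y ⟶ Gm l) :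
    cls k ((c.stabN.mul d).push s) = cls k ((c.mul d).push s) := by
  let s' : FunctorToTypes.prod Y (Gm m) ⟶ Gm l :=
    FunctorToTypes.prod.lift FunctorToTypes.prod.snd FunctorToTypes.prod.fst ≫ s
  rw [cls_mul_comm c.stabN d s s' fun _ _ _ => rfl, cls_mul_comm c d s s' fun _ _ _ => rfl,
    ← cls_stabN ((d.mul c).push s')]
  refine (cls_eq_of_reorders ((d.mul c).push s').stabN ((d.mul c.stabN).push s') (Equiv.refl _)
    (Equiv.sumCongr (finCongr (Nat.add_assoc n' n 0).symm)
      (finCongr (Nat.add_assoc N' N 1).symm)) (𝟙 _) ?_ ?_ ?_ ?_).symm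
  · refine (Category.id_comp _).trans (Eq.trans ?_ (congrArg (_ ≫ ·) Aff.reorder_id.symm))
    exact (Category.comp_id _).symm
  · intro x
    refine Eq.to_iff (congrArg (· ∈ (d.mul c).Z) ?_)
    exact (congrArg (fun f : Aff (n' + n) (Spec (.of k)) ⟶ Aff (n' + n) _ => f x)
      Aff.reorder_id).symm
  · exact (TauMap.Reorders.prod_assoc (d.φ.comp (pullback.fst _ _)) (c.φ.comp (pullback.snd _ _))
      (.zero _ 1)).congr rfl (TauMap.comp_id _)
  · exact (Functor.map_id_apply (Gm l) _ _).symm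

/-- The elements with the property form a subgroup, and the quotient by it vanishes since it kills
all classes. -/
lemma H0_induction {p : H0 k m → Prop}
    (h : ∀ (n N : ℕ) (c : PreFr n N (Spec (.of k)) (Gm m)), p (cls k c))
    (h_add : ∀ x y, p x → p y → p (x + y)) (h_neg : ∀ x, p x → p (-x)) (h_zero : p 0) (x : H0 k m) :
    p x := by
  let S : AddSubgroup (H0 k m) :=
    { carrier := {x | p x}, add_mem' := h_add _ _, zero_mem' := h_zero, neg_mem' := h_neg _ }
  have : QuotientAddGroup.mk' S = 0 := H0_hom_ext k fun n N c =>
    (QuotientAddGroup.eq_zero_iff _).2 (h n N c)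
  exact (QuotientAddGroup.eq_zero_iff x).1 (DFunLike.congr_fun this x)

/-- External multiplication with a correspondence on the right as a homomorphism. -/
lemma exists_mulHom (d : PreFr n' N' (Spec (.of k)) Y)
    (s : FunctorToTypes.prod (Gm m) Y ⟶ Gm l)
    (hs : ∀ i, ∃ j, ∀ W g y, s.app W ((Gm.setOne m i).app W g, y) =
      (Gm.setOne l j).app W (s.app W (g, y))) :
    ∃ ψ : H0 k m →+ H0 k l, ∀ (n N : ℕ) (c : PreFr n N (Spec (.of k)) (Gm m)),
      ψ (cls k c) = cls k ((c.mul d).push s) := by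
  -- By the two preceding lemmas the class of `c × d` depends only on the stable correspondence of
  -- `c`.
  let f : StableFr (Spec (.of k)) (Gm m) → H0 k l :=
    Quot.lift (fun c => Quot.lift (fun c => cls k ((c.mul d).push s))
        (fun c c' h => cls_eq_of_rel ((h.mul (.refl d)).push s)) c.2.2) (by
      rintro _ _ (⟨n, N, ⟨c⟩⟩ | ⟨n, N, ⟨c⟩⟩)
      · exact (cls_stabn_mul c d s).symm
      · exact (cls_stabN_mul c d s).symm)
  let ψ : ZF (Spec (.of k)) (Gm m) →+ H0 k l :=
    QuotientAddGroup.lift _ (FreeAbelianGroup.lift f) (by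
      rw [additivity, AddSubgroup.closure_le]
      rintro _ ⟨n, N, a, b, c, h, rfl⟩
      have := congrArg (clsHom k l) (ZF.mk_add_mk ((h.mul_right d).push s))
      rw [map_add, ← sub_eq_zero] at this
      rw [SetLike.mem_coe, AddMonoidHom.mem_ker, map_sub, map_add, FreeAbelianGroup.lift_apply_of,
        FreeAbelianGroup.lift_apply_of, FreeAbelianGroup.lift_apply_of]
      exact this)
  have hψ : ∀ (n N : ℕ) (c : PreFr n N (Spec (.of k)) (Gm m)),
      ψ (ZF.mk c) = cls k ((c.mul d).push s) := fun n N c => FreeAbelianGroup.lift_apply_of _ _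
  -- A degenerate first factor gives a degenerate product: this is the hypothesis `hs`.
  have h₁ : ∀ i x, ψ (ZF.push (Gm.setOne m i) x) = 0 := fun i x => by
    obtain ⟨j, hj⟩ := hs i
    refine DFunLike.congr_fun (f := ψ.comp (ZF.push (Gm.setOne m i))) (g := 0)
      (ZF.hom_ext fun n N c => ?_) x
    rw [AddMonoidHom.comp_apply, ZF.push_mk, hψ, AddMonoidHom.zero_apply]
    refine Eq.trans ?_ (clsHom_push_setOne k l j (ZF.mk ((c.mul d).push s)))
    rw [ZF.push_mk]
    refine cls_eq_of_rel (.of_hom rfl (𝟙 _) (Category.id_comp _) (TauMap.comp_id _).symm ?_)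
    refine Eq.trans ?_ (Functor.map_id_apply (Gm l) _ _).symm
    refine Eq.trans ?_ (hj _ _ _)
    refine congrArg (s.app _) (Prod.ext ?_ rfl)
    exact (NatTrans.naturality_apply (Gm.setOne m i) _ c.g).symm
  -- A homotopy of first factors is multiplied with the constant family `d` over the interval.
  have h₂ : ∀ x, ψ (ZF.pull (endpoint k 0) x) = ψ (ZF.pull (endpoint k 1) x) := fun x => by
    refine DFunLike.congr_fun (f := ψ.comp (ZF.pull (endpoint k 0)))
      (g := ψ.comp (ZF.pull (endpoint k 1))) (ZF.hom_ext fun n N c => ?_) x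
    have key : ∀ i, clsHom k l (ZF.pull (endpoint k i) (ZF.mk
        ((c.mul (d.pull (intervalProj k))).push s))) =
        cls k (((c.pull (endpoint k i)).mul d).push s) := fun i => by
      rw [ZF.pull_mk, ← cls_eq, PreFr.push_pull,
        cls_eq_of_rel ((PreFr.mul_pull (endpoint k i) c (d.pull (intervalProj k))).push s)]
      exact cls_eq_of_rel (((PreFr.Rel.refl _).mul
        (d.rel_pull_pull_of_section (endpoint_intervalProj k i))).push s)
    rw [AddMonoidHom.comp_apply, AddMonoidHom.comp_apply, ZF.pull_mk, ZF.pull_mk, hψ, hψ, ← key,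
      ← key, clsHom_pull_endpoint]
  obtain ⟨ψ', h⟩ := exists_lift_clsHom k ψ h₁ h₂
  exact ⟨ψ', fun n N c => (h _).trans (hψ n N c)⟩

end

end CobFr
end

/-! ### The graded ring structure. -/

noncomputable section
namespace CobFr

/-- The isomorphism `𝔾_m^m ≅ 𝔾_m^m'` for `m = m'`. -/
def Gm.cast {m m' : ℕ} (h : m = m') : Gm.{u} m ⟶ Gm m' where
  app W := ↾fun g i => g (Fin.cast h.symm i)

lemma update_append_left {A : Type*} {m m' : ℕ} (g : Fin m → A) (g' : Fin m' → A) (i : Fin m)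
    (a : A) : Function.update (Fin.append g g') (Fin.castAdd m' i) a =
      Fin.append (Function.update g i a) g' := by
  funext j
  refine Fin.addCases (fun j => ?_) (fun j => ?_) j
  · simp only [Function.update_apply, Fin.append_left, (Fin.castAdd_injective m m').eq_iff]
  · rw [Function.update_of_ne, Fin.append_right, Fin.append_right]
    intro h
    have := congrArg Fin.val h
    simp at this
    omega

lemma update_append_right {A : Type*} {m m' : ℕ} (g : Fin m → A) (g' : Fin m' → A) (i : Fin m')
    (a : A) : Function.update (Fin.append g g') (Fin.natAdd m i) a =
      Fin.append g (Function.update g' i a) := by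
  funext j
  refine Fin.addCases (fun j => ?_) (fun j => ?_) j
  · rw [Function.update_of_ne, Fin.append_left, Fin.append_left]
    intro h
    have := congrArg Fin.val h
    simp at this
    omega
  · simp only [Function.update_apply, Fin.append_right, (Fin.natAdd_injective m' m).eq_iff]

section

variable {k : Type u} [Field k] {n N n' N' l m m' m'' : ℕ} {Y Y' Y₁ : Scheme.{u}ᵒᵖ ⥤ Type u}

lemma cls_push_mul (c : PreFr n N (Spec (.of k)) Y) (α : Y ⟶ Y₁)
    (d : PreFr n' N' (Spec (.of k)) Y') (s : FunctorToTypes.prod Y₁ Y' ⟶ Gm m) :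
    cls k (((c.push α).mul d).push s) = cls k ((c.mul d).push
      (FunctorToTypes.prod.lift (FunctorToTypes.prod.fst ≫ α) FunctorToTypes.prod.snd ≫ s)) := by
  refine cls_eq_of_rel (.of_hom rfl (𝟙 _) (Category.id_comp _) (TauMap.comp_id _).symm ?_)
  refine Eq.trans ?_ (Functor.map_id_apply (Gm m) _ _).symm
  refine congrArg (s.app _) (Prod.ext ?_ rfl)
  exact (NatTrans.naturality_apply α _ c.g).symm

lemma cls_mul_push (c : PreFr n N (Spec (.of k)) Y) (d : PreFr n' N' (Spec (.of k)) Y')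
    (α : Y' ⟶ Y₁) (s : FunctorToTypes.prod Y Y₁ ⟶ Gm m) :
    cls k ((c.mul (d.push α)).push s) = cls k ((c.mul d).push
      (FunctorToTypes.prod.lift FunctorToTypes.prod.fst (FunctorToTypes.prod.snd ≫ α) ≫ s)) := by
  refine cls_eq_of_rel (.of_hom rfl (𝟙 _) (Category.id_comp _) (TauMap.comp_id _).symm ?_)
  refine Eq.trans ?_ (Functor.map_id_apply (Gm m) _ _).symm
  refine congrArg (s.app _) (Prod.ext rfl ?_)
  exact (NatTrans.naturality_apply α _ d.g).symm

/-- The isomorphism `H⁰(C_* ℤF^cob(pt, 𝔾_m^∧m)) ≅ H⁰(C_* ℤF^cob(pt, 𝔾_m^∧m'))` for `m = m'`. -/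
def castH0 (h : m = m') : H0 k m →+ H0 k m' := by
  subst h
  exact AddMonoidHom.id _

lemma castH0_cls (h : m = m') (c : PreFr n N (Spec (.of k)) (Gm m)) :
    castH0 h (cls k c) = cls k (c.push (Gm.cast h)) := by
  subst h
  rfl

/-- The ring axioms relate elements of groups whose degrees agree only propositionally; this turns
them into equations after a cast. -/
lemma gradedMonoid_mk_eq (h : m = m') {x : H0 k m} {y : H0 k m'} (hxy : castH0 h x = y) :
    (GradedMonoid.mk m x : GradedMonoid (H0 k)) = GradedMonoid.mk m' y := by
  subst h hxy
  rfl

lemma exists_mulRight (d : PreFr n' N' (Spec (.of k)) (Gm m')) (m : ℕ) :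
    ∃ ψ : H0 k m →+ H0 k (m + m'), ∀ (n N : ℕ) (c : PreFr n N (Spec (.of k)) (Gm m)),
      ψ (cls k c) = cls k ((c.mul d).push (Gm.append m m')) := by
  refine exists_mulHom d _ fun i => ⟨Fin.castAdd m' i, fun W g y => ?_⟩
  exact (update_append_left g y i (1 : Γ(unop W, ⊤)ˣ)).symm

/-- By `cls_mul_comm`, left multiplication is right multiplication followed by an exchange of the
two blocks of coordinates of the target. -/
lemma exists_mulLeft (c : PreFr n N (Spec (.of k)) (Gm m)) (m' : ℕ) :
    ∃ ψ : H0 k m' →+ H0 k (m + m'), ∀ (n' N' : ℕ) (d : PreFr n' N' (Spec (.of k)) (Gm m')),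
      ψ (cls k d) = cls k ((c.mul d).push (Gm.append m m')) := by
  obtain ⟨ψ, h⟩ := exists_mulHom (m := m') c
    (FunctorToTypes.prod.lift FunctorToTypes.prod.snd FunctorToTypes.prod.fst ≫ Gm.append m m')
    fun i => ⟨Fin.natAdd m i, fun W g y =>
      (update_append_right y g i (1 : Γ(unop W, ⊤)ˣ)).symm⟩
  exact ⟨ψ, fun n' N' d => (h _ _ d).trans (cls_mul_comm _ _ _ _ fun _ _ _ => rfl)⟩

/-- The homomorphism `[d] ↦ [c × d]`. -/
def mulLeft (c : PreFr n N (Spec (.of k)) (Gm m)) (m' : ℕ) : H0 k m' →+ H0 k (m + m') :=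
  (exists_mulLeft c m').choose

lemma mulLeft_cls (c : PreFr n N (Spec (.of k)) (Gm m)) (d : PreFr n' N' (Spec (.of k)) (Gm m')) :
    mulLeft c m' (cls k d) = cls k ((c.mul d).push (Gm.append m m')) :=
  (exists_mulLeft c m').choose_spec n' N' d

/-- The elements `y` for which right multiplication by `y` exists form a subgroup containing all
classes. -/
lemma exists_mul (m : ℕ) (y : H0 k m') : ∃ ψ : H0 k m →+ H0 k (m + m'),
    ∀ (n N : ℕ) (c : PreFr n N (Spec (.of k)) (Gm m)), ψ (cls k c) = mulLeft c m' y := by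
  induction y using H0_induction with
  | h n' N' d =>
    obtain ⟨ψ, h⟩ := exists_mulRight d m
    exact ⟨ψ, fun n N c => (h n N c).trans (mulLeft_cls c d).symm⟩
  | h_add x y hx hy =>
    obtain ⟨ψ, h⟩ := hx
    obtain ⟨ψ', h'⟩ := hy
    exact ⟨ψ + ψ', fun n N c => by rw [AddMonoidHom.add_apply, h, h', map_add]⟩
  | h_neg x hx =>
    obtain ⟨ψ, h⟩ := hx
    exact ⟨-ψ, fun n N c => by rw [AddMonoidHom.neg_apply, h, map_neg]⟩
  | h_zero => exact ⟨0, fun n N c => by rw [AddMonoidHom.zero_apply, map_zero]⟩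

/-- The multiplication induced by the external product. -/
def gmul (m m' : ℕ) : H0 k m →+ H0 k m' →+ H0 k (m + m') :=
  -- The chosen homomorphisms are determined by their values on classes, and these are additive in
  -- `y`.
  (AddMonoidHom.mk' (fun y => (exists_mul (k := k) m y).choose) fun y y' =>
    H0_hom_ext k fun n N c => by
      rw [AddMonoidHom.add_apply, (exists_mul m _).choose_spec, (exists_mul m _).choose_spec,
        (exists_mul m _).choose_spec, map_add]).flip

lemma gmul_cls (c : PreFr n N (Spec (.of k)) (Gm m)) (d : PreFr n' N' (Spec (.of k)) (Gm m')) :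
    gmul m m' (cls k c) (cls k d) = cls k ((c.mul d).push (Gm.append m m')) :=
  ((exists_mul m (cls k d)).choose_spec n N c).trans (mulLeft_cls c d)

/-- The unit of the multiplication. -/
def gone : H0 k 0 := cls k (PreFr.ofMap (point (k := k) Fin.elim0))

lemma gmul_gone (x : H0 k m) : gmul m 0 x gone = x := by
  induction x using H0_induction with
  | h n N c =>
    rw [gone, gmul_cls, cls_mul_ofMap]
    refine congrArg (fun g => cls k (c.withMap g)) (a₂ := c.g) ?_
    exact Fin.append_right_nil _ _ rfl
  | h_add x y hx hy => rw [map_add, AddMonoidHom.add_apply, hx, hy]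
  | h_neg x hx => rw [map_neg, AddMonoidHom.neg_apply, hx]
  | h_zero => rw [map_zero, AddMonoidHom.zero_apply]

/-- Commutativity moves the unit to the right, where `cls_mul_ofMap` computes the product. -/
lemma gone_gmul (x : H0 k m) : castH0 (Nat.zero_add m) (gmul 0 m gone x) = x := by
  induction x using H0_induction with
  | h n N c =>
    rw [gone, gmul_cls, castH0_cls]
    refine (cls_mul_comm _ _ (Gm.append 0 m ≫ Gm.cast (Nat.zero_add m))
      (FunctorToTypes.prod.lift FunctorToTypes.prod.snd FunctorToTypes.prod.fst ≫
        Gm.append 0 m ≫ Gm.cast (Nat.zero_add m)) fun _ _ _ => rfl).trans ?_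
    rw [cls_mul_ofMap]
    refine congrArg (fun g => cls k (c.withMap g)) (a₂ := c.g) (funext fun i => ?_)
    have h : ∀ u : Fin 0 → Γ(c.W, ⊤)ˣ,
        Fin.append u c.g (Fin.cast (Nat.zero_add m).symm i) = c.g i := fun u =>
      congrFun (Fin.append_left_nil u c.g rfl) _
    exact h ((Gm 0).map (c.e ≫ Aff.proj n _).op (point Fin.elim0))
  | h_add x y hx hy => rw [map_add, map_add, hx, hy]
  | h_neg x hx => rw [map_neg, map_neg, hx]
  | h_zero => rw [map_zero, map_zero]

lemma gmul_assoc (x : H0 k m) (y : H0 k m') (z : H0 k m'') :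
    castH0 (Nat.add_assoc m m' m'') (gmul (m + m') m'' (gmul m m' x y) z) =
      gmul m (m' + m'') x (gmul m' m'' y z) := by
  induction x using H0_induction with
  | h n N a =>
    induction y using H0_induction with
    | h n' N' b =>
      induction z using H0_induction with
      | h n'' N'' c =>
        rw [gmul_cls, gmul_cls, castH0_cls, gmul_cls, gmul_cls]
        refine (cls_push_mul _ _ _ (Gm.append (m + m') m'' ≫ Gm.cast (Nat.add_assoc m m' m''))).trans
          (Eq.trans ?_ (cls_mul_push _ _ _ _).symm)
        refine cls_mul_assoc a b c _ _ fun W y y' y'' => funext fun i => ?_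
        exact (congrFun (Fin.append_assoc y y' y'') _)
      | h_add x y hx hy => simp only [map_add, hx, hy]
      | h_neg x hx => simp only [map_neg, hx]
      | h_zero => simp only [map_zero]
    | h_add x y hx hy => simp only [map_add, AddMonoidHom.add_apply, hx, hy]
    | h_neg x hx => simp only [map_neg, AddMonoidHom.neg_apply, hx]
    | h_zero => simp only [map_zero, AddMonoidHom.zero_apply]
  | h_add x y hx hy => simp only [map_add, AddMonoidHom.add_apply, hx, hy]
  | h_neg x hx => simp only [map_neg, AddMonoidHom.neg_apply, hx]
  | h_zero => simp only [map_zero, AddMonoidHom.zero_apply]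

variable (k) in
/-- The unit of the graded ring `⨁ H⁰(C_* ℤF^cob(pt, 𝔾_m^∧m))`. -/
@[reducible] def goneH0 : GradedMonoid.GOne (H0 k) := ⟨gone⟩

variable (k) in
/-- The multiplication of the graded ring `⨁ H⁰(C_* ℤF^cob(pt, 𝔾_m^∧m))`. -/
@[reducible] def gmulH0 : GradedMonoid.GMul (H0 k) := ⟨fun x y => gmul _ _ x y⟩

attribute [local instance] goneH0 gmulH0

variable (k) in
/-- The graded ring structure on `⨁ H⁰(C_* ℤF^cob(pt, 𝔾_m^∧m))` given by the external product. -/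
@[reducible] def gringH0 : DirectSum.GRing (H0 k) where
  mul_zero _ := map_zero _
  zero_mul y := DFunLike.congr_fun (map_zero (gmul _ _)) y
  mul_add _ _ _ := map_add _ _ _
  add_mul x y z := DFunLike.congr_fun (map_add (gmul _ _) x y) z
  one_mul x := gradedMonoid_mk_eq (Nat.zero_add _) (gone_gmul x.2)
  mul_one x := gradedMonoid_mk_eq (Nat.add_zero _) (gmul_gone x.2)
  mul_assoc x y z := gradedMonoid_mk_eq (Nat.add_assoc _ _ _) (gmul_assoc x.2 y.2 z.2)
  natCast n := n • gone
  natCast_zero := zero_smul _ _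
  natCast_succ n := succ_nsmul _ _
  intCast n := n • gone
  intCast_ofNat n := natCast_zsmul _ _
  intCast_negSucc_ofNat n := negSucc_zsmul _ _

end

end CobFr
end

/-! ### Splitting a support, and rescaling a section by a unit. -/

noncomputable section
namespace CobFr

lemma etale_coprod_desc {A B C : Scheme.{u}} (f : A ⟶ C) (g : B ⟶ C) [Etale f] [Etale g] :
    Etale (coprod.desc f g) := by
  have : IsZariskiLocalAtSource @Etale.{u} :=
    HasRingHomProperty.instIsZariskiLocalAtSource (Q := RingHom.Etale)
  refine IsZariskiLocalAtSource.of_openCover (P := @Etale) (coprodOpenCover.{_, 0} A B) ?_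
  rintro (⟨⟩ | ⟨⟩)
  · change Etale (coprod.inl ≫ coprod.desc f g)
    rw [coprod.inl_desc]; infer_instance
  · change Etale (coprod.inr ≫ coprod.desc f g)
    rw [coprod.inr_desc]; infer_instance

/-- Morphisms out of a scheme that is the union of two opens agree if they agree on these. -/
lemma hom_ext_of_isCompl {U W : Scheme.{u}} {A B : U.Opens} (h : IsCompl A B) {f g : U ⟶ W}
    (hA : A.ι ≫ f = A.ι ≫ g) (hB : B.ι ≫ f = B.ι ≫ g) : f = g := by
  obtain ⟨hc⟩ := nonempty_isColimit_binaryCofanMk_of_isCompl A.ι B.ι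
    (by rwa [Scheme.Opens.opensRange_ι, Scheme.Opens.opensRange_ι])
  refine BinaryCofan.IsColimit.hom_ext hc hA hB

lemma exists_desc_of_isCompl {U W : Scheme.{u}} {A B : U.Opens} (h : IsCompl A B)
    (f : (A : Scheme) ⟶ W) (g : (B : Scheme) ⟶ W) :
    ∃ l : U ⟶ W, A.ι ≫ l = f ∧ B.ι ≫ l = g := by
  obtain ⟨hc⟩ := nonempty_isColimit_binaryCofanMk_of_isCompl A.ι B.ι
    (by rwa [Scheme.Opens.opensRange_ι, Scheme.Opens.opensRange_ι])
  obtain ⟨l, h1, h2⟩ := BinaryCofan.IsColimit.desc' hc f g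
  exact ⟨l, h1, h2⟩

variable {n N : ℕ} {X : Scheme.{u}} {Y : Scheme.{u}ᵒᵖ ⥤ Type u}

/-- An étale neighbourhood of the union of two disjoint closed subsets may be replaced by the
disjoint union of the complements of (the preimages of) the two subsets. -/
lemma IsEtaleNhd.coprod {A W Wa Wb : Scheme.{u}} {Z Za Zb : Closeds A} {e : W ⟶ A}
    (h : IsEtaleNhd Z e) (hd : Disjoint Za Zb) (hZ : Z = Za ⊔ Zb) (ia : Wa ⟶ W) (ib : Wb ⟶ W)
    [IsOpenImmersion ia] [IsOpenImmersion ib]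
    (ha : ∀ w, w ∈ Set.range ia ↔ e w ∉ Zb) (hb : ∀ w, w ∈ Set.range ib ↔ e w ∉ Za) :
    IsEtaleNhd Z (coprod.desc (ia ≫ e) (ib ≫ e)) := by
  have := h.etale
  refine ⟨etale_coprod_desc _ _, (isIso_pullback_snd_iff _ _).2 fun U r => ?_⟩
  obtain ⟨v, hv, hv'⟩ := (isIso_pullback_snd_iff _ _).1 h.isIso U r
  have hmem : ∀ x : U, e (v x) ∈ Za ∨ e (v x) ∈ Zb := fun x => by
    have h1 : e (v x) = redι Z (r x) := by
      rw [← Scheme.Hom.comp_apply, hv, Scheme.Hom.comp_apply]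
    have h2 : e (v x) ∈ (Z : Set A) := by
      rw [h1, ← range_redι Z]; exact ⟨_, rfl⟩
    rw [hZ] at h2
    exact h2
  have hnot : ∀ y, y ∈ Za → y ∉ Zb := fun y h1 h2 => by
    have h3 : y ∈ Za ⊓ Zb := ⟨h1, h2⟩
    rw [hd.eq_bot] at h3
    exact h3
  -- `A'` and `B'` are the parts of `U` over `Za` and `Zb`. They are open and complementary because
  -- over `Z` avoiding one of the two sets means lying on the other.
  let A' : U.Opens := v ⁻¹ᵁ ia.opensRange
  let B' : U.Opens := v ⁻¹ᵁ ib.opensRange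
  have hA' : ∀ x, x ∈ A' ↔ e (v x) ∉ Zb := fun x => ha (v x)
  have hB' : ∀ x, x ∈ B' ↔ e (v x) ∉ Za := fun x => hb (v x)
  have hcomp : IsCompl A' B' := by
    constructor
    · rw [disjoint_iff]
      ext x
      have := hA' x
      have := hB' x
      have := hmem x
      simp only [Opens.coe_inf, Set.mem_inter_iff, SetLike.mem_coe, Opens.coe_bot,
        Set.mem_empty_iff_false]
      tauto
    · rw [codisjoint_iff]
      ext x
      have := hA' x
      have := hB' x
      have := hnot (e (v x))
      simp only [Opens.coe_sup, Set.mem_union, SetLike.mem_coe, Opens.coe_top,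
        Set.mem_univ]
      tauto
  have hra : Set.range (A'.ι ≫ v) ⊆ Set.range ia := by
    rintro _ ⟨x, rfl⟩
    exact x.2
  have hrb : Set.range (B'.ι ≫ v) ⊆ Set.range ib := by
    rintro _ ⟨x, rfl⟩
    exact x.2
  obtain ⟨l, hl1, hl2⟩ := exists_desc_of_isCompl hcomp
    (IsOpenImmersion.lift ia (A'.ι ≫ v) hra ≫ (coprod.inl : Wa ⟶ Wa ⨿ Wb))
    (IsOpenImmersion.lift ib (B'.ι ≫ v) hrb ≫ coprod.inr)
  have hdesc : coprod.desc (ia ≫ e) (ib ≫ e) = coprod.desc ia ib ≫ e := by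
    rw [coprod.desc_comp]
  refine ⟨l, hom_ext_of_isCompl hcomp ?_ ?_, fun w hw => ?_⟩
  · rw [reassoc_of% hl1, coprod.inl_desc, IsOpenImmersion.lift_fac_assoc, Category.assoc, hv]
  · rw [reassoc_of% hl2, coprod.inr_desc, IsOpenImmersion.lift_fac_assoc, Category.assoc, hv]
  · rw [hdesc, ← Category.assoc] at hw
    have hw1 := hv' _ hw
    have hwx : ∀ x, coprod.desc ia ib (w x) = v x := fun x => by
      rw [← hw1, Scheme.Hom.comp_apply]
    have hcov := (isCompl_range_inl_inr Wa Wb)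
    -- Uniqueness of the lift: over `A'` it cannot pass through the summand `Wb`, whose image in `A`
    -- avoids `Za`.
    have hwa : Set.range (A'.ι ≫ w) ⊆ Set.range (coprod.inl : Wa ⟶ Wa ⨿ Wb) := by
      rintro _ ⟨x, rfl⟩
      by_contra hx
      rw [← Set.mem_compl_iff, hcov.compl_eq] at hx
      obtain ⟨y, hy⟩ := hx
      have h1 : ib y = v x.1 := by
        rw [← hwx]
        change _ = coprod.desc ia ib ((A'.ι ≫ w) x)
        rw [← hy, ← Scheme.Hom.comp_apply, coprod.inr_desc]
      exact ((hb _).1 ⟨y, h1⟩) ((hmem x.1).resolve_right ((hA' _).1 x.2))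
    have hwb : Set.range (B'.ι ≫ w) ⊆ Set.range (coprod.inr : Wb ⟶ Wa ⨿ Wb) := by
      rintro _ ⟨x, rfl⟩
      by_contra hx
      rw [← Set.mem_compl_iff, hcov.symm.compl_eq] at hx
      obtain ⟨y, hy⟩ := hx
      have h1 : ia y = v x.1 := by
        rw [← hwx]
        change _ = coprod.desc ia ib ((B'.ι ≫ w) x)
        rw [← hy, ← Scheme.Hom.comp_apply, coprod.inl_desc]
      exact ((ha _).1 ⟨y, h1⟩) ((hmem x.1).resolve_left ((hB' _).1 x.2))
    refine hom_ext_of_isCompl hcomp ?_ ?_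
    · rw [hl1, ← IsOpenImmersion.lift_fac coprod.inl (A'.ι ≫ w) hwa]
      congr 1
      rw [← cancel_mono ia, IsOpenImmersion.lift_fac, ← hw1, ← Category.assoc]
      conv_rhs => rw [← IsOpenImmersion.lift_fac coprod.inl (A'.ι ≫ w) hwa]
      rw [Category.assoc, coprod.inl_desc]
    · rw [hl2, ← IsOpenImmersion.lift_fac coprod.inr (B'.ι ≫ w) hwb]
      congr 1
      rw [← cancel_mono ib, IsOpenImmersion.lift_fac, ← hw1, ← Category.assoc]
      conv_rhs => rw [← IsOpenImmersion.lift_fac coprod.inr (B'.ι ≫ w) hwb]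
      rw [Category.assoc, coprod.inr_desc]

namespace PreFr

/-- The additivity relation requires a neighbourhood that is a disjoint union. The two open subsets
of `c.W` may overlap, but their disjoint union is again an étale neighbourhood of the support, so
`c` may be replaced by its restriction to it. -/
lemma mk_add_mk_of_cover (a b c : PreFr n N X Y) (hd : Disjoint a.Z b.Z) (hZ : c.Z = a.Z ⊔ b.Z)
    (ia : a.W ⟶ c.W) (ib : b.W ⟶ c.W) [IsOpenImmersion ia] [IsOpenImmersion ib]
    (ha : ∀ w, w ∈ Set.range ia ↔ c.e w ∉ b.Z) (hb : ∀ w, w ∈ Set.range ib ↔ c.e w ∉ a.Z)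
    (hea : ia ≫ c.e = a.e) (heb : ib ≫ c.e = b.e)
    (hφa : a.φ = c.φ.comp ia) (hφb : b.φ = c.φ.comp ib)
    (hga : a.g = Y.map ia.op c.g) (hgb : b.g = Y.map ib.op c.g) :
    ZF.mk a + ZF.mk b = ZF.mk c := by
  have hdesc : coprod.desc (ia ≫ c.e) (ib ≫ c.e) = coprod.desc ia ib ≫ c.e := by
    rw [coprod.desc_comp]
  let d : PreFr n N X Y :=
    { Z := c.Z
      finite := c.finite
      W := a.W ⨿ b.W
      e := coprod.desc (ia ≫ c.e) (ib ≫ c.e)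
      nhd := c.nhd.coprod hd hZ ia ib ha hb
      φ := c.φ.comp (coprod.desc ia ib)
      zero_iff := fun K _ y t => by
        rw [hdesc, ← Category.assoc]
        exact c.zero_iff K (y ≫ coprod.desc ia ib) t
      g := Y.map (coprod.desc ia ib).op c.g }
  have hrel : Rel d c := Rel.of_hom rfl (coprod.desc ia ib) hdesc.symm rfl rfl
  rw [← ZF.mk_eq_of_rel hrel]
  refine ZF.mk_add_mk ⟨hd, hZ, (coprod.inl : a.W ⟶ a.W ⨿ b.W), (coprod.inr : b.W ⟶ a.W ⨿ b.W),
    inferInstance, inferInstance, isCompl_range_inl_inr _ _, ?_, ?_, ?_, ?_, ?_, ?_⟩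
  · exact (coprod.inl_desc _ _).trans hea
  · exact (coprod.inr_desc _ _).trans heb
  · rw [TauMap.comp_comp, coprod.inl_desc, hφa]
  · rw [TauMap.comp_comp, coprod.inr_desc, hφb]
  · rw [restr_restr, coprod.inl_desc, hga]
  · rw [restr_restr, coprod.inr_desc, hgb]

end PreFr

/-- The composite of an epimorphism with the multiplication by an invertible function. -/
def Framing.scale {W : Scheme.{u}} {n N : ℕ} (φ : TauMap W n N) {w : Γ(W, ⊤)} (hw : IsUnit w) :
    Framing φ N where
  q R x := evalAt x w • (φ.pt R x).quot.toSubmodule.mkQ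
  surjective R x y := by
    obtain ⟨v, hv⟩ := Submodule.mkQ_surjective _ y
    obtain ⟨a, ha⟩ := (isUnit_evalAt x hw).exists_right_inv
    refine ⟨a • v, ?_⟩
    rw [LinearMap.smul_apply, map_smul, smul_smul, ha, one_smul, hv]
  compat {R S} f x v w' hv := by
    rw [LinearMap.smul_apply, ← map_smul] at hv ⊢
    rw [← (φ.compat f x).mkQ_eq hv]
    congr 1
    ext j
    simp [evalAt_map]

/-- The automorphism `w` of `O` identifies `s` and the standard epimorphism with `w * s` and `w`
times the standard epimorphism. -/
lemma TauMap.ofSection_reframe_scale {W : Scheme.{u}} {w : Γ(W, ⊤)} (hw : IsUnit w)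
    (s : Γ(W, ⊤)) : (ofSection (w * s)).reframe (.scale _ hw) = ofSection s := by
  refine TauMap.ext fun R x => TauPoint.ext_of_forall (fun v => ?_) (fun v => ?_)
  · rw [mem_reframe, mem_ofSection]
    refine ((isUnit_evalAt x hw).smul_eq_zero
      (x := ((ofSection (w * s)).pt R x).quot.toSubmodule.mkQ v)).trans ?_
    rw [← mem_ofSection (w * s) x v]
    exact Submodule.Quotient.mk_eq_zero _
  · refine Iff.mp (b := ((ofSection s).pt R x).quot.toSubmodule.mkQ v = _) ?_
    rw [mkQ_eq_reframe_sec, mkQ_eq_ofSection_sec]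
    change evalAt x w • ((ofSection (w * s)).pt R x).quot.toSubmodule.mkQ v =
      ((ofSection (w * s)).pt R x).sec ↔ _
    rw [← map_smul, mkQ_eq_ofSection_sec, evalAt_mul, Pi.smul_apply, smul_eq_mul,
      (isUnit_evalAt x hw).mul_right_inj]

/-- Multiplying the section by an invertible function does not change the class. -/
lemma cls_eq_of_unit_mul {k : Type u} [Field k] {m : ℕ} (c d : PreFr 1 0 (Spec (.of k)) (Gm m))
    (hZ : c.Z = d.Z) (i : c.W ⟶ d.W) (he : i ≫ d.e = c.e) {w : Γ(c.W, ⊤)} (hw : IsUnit w)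
    {s : Γ(d.W, ⊤)} (hc : c.φ = TauMap.ofSection (w * i.appTop s)) (hd : d.φ = TauMap.ofSection s)
    (hg : c.g = (Gm m).map i.op d.g) : cls k c = cls k d := by
  rw [← cls_reframe c (.scale c.φ hw)]
  refine cls_eq_of_rel (.of_hom hZ i he ?_ hg)
  have h : ∀ φ : TauMap c.W 1 0, φ = TauMap.ofSection (w * i.appTop s) →
      φ.reframe (.scale φ hw) = TauMap.ofSection (i.appTop s) := by
    rintro _ rfl
    exact TauMap.ofSection_reframe_scale hw _
  rw [hd, TauMap.ofSection_comp]
  exact h _ hc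

end CobFr
end

/-! ### Correspondences given by functions on open subsets of the line. -/

noncomputable section
namespace CobFr

lemma isUnit_of_forall_mem_basicOpen {V : Scheme.{u}} {f : Γ(V, ⊤)}
    (h : ∀ x, x ∈ V.basicOpen f) : IsUnit f :=
  RingedSpace.isUnit_of_isUnit_germ V.toSheafedSpace ⊤ f fun x _ =>
    (V.mem_basicOpen_top f x).1 (h x)

lemma mem_basicOpen_prod_iff {V : Scheme.{u}} {ι : Type*} [Fintype ι] (f : ι → Γ(V, ⊤)) (x : V) :
    x ∈ V.basicOpen (∏ i, f i) ↔ ∀ i, x ∈ V.basicOpen (f i) := by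
  simp only [Scheme.mem_basicOpen_top]
  rw [map_prod, IsUnit.prod_univ_iff]

lemma exists_point {V : Scheme.{u}} (v : V) : ∃ (K : Type u) (_ : Field K) (y : Spec (.of K) ⟶ V)
    (t : Spec (.of K)), y t = v :=
  ⟨V.residueField v, inferInstance, V.fromSpecResidueField v, default,
    V.fromSpecResidueField_apply v default⟩

lemma mem_basicOpen_iff {V : Scheme.{u}} {K : Type u} [Field K] (y : Spec (.of K) ⟶ V)
    (t : Spec (.of K)) (f : Γ(V, ⊤)) : y t ∈ V.basicOpen f ↔ evalAt y f ≠ 0 := by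
  have h0 : y t ∈ V.basicOpen f ↔ t ∈ (Spec (.of K)).basicOpen (y.appTop f) := by
    rw [← Scheme.preimage_basicOpen_top]
    rfl
  rw [h0]
  constructor
  · intro h hf
    have h1 : y.appTop f = 0 := (map_eq_zero_iff (Scheme.ΓSpecIso (.of K)).commRingCatIsoToRingEquiv
        (RingEquiv.injective _)).1 hf
    rw [h1, Scheme.basicOpen_zero] at h
    exact h
  · intro h
    have h1 : IsUnit (y.appTop f) :=
      (isUnit_map_iff (Scheme.ΓSpecIso (.of K)).commRingCatIsoToRingEquiv _).1
        (isUnit_iff_ne_zero.2 h : IsUnit (evalAt y f : K))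
    rw [Scheme.basicOpen_of_isUnit _ h1]
    trivial

/-- The closed subset of zeros of a function. -/
def zeros {V : Scheme.{u}} (f : Γ(V, ⊤)) : Closeds V :=
  ⟨(V.basicOpen f : Set V)ᶜ, (V.basicOpen f).isOpen.isClosed_compl⟩

lemma mem_zeros {V : Scheme.{u}} {f : Γ(V, ⊤)} {v : V} : v ∈ zeros f ↔ v ∉ V.basicOpen f := Iff.rfl

lemma zeros_mul {V : Scheme.{u}} (f g : Γ(V, ⊤)) : zeros (f * g) = zeros f ⊔ zeros g := by
  ext v
  change v ∉ V.basicOpen (f * g) ↔ v ∉ V.basicOpen f ∨ v ∉ V.basicOpen g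
  rw [Scheme.basicOpen_mul, Opens.mem_inf]
  tauto

lemma zeros_preimage {V V' : Scheme.{u}} (p : V' ⟶ V) (f : Γ(V, ⊤)) :
    (zeros f).preimage p.continuous = zeros (p.appTop f) := by
  ext v
  change p v ∉ V.basicOpen f ↔ v ∉ V'.basicOpen (p.appTop f)
  rw [← Scheme.preimage_basicOpen_top]
  rfl

lemma mem_basicOpen_of_isCoprime {V : Scheme.{u}} {f g : Γ(V, ⊤)} (h : IsCoprime f g) {v : V}
    (hv : v ∈ zeros f) : v ∈ V.basicOpen g := by
  rw [mem_zeros, Scheme.mem_basicOpen_top] at hv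
  rw [Scheme.mem_basicOpen_top]
  obtain ⟨a, b, hab⟩ := h
  have h1 := congrArg (V.presheaf.germ ⊤ v trivial) hab
  rw [map_add, map_one, map_mul, map_mul] at h1
  rcases IsLocalRing.isUnit_or_isUnit_of_add_one h1 with h2 | h2
  · exact absurd (isUnit_of_mul_isUnit_right h2) hv
  · exact isUnit_of_mul_isUnit_right h2

lemma IsEtaleNhd.of_isOpenImmersion {A W : Scheme.{u}} {Z : Closeds A} (e : W ⟶ A)
    [IsOpenImmersion e] (h : (Z : Set A) ⊆ Set.range e) : IsEtaleNhd Z e := by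
  refine ⟨inferInstance, (isIso_pullback_snd_iff _ _).2 fun U r => ?_⟩
  have hr : Set.range (r ≫ redι Z) ⊆ Set.range e := by
    rintro _ ⟨x, rfl⟩
    refine h ?_
    rw [← range_redι Z, Scheme.Hom.comp_apply]
    exact ⟨_, rfl⟩
  refine ⟨IsOpenImmersion.lift e (r ≫ redι Z) hr, IsOpenImmersion.lift_fac _ _ _, fun v hv => ?_⟩
  rw [← cancel_mono e, hv, IsOpenImmersion.lift_fac]

lemma exists_restrict {V : Scheme.{u}} (U : V.Opens) (f : Γ(V, ⊤)) :
    ∃ (U' : V.Opens) (i : (U' : Scheme.{u}) ⟶ U), IsOpenImmersion i ∧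
      (∀ x, x ∈ U' ↔ x ∈ U ∧ x ∈ V.basicOpen f) ∧ i ≫ U.ι = U'.ι ∧
      ∀ w, w ∈ Set.range i ↔ U.ι w ∈ V.basicOpen f := by
  refine ⟨U ⊓ V.basicOpen f, V.homOfLE inf_le_left, inferInstance, fun _ => Iff.rfl,
    Scheme.homOfLE_ι _ _, fun w => ?_⟩
  refine (Eq.to_iff (congrArg (w ∈ ·) (Scheme.opensRange_homOfLE _))).trans ?_
  exact and_iff_right w.2

namespace PreFr

variable {X : Scheme.{u}} {Y : Scheme.{u}ᵒᵖ ⥤ Type u}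

/-- The correspondence of level `(1, 1 + 0)` given by a function `f` on an open subset of the
affine line. -/
def ofOpen (U : (Aff 1 X).Opens) (f : Γ(Aff 1 X, ⊤)) (Z : Closeds (Aff 1 X))
    (hfin : IsFinite (redι Z ≫ Aff.proj 1 X)) (hZ : ∀ v, v ∈ Z ↔ v ∈ U ∧ v ∈ zeros f)
    (g : Y.obj (op (U : Scheme.{u}))) : PreFr 1 0 X Y where
  Z := Z
  finite := hfin
  W := U
  e := U.ι
  nhd := .of_isOpenImmersion _ fun v hv => by
    rw [Scheme.Opens.range_ι]
    exact ((hZ v).1 hv).1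
  φ := .ofSection (U.ι.appTop f)
  zero_iff K _ y t := by
    rw [TauMap.ofSection_sec_eq_zero, ← evalAt_comp, hZ, mem_zeros, mem_basicOpen_iff, not_not]
    exact and_iff_right (y t).2
  g := g

end PreFr

section

variable {k : Type u} [Field k] {m : ℕ}

/-- Where `f'` is invertible, `f` and `f * f'` differ by a unit, and by coprimality no zero of `f`
is lost by restricting to that open set. -/
lemma exists_restrict_ofOpen (U : (Aff 1 (Spec (.of k))).Opens)
    (f f' : Γ(Aff 1 (Spec (.of k)), ⊤)) (h : IsCoprime f f') (Z : Closeds (Aff 1 (Spec (.of k))))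
    (hfin hZ) (g : (Gm m).obj (op (U : Scheme.{u}))) :
    ∃ c : PreFr 1 0 (Spec (.of k)) (Gm m), cls k (PreFr.ofOpen U f Z hfin hZ g) = cls k c ∧
      c.Z = Z ∧ ∃ i : c.W ⟶ (U : Scheme.{u}), IsOpenImmersion i ∧
        (∀ w, w ∈ Set.range i ↔ U.ι w ∈ (Aff 1 (Spec (.of k))).basicOpen f') ∧
        i ≫ U.ι = c.e ∧ c.φ = (TauMap.ofSection (U.ι.appTop (f * f'))).comp i ∧
        c.g = (Gm m).map i.op g := by
  obtain ⟨V, i, hi', hV, hi, hr⟩ := exists_restrict U f'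
  have hφ : TauMap.ofSection (V.ι.appTop (f * f')) =
      (TauMap.ofSection (U.ι.appTop (f * f'))).comp i := by
    rw [TauMap.ofSection_comp, ← Aff.comp_appTop_apply, hi]
  have hu : IsUnit (V.ι.appTop f') := isUnit_of_forall_mem_basicOpen fun x => by
    rw [← Scheme.preimage_basicOpen_top]
    exact ((hV _).1 x.2).2
  have hZV : ∀ v, v ∈ Z ↔ v ∈ V ∧ v ∈ zeros (f * f') := fun v => by
    have h1 := @mem_basicOpen_of_isCoprime _ f f' h v
    have h2 : v ∈ zeros (f * f') ↔ v ∈ zeros f ∨ v ∈ zeros f' := by rw [zeros_mul]; rfl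
    rw [hZ, hV, h2, mem_zeros (f := f')]
    tauto
  have h1 : TauMap.ofSection (V.ι.appTop (f * f')) =
      TauMap.ofSection (V.ι.appTop f' * i.appTop (U.ι.appTop f)) := by
    rw [← Aff.comp_appTop_apply, hi, map_mul, mul_comm]
  have h2 := (cls_eq_of_unit_mul (PreFr.ofOpen V (f * f') Z hfin hZV ((Gm m).map i.op g))
    (PreFr.ofOpen U f Z hfin hZ g) rfl i hi hu h1 rfl rfl).symm
  exact ⟨PreFr.ofOpen V (f * f') Z hfin hZV ((Gm m).map i.op g), h2, rfl, i, hi', hr, hi, hφ, rfl⟩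

/-- Coprimality makes the two supports disjoint. Both summands can be represented by the section `f
* f'` on smaller open sets, so they are the two parts of the correspondence on the left. -/
lemma cls_ofOpen_mul (U : (Aff 1 (Spec (.of k))).Opens) (f f' : Γ(Aff 1 (Spec (.of k)), ⊤))
    (h : IsCoprime f f') (Z Z' Z'' : Closeds (Aff 1 (Spec (.of k)))) (hfin hfin' hfin'')
    (hZ hZ' hZ'') (g : (Gm m).obj (op (U : Scheme.{u}))) :
    cls k (PreFr.ofOpen U (f * f') Z'' hfin'' hZ'' g) =
      cls k (PreFr.ofOpen U f Z hfin hZ g) + cls k (PreFr.ofOpen U f' Z' hfin' hZ' g) := by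
  obtain ⟨a, ha, haZ, ia, hia, har, hae, haφ, hag⟩ := exists_restrict_ofOpen U f f' h Z hfin hZ g
  obtain ⟨b, hb, hbZ, ib, hib, hbr, hbe, hbφ, hbg⟩ :=
    exists_restrict_ofOpen U f' f h.symm Z' hfin' hZ' g
  rw [mul_comm f' f] at hbφ
  have hd : Disjoint a.Z b.Z := by
    rw [haZ, hbZ, disjoint_iff]
    ext v
    change v ∈ Z ∧ v ∈ Z' ↔ False
    rw [hZ, hZ', mem_zeros (f := f')]
    have h1 := @mem_basicOpen_of_isCoprime _ f f' h v
    tauto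
  have hsup : Z'' = a.Z ⊔ b.Z := by
    rw [haZ, hbZ]
    ext v
    change v ∈ Z'' ↔ v ∈ Z ∨ v ∈ Z'
    rw [hZ, hZ', hZ'', zeros_mul, ← and_or_left]
    rfl
  have h1 : ∀ w, w ∈ Set.range ia ↔ U.ι w ∉ b.Z := fun w => by
    rw [har, hbZ, hZ', mem_zeros, not_and_not_right]
    exact ⟨fun h _ => h, fun h => h w.2⟩
  have h2 : ∀ w, w ∈ Set.range ib ↔ U.ι w ∉ a.Z := fun w => by
    rw [hbr, haZ, hZ, mem_zeros, not_and_not_right]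
    exact ⟨fun h _ => h, fun h => h w.2⟩
  have := @PreFr.mk_add_mk_of_cover _ _ _ _ a b (PreFr.ofOpen U (f * f') Z'' hfin'' hZ'' g) hd hsup
    ia ib hia hib h1 h2 hae hbe haφ hbφ hag hbg
  rw [ha, hb, cls_eq, cls_eq, cls_eq, ← this, map_add]

end

end CobFr
end

/-! ### Correspondences given by monic polynomials. -/

noncomputable section
namespace CobFr

section Line

variable (A : CommRingCat.{u}) {B C : CommRingCat.{u}}

/-- Polynomials as functions on the affine line. -/
def lineFun : Polynomial A →+* Γ(Aff 1 (Spec A), ⊤) :=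
  Polynomial.eval₂RingHom ((Scheme.ΓSpecIso A).inv ≫ (Aff.proj 1 (Spec A)).appTop).hom
    (Aff.x (Spec A) 0)

lemma lineFun_C (a : A) :
    lineFun A (.C a) = (Aff.proj 1 (Spec A)).appTop ((Scheme.ΓSpecIso A).inv a) :=
  Polynomial.eval₂_C _ _

lemma lineFun_X : lineFun A .X = Aff.x (Spec A) 0 := Polynomial.eval₂_X _ _

variable {A}

lemma map_lineFun (f : A ⟶ B) (P : Polynomial A) :
    (Aff.map 1 (Spec.map f)).appTop (lineFun A P) = lineFun B (P.map f.hom) := by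
  have : (Aff.map 1 (Spec.map f)).appTop.hom.comp (lineFun A) =
      (lineFun B).comp (Polynomial.mapRingHom f.hom) := by
    refine Polynomial.ringHom_ext (fun a => ?_) ?_
    · simp only [RingHom.comp_apply, Polynomial.coe_mapRingHom, Polynomial.map_C, lineFun_C]
      rw [← appTop_ΓSpecIso_inv]
      refine (Aff.comp_appTop_apply _ _ _).symm.trans (.trans ?_ (Aff.comp_appTop_apply _ _ _))
      rw [AffineSpace.map_over]
    · simp only [RingHom.comp_apply, Polynomial.coe_mapRingHom, Polynomial.map_X, lineFun_X]
      exact Aff.map_appTop_x _ _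
  exact congr($this P)

/-- The point of the affine line over `A` with values in an `A`-algebra given by an element. -/
def linePoint (f : A ⟶ B) (b : B) : Spec B ⟶ Aff 1 (Spec A) :=
  AffineSpace.homOfVector (Spec.map f) fun _ => (Scheme.ΓSpecIso B).inv b

lemma linePoint_proj (f : A ⟶ B) (b : B) : linePoint f b ≫ Aff.proj 1 (Spec A) = Spec.map f :=
  AffineSpace.homOfVector_over _ _

lemma linePoint_appTop (f : A ⟶ B) (b : B) (P : Polynomial A) :
    (linePoint f b).appTop (lineFun A P) = (Scheme.ΓSpecIso B).inv (P.eval₂ f.hom b) := by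
  have : (linePoint f b).appTop.hom.comp (lineFun A) =
      (Scheme.ΓSpecIso B).inv.hom.comp (Polynomial.eval₂RingHom f.hom b) := by
    refine Polynomial.ringHom_ext (fun a => ?_) ?_
    · simp only [RingHom.comp_apply, Polynomial.coe_eval₂RingHom, Polynomial.eval₂_C, lineFun_C]
      refine (Aff.comp_appTop_apply _ _ _).symm.trans ?_
      rw [linePoint_proj, appTop_ΓSpecIso_inv]
    · simp only [RingHom.comp_apply, Polynomial.coe_eval₂RingHom, Polynomial.eval₂_X, lineFun_X]
      exact AffineSpace.homOfVector_appTop_coord _ _ _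
  exact congr($this P)

lemma map_linePoint (f : A ⟶ B) (b : B) (g : B ⟶ C) :
    Spec.map g ≫ linePoint f b = linePoint (f ≫ g) (g b) := by
  refine Aff.hom_ext_coord ?_ fun i => ?_
  · rw [Category.assoc, linePoint_proj, linePoint_proj, Spec.map_comp]
  · obtain rfl : i = 0 := Subsingleton.elim _ _
    rw [Aff.comp_appTop_apply, ← lineFun_X, linePoint_appTop, linePoint_appTop,
      appTop_ΓSpecIso_inv, Polynomial.eval₂_X, Polynomial.eval₂_X]

lemma exists_eq_linePoint (y : Spec B ⟶ Aff 1 (Spec A)) :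
    ∃ (f : A ⟶ B) (b : B), y = linePoint f b := by
  refine ⟨Spec.preimage (y ≫ Aff.proj 1 _), (Scheme.ΓSpecIso B).hom (y.appTop (Aff.x _ 0)), ?_⟩
  refine Aff.hom_ext_coord ?_ fun i => ?_
  · rw [linePoint_proj, Spec.map_preimage]
  · obtain rfl : i = 0 := Subsingleton.elim _ _
    rw [← lineFun_X, linePoint_appTop, Polynomial.eval₂_X]
    simp

lemma evalAt_linePoint (f : A ⟶ B) (b : B) (P : Polynomial A) :
    evalAt (linePoint f b) (lineFun A P) = P.eval₂ f.hom b := by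
  rw [evalAt, linePoint_appTop]
  simp

/-- The zeros lie in the closed subscheme `Spec A[X]/(P)` of the line, which is finite over `A`
because `P` is monic. -/
lemma isFinite_zeros_lineFun {P : Polynomial A} (hP : P.Monic) :
    IsFinite (redι (zeros (lineFun A P)) ≫ Aff.proj 1 (Spec A)) := by
  let R : CommRingCat.{u} := .of (AdjoinRoot P)
  let f : A ⟶ R := CommRingCat.ofHom (AdjoinRoot.of P)
  have hc : IsClosedImmersion (linePoint f (AdjoinRoot.root P)) := by
    refine IsClosedImmersion.of_surjective_of_isAffine _ fun s => ?_
    obtain ⟨Q, hQ⟩ := AdjoinRoot.mk_surjective ((Scheme.ΓSpecIso R).hom s)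
    refine ⟨lineFun A Q, ?_⟩
    rw [linePoint_appTop]
    have : Q.eval₂ f.hom (AdjoinRoot.root P) = AdjoinRoot.mk P Q := AdjoinRoot.aeval_eq Q
    rw [this, hQ]
    simp
  refine isFinite_of_closedImmersion _ _ (linePoint f (AdjoinRoot.root P)) (fun v hv => ?_) ?_
  -- A point of the zero set is a root of `P` in some field, and a root is a homomorphism from
  -- `AdjoinRoot P`.
  · obtain ⟨K, _, y, t, rfl⟩ := exists_point v
    obtain ⟨ρ, b, rfl⟩ := exists_eq_linePoint y
    rw [SetLike.mem_coe, mem_zeros, mem_basicOpen_iff, not_not, evalAt_linePoint] at hv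
    let g : R ⟶ .of K := CommRingCat.ofHom (AdjoinRoot.lift ρ.hom b hv)
    have h : Spec.map g ≫ linePoint f (AdjoinRoot.root P) = linePoint ρ b := by
      rw [map_linePoint]
      congr 1
      · ext a
        exact AdjoinRoot.lift_of hv
      · exact AdjoinRoot.lift_root hv
    rw [← h]
    exact ⟨Spec.map g t, rfl⟩
  · rw [linePoint_proj, IsFinite.SpecMap_iff]
    exact RingHom.finite_algebraMap.2 hP.finite_adjoinRoot

end Line

/-- The `m`-tuple of units on the complement of their zeros given by `m` functions. -/
def tupleUnits {V : Scheme.{u}} {m : ℕ} (G : Fin m → Γ(V, ⊤)) :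
    (Gm m).obj (op (V.basicOpen (∏ i, G i) : Scheme.{u})) := fun i =>
  IsUnit.unit (a := (V.basicOpen (∏ i, G i)).ι.appTop (G i))
    (isUnit_of_forall_mem_basicOpen fun x => by
      rw [← Scheme.preimage_basicOpen_top]
      exact (mem_basicOpen_prod_iff G _).1 x.2 i)

section PolFr

open Polynomial

variable {A B : CommRingCat.{u}} {m : ℕ}

/-- The correspondence from `Spec A` to `𝔾_m^m` given by a monic polynomial and a tuple of
polynomials prime to it. -/
def polFr (P : A[X]) (G : Fin m → A[X]) (hP : P.Monic) (h : ∀ i, IsCoprime P (G i)) :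
    PreFr 1 0 (Spec A) (Gm m) :=
  .ofOpen ((Aff 1 (Spec A)).basicOpen (∏ i, lineFun A (G i))) (lineFun A P) (zeros (lineFun A P))
    (isFinite_zeros_lineFun hP) (fun _ => ⟨fun hv => ⟨(mem_basicOpen_prod_iff _ _).2 fun i =>
      mem_basicOpen_of_isCoprime ((h i).map (lineFun A)) hv, hv⟩, fun hv => hv.2⟩) (tupleUnits _)

lemma polFr_pull (f : A ⟶ B) (P : A[X]) (G : Fin m → A[X]) (hP h) (P' : B[X]) (G' : Fin m → B[X])
    (hP' h') (hPP' : P.map f.hom = P') (hGG' : ∀ i, (G i).map f.hom = G' i) :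
    PreFr.Rel ((polFr P G hP h).pull (Spec.map f)) (polFr P' G' hP' h') := by
  obtain rfl : (fun i => (G i).map f.hom) = G' := funext hGG'
  subst hPP'
  let U := (Aff 1 (Spec A)).basicOpen (∏ i, lineFun A (G i))
  let U' := (Aff 1 (Spec B)).basicOpen (∏ i, lineFun B ((G i).map f.hom))
  have hU : Aff.map 1 (Spec.map f) ⁻¹ᵁ U = U' := by
    rw [Scheme.preimage_basicOpen_top, map_prod]
    simp only [map_lineFun]
    rfl
  have hr : Set.range (pullback.snd U.ι (Aff.map 1 (Spec.map f))) ⊆ Set.range U'.ι := by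
    rw [Scheme.Pullback.range_snd, Scheme.Opens.range_ι, Scheme.Opens.range_ι, ← hU]
    rfl
  let i : pullback U.ι (Aff.map 1 (Spec.map f)) ⟶ U' := IsOpenImmersion.lift U'.ι _ hr
  have hi : i ≫ U'.ι = pullback.snd U.ι (Aff.map 1 (Spec.map f)) := IsOpenImmersion.lift_fac _ _ _
  have key : ∀ Q : A[X], (pullback.fst U.ι (Aff.map 1 (Spec.map f))).appTop
      (U.ι.appTop (lineFun A Q)) = i.appTop (U'.ι.appTop (lineFun B (Q.map f.hom))) := fun Q => by
    rw [← Aff.comp_appTop_apply, ← Aff.comp_appTop_apply, hi, pullback.condition,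
      Aff.comp_appTop_apply, map_lineFun]
  refine .of_hom ?_ i hi ?_ ?_
  · refine (zeros_preimage _ _).trans ?_
    rw [map_lineFun]
    rfl
  · refine (TauMap.ofSection_comp _ _).trans (.trans ?_ (TauMap.ofSection_comp _ _).symm)
    exact congrArg _ (key P)
  · funext j
    refine Units.ext ?_
    exact key (G j)

end PolFr

end CobFr
end

/-! ### Polynomial homotopies and rational points of the line. -/

noncomputable section
namespace CobFr

section

open Polynomial PreFr

variable {k : Type u} [Field k] {m : ℕ}

/-- `Q` is congruent to the constant `Q(a)` modulo `X - a`. -/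
lemma isCoprime_X_sub_C {R : Type*} [CommRing R] {a : R} {Q : R[X]} (h : IsUnit (Q.eval a)) :
    IsCoprime (X - C a) Q := by
  obtain ⟨q, hq⟩ := X_sub_C_dvd_sub_C_eval (a := a) (p := Q)
  obtain ⟨b, hb⟩ := h.exists_left_inv
  refine ⟨-C b * q, C b, ?_⟩
  have : C b * C (Q.eval a) = 1 := by rw [← C_mul, hb, C_1]
  linear_combination C b * hq + this

variable (k) in
/-- The coordinate ring of the interval as an algebra over the polynomial ring. -/
def intervalHom : CommRingCat.of k[X] ⟶ IntervalRing k :=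
  CommRingCat.ofHom (aeval (intervalCoord k : SimplexRing k 1)).toRingHom

variable (k) in
/-- The evaluation of functions on the interval at an endpoint. -/
def endpointHom (i : Fin 2) : IntervalRing k ⟶ CommRingCat.of k :=
  CommRingCat.ofHom (intervalEval k i).toRingHom

lemma intervalHom_comp_endpointHom {i : Fin 2} {t : k}
    (ht : intervalEval k i (intervalCoord k) = t) :
    intervalHom k ≫ endpointHom k i = CommRingCat.ofHom (evalRingHom t) := by
  subst ht
  have h : (intervalEval k i).comp (aeval (intervalCoord k : SimplexRing k 1)) =
      aeval (intervalEval k i (intervalCoord k)) := algHom_ext (by simp)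
  refine CommRingCat.hom_ext (RingHom.ext fun Q => ?_)
  exact (DFunLike.congr_fun h Q).trans (by rw [coe_aeval_eq_eval]; rfl)

lemma map_hom_map_hom {A B C : CommRingCat.{u}} (f : A ⟶ B) (g : B ⟶ C) (Q : Polynomial A) :
    (Q.map f.hom).map g.hom = Q.map (f ≫ g).hom := by
  rw [Polynomial.map_map, CommRingCat.hom_comp]

lemma isCoprime_map_hom {A B : CommRingCat.{u}} (f : A ⟶ B) {P Q : Polynomial A}
    (h : IsCoprime P Q) : IsCoprime (P.map f.hom) (Q.map f.hom) := by
  obtain ⟨a, b, hab⟩ := h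
  refine ⟨a.map f.hom, b.map f.hom, ?_⟩
  rw [← Polynomial.map_mul, ← Polynomial.map_mul, ← Polynomial.map_add, hab, Polynomial.map_one]

/-- Invariance under homotopies that are polynomial in a parameter. -/
lemma cls_polFr_homotopy (P : k[X][X]) (G : Fin m → k[X][X]) (hP : P.Monic)
    (h : ∀ i, IsCoprime P (G i)) {P₀ P₁ : k[X]} {G₀ G₁ : Fin m → k[X]} (hP₀ h₀ hP₁ h₁)
    (e₀ : P.map (evalRingHom 1) = P₀) (e₁ : P.map (evalRingHom 0) = P₁)
    (d₀ : ∀ i, (G i).map (evalRingHom 1) = G₀ i) (d₁ : ∀ i, (G i).map (evalRingHom 0) = G₁ i) :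
    cls k (polFr (A := .of k) P₀ G₀ hP₀ h₀) = cls k (polFr (A := .of k) P₁ G₁ hP₁ h₁) := by
  -- The inner variable of `k[X][X]` is the homotopy parameter, the outer one the coordinate of the
  -- line. The parameter becomes the coordinate of the interval, with values `1` and `0` at the
  -- endpoints.
  have key : ∀ (i : Fin 2) (t : k) (_ : intervalEval k i (intervalCoord k) = t)
      (Q : k[X][X]) (Q' : k[X]) (_ : Q.map (evalRingHom t) = Q'),
      (Q.map (intervalHom k).hom).map (endpointHom k i).hom = Q' := by
    intro i t ht Q Q' hQ
    rw [map_hom_map_hom, intervalHom_comp_endpointHom ht]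
    exact hQ
  have hP' : (P.map (intervalHom k).hom).Monic := hP.map _
  have h' : ∀ i, IsCoprime (P.map (intervalHom k).hom) ((G i).map (intervalHom k).hom) :=
    fun i => isCoprime_map_hom _ (h i)
  refine cls_eq_of_homotopy k (polFr (A := IntervalRing k) (P.map (intervalHom k).hom)
    (fun i => (G i).map (intervalHom k).hom) hP' h') ?_ ?_
  · exact polFr_pull (endpointHom k 0) _ _ _ _ _ _ _ _
      (key 0 1 (intervalEval_zero_coord k) _ _ e₀)
      fun i => key 0 1 (intervalEval_zero_coord k) _ _ (d₀ i)
  · exact polFr_pull (endpointHom k 1) _ _ _ _ _ _ _ _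
      (key 1 0 (intervalEval_one_coord k) _ _ e₁)
      fun i => key 1 0 (intervalEval_one_coord k) _ _ (d₁ i)

lemma cls_polFr_mul {P Q : k[X]} {G : Fin m → k[X]} (hP : P.Monic) (hQ : Q.Monic)
    (h : ∀ i, IsCoprime P (G i)) (h' : ∀ i, IsCoprime Q (G i)) (hPQ : IsCoprime P Q) :
    cls k (polFr (A := .of k) (P * Q) G (hP.mul hQ) fun i => (h i).mul_left (h' i)) =
      cls k (polFr (A := .of k) P G hP h) + cls k (polFr (A := .of k) Q G hQ h') := by
  have key : ∀ (U : (Aff 1 (Spec (.of k))).Opens) (f f' f'' : Γ(Aff 1 (Spec (.of k)), ⊤))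
      (_ : IsCoprime f f') (_ : f'' = f * f') (Z Z' Z'' : Closeds (Aff 1 (Spec (.of k))))
      (hfin hfin' hfin'' hZ hZ' hZ'') (g : (Gm m).obj (op (U : Scheme.{u}))),
      cls k (PreFr.ofOpen U f'' Z'' hfin'' hZ'' g) =
      cls k (PreFr.ofOpen U f Z hfin hZ g) + cls k (PreFr.ofOpen U f' Z' hfin' hZ' g) := by
    rintro U f f' _ hff rfl Z Z' Z'' _ _ _ _ _ _ g
    exact cls_ofOpen_mul U f f' hff Z Z' Z'' _ _ _ _ _ _ g
  exact key _ _ _ _ (hPQ.map (lineFun (.of k))) (map_mul _ _ _) _ _ _ _ _ _ _ _ _ _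

lemma zeros_lineFun_X : zeros (lineFun (.of k) X) = (suspension (Spec (.of k))).Z := by
  ext v
  obtain ⟨K, _, y, t, rfl⟩ := exists_point v
  refine Iff.trans ?_ (Aff.mem_range_zeroSection y t).symm
  refine (not_congr (mem_basicOpen_iff y t _)).trans ?_
  rw [not_not, lineFun_X]

/-- With the section `X` and a constant tuple one has the stabilisation of a point of `𝔾_m^m`,
restricted to an open subset of the line. -/
lemma cls_polFr_X_C (g : Fin m → kˣ) (hP h) :
    cls k (polFr (A := .of k) X (fun i => C (g i : k)) hP h) = cls k (ofMap (point g)) := by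
  rw [← cls_stabn (ofMap (point g))]
  refine Eq.trans ?_ (cls_mul_ofMap (suspension (Spec (.of k))) (point g)
    FunctorToTypes.prod.snd).symm
  let U := (Aff 1 (Spec (.of k))).basicOpen (∏ i, lineFun (.of k) (C (g i : k)))
  refine cls_eq_of_rel (.of_hom zeros_lineFun_X U.ι (Category.comp_id _) ?_ ?_)
  · refine Eq.trans ?_ (TauMap.ofSection_comp _ _).symm
    exact congrArg (fun f => TauMap.ofSection (U.ι.appTop f)) (lineFun_X _)
  · funext i
    refine Units.ext ?_
    change U.ι.appTop (lineFun (.of k) (C (g i : k))) =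
      U.ι.appTop ((𝟙 _ ≫ Aff.proj 1 (Spec (.of k))).appTop ((Scheme.ΓSpecIso (.of k)).inv (g i : k)))
    rw [Category.id_comp, lineFun_C]

/-- The class of a rational point of the affine line. -/
lemma cls_polFr_X_sub_C (a : k) (G : Fin m → k[X]) (g : Fin m → kˣ)
    (hg : ∀ i, (g i : k) = (G i).eval a) (hP h) :
    cls k (polFr (A := .of k) (X - C a) G hP h) = cls k (ofMap (point g)) := by
  have hc : ∀ (a : k) i, IsCoprime (X - C a) (C (g i : k)) := fun a i =>
    isCoprime_X_sub_C (by rw [eval_C]; exact (g i).isUnit)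
  refine Eq.trans (b := cls k (polFr (A := .of k) (X - C a) (fun i => C (g i : k)) hP (hc a))) ?_ ?_
  -- The homotopy `G(a + t (X - a))` contracts the tuple to its value at `a`. On the support `X = a`
  -- it does not depend on `t`, so coprimality persists.
  · refine cls_polFr_homotopy (X - C (C a))
      (fun i => ((G i).map C).comp (C (C a) + C X * (X - C (C a)))) (monic_X_sub_C _) (fun i => ?_)
      _ _ _ _ ?_ ?_ ?_ ?_
    · refine isCoprime_X_sub_C ?_
      rw [eval_comp]
      simp only [eval_add, eval_mul, eval_sub, eval_C, eval_X, sub_self, mul_zero, add_zero]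
      rw [Polynomial.eval_map, eval₂_at_apply, ← hg]
      exact (g i).isUnit.map C
    · simp
    · simp
    · intro i
      rw [Polynomial.map_comp, Polynomial.map_map]
      have : (evalRingHom (1 : k)).comp C = RingHom.id k := by ext; simp
      rw [this]
      simp
    · intro i
      rw [Polynomial.map_comp, Polynomial.map_map]
      have : (evalRingHom (0 : k)).comp C = RingHom.id k := by ext; simp
      rw [this, hg]
      simp
  -- With a constant tuple the support can be moved from `a` to the origin, along `t a`.
  · rw [← cls_polFr_X_C g monic_X fun i => by simpa using hc 0 i]
    refine cls_polFr_homotopy (X - C (X * C a)) (fun i => C (C (g i : k))) (monic_X_sub_C _)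
      (fun i => ?_) _ _ _ _ ?_ ?_ ?_ ?_
    · refine isCoprime_X_sub_C ?_
      rw [eval_C]
      exact (g i).isUnit.map C
    · simp
    · simp
    · simp
    · simp

end

end CobFr
end

/-! ### Logarithms on a field and the functional equation behind the Steinberg relation. -/

noncomputable section
namespace CobFr

section

variable {k M : Type*} [Field k] [CharZero k] [AddCommGroup M]

/-- A function on nonzero elements that is compatible with multiplication. -/
def IsLogarithm (α : k → M) : Prop := ∀ x y, x ≠ 0 → y ≠ 0 → α (x * y) = α x + α y

namespace IsLogarithm

set_option linter.unusedSectionVars false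

variable {α : k → M} (hα : IsLogarithm α)
include hα

lemma map_one : α 1 = 0 := by
  have := hα 1 1 one_ne_zero one_ne_zero
  rw [mul_one] at this
  grind

lemma map_neg_one : α (-1) + α (-1) = 0 := by
  have := hα (-1) (-1) (by norm_num) (by norm_num)
  rw [neg_one_mul, neg_neg, hα.map_one] at this
  exact this.symm

lemma map_neg {x : k} (hx : x ≠ 0) : α (-x) = α (-1) + α x := by
  rw [← hα _ _ (by norm_num) hx, neg_one_mul]

lemma map_inv {x : k} (hx : x ≠ 0) : α x⁻¹ = -α x := by
  have := hα x x⁻¹ hx (inv_ne_zero hx)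
  rw [mul_inv_cancel₀ hx, hα.map_one] at this
  grind

lemma map_div {x y : k} (hx : x ≠ 0) (hy : y ≠ 0) : α (x / y) = α x - α y := by
  rw [div_eq_mul_inv, hα _ _ hx (inv_ne_zero hy), hα.map_inv hy, sub_eq_add_neg]

lemma map_sq {x : k} (hx : x ≠ 0) : α (x ^ 2) = α x + α x := by
  rw [sq, hα _ _ hx hx]

lemma add {β : k → M} (hβ : IsLogarithm β) : IsLogarithm fun x => α x + β x := fun x y hx hy => by
  have := hα x y hx hy
  have := hβ x y hx hy
  grind

/-- A logarithm that is constant on the products `x (1 - x)` vanishes. -/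
lemma eq_zero_of_mul_one_sub {c : M} (h : ∀ x, x ≠ 0 → x ≠ 1 → α x + α (1 - x) = c) {x : k}
    (hx : x ≠ 0) : α x = 0 := by
  have h2 := h 2 (by norm_num) (by norm_num)
  have h3 := h 3 (by norm_num) (by norm_num)
  have h4 := h 4 (by norm_num) (by norm_num)
  have hh := h 2⁻¹ (by norm_num) (by norm_num)
  have e2 := hα.map_inv (x := 2) (by norm_num)
  have e3 := hα.map_neg (x := 2) (by norm_num)
  have e4 := hα.map_neg (x := 3) (by norm_num)
  have e5 := hα 2 2 (by norm_num) (by norm_num)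
  have e6 := hα.map_neg_one
  norm_num at h2 h3 h4 hh e2 e5
  -- In the difference of the relations at `4` and at `3` the terms `α 3` and `α (-1)` cancel, and
  -- `α 2` remains.
  have t2 : α 2 = 0 := by linear_combination (norm := abel) h4 - e5 - e4 - h3 + e3
  -- The relation at `1/2` reads `-2 α(2) = c`.
  have hc : c = 0 := by linear_combination (norm := abel) (2 : ℤ) • e2 - hh - (2 : ℤ) • t2
  subst hc
  -- This is the relation at `x⁻¹`, because `1 - x⁻¹ = (x - 1) / x`.
  have tri : ∀ x, x ≠ 0 → x ≠ 1 → α (x - 1) = α x + α x := fun x hx hx1 => by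
    have h0 : x - 1 ≠ 0 := sub_ne_zero.2 hx1
    have h5 := h x⁻¹ (inv_ne_zero hx) (by simpa using hx1)
    have h6 : 1 - x⁻¹ = (x - 1) / x := by field_simp
    rw [h6, hα.map_div h0 hx, hα.map_inv hx] at h5
    grind
  have hm : α (-1) = 0 := by grind
  -- The relation at `x` gives `α x + α (x - 1) = 0` since `α (-1) = 0`; combine this with `tri`.
  have three : ∀ x, x ≠ 0 → x ≠ 1 → α x + α x + α x = 0 := fun x hx hx1 => by
    have h0 : x - 1 ≠ 0 := sub_ne_zero.2 hx1
    have h5 := tri x hx hx1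
    have h6 := h x hx hx1
    have h7 := hα.map_neg h0
    rw [neg_sub] at h7
    grind
  -- `tri` at `x + 1` reads `α x = 2 α (x + 1)`, and `2` acts as `-1` on elements killed by `3`.
  have step : ∀ x, x ≠ 0 → x + 1 ≠ 0 → α (x + 1) = -α x := fun x hx hx1 => by
    by_cases h0 : x = 1
    · subst h0
      rw [hα.map_one]
      norm_num
      exact t2
    have h5 := tri (x + 1) hx1 (by simpa using hx)
    rw [add_sub_cancel_right] at h5
    have h6 := three (x + 1) hx1 (by simpa using hx)
    linear_combination (norm := abel) h5 + h6
  -- The values `-1`, `-1/2` and `1` are exceptions to the preceding relations and are treated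
  -- directly.
  by_cases h1 : x + 1 = 0
  · rwa [eq_neg_of_add_eq_zero_left h1]
  by_cases h2 : 2 * x + 1 = 0
  · have : x = (-1) / 2 := by field_simp; linear_combination h2
    rw [this, hα.map_div (by norm_num) (by norm_num), hm, t2, sub_zero]
  by_cases h3 : x = 1
  · rw [h3, hα.map_one]
  -- The element `2 (x + 1)` is reached from `2 x` in two unit steps, whence `α (x + 1) = α x`,
  -- while one step gives `α (x + 1) = -α x`. So `2 α x = 0`, and also `3 α x = 0`.
  have h4 := step x hx h1
  have h5 := step (2 * x) (mul_ne_zero two_ne_zero hx) h2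
  have h6 := step (2 * x + 1) h2 (by
    have : 2 * x + 1 + 1 = 2 * (x + 1) := by ring
    rw [this]
    exact mul_ne_zero two_ne_zero h1)
  have h7 : 2 * x + 1 + 1 = 2 * (x + 1) := by ring
  rw [h7, hα 2 _ two_ne_zero h1] at h6
  rw [hα 2 x two_ne_zero hx] at h5
  linear_combination (norm := abel) three x hx h3 + h6 - h5 - h4

/-- A logarithm that is constant on the quotients `x ^ 2 / (1 - x ^ 2)` vanishes. -/
lemma eq_zero_of_sq_div {c : M} (h : ∀ x, x ≠ 0 → x ≠ 1 → x ≠ -1 →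
    α (x ^ 2) - α (1 - x ^ 2) = c) (hc : c + c = 0) : c = 0 ∧ ∀ x, x ≠ 0 → α x = 0 := by
  have hne : ∀ x : k, x ≠ 1 → x ≠ -1 → 1 - x ^ 2 ≠ 0 := fun x h1 h2 h0 => by
    have : (1 - x) * (1 + x) = 0 := by linear_combination h0
    rcases mul_eq_zero.1 this with h3 | h3
    · exact h1 (sub_eq_zero.1 h3).symm
    · exact h2 (eq_neg_of_add_eq_zero_right h3)
  -- Compare the relations at `x` and `x⁻¹`, using `1 - x⁻² = -(1 - x²) / x²`.
  have two : ∀ x, x ≠ 0 → x ≠ 1 → x ≠ -1 → α x + α x = α (-1) := fun x h0 h1 h2 => by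
    have e1 := h x h0 h1 h2
    have e2 := h x⁻¹ (inv_ne_zero h0) (by simpa using h1) (by
      rwa [Ne, inv_eq_iff_eq_inv, inv_neg, inv_one])
    have h3 := hne x h1 h2
    have e3 : 1 - x⁻¹ ^ 2 = -(1 - x ^ 2) / x ^ 2 := by field_simp; ring
    rw [e3, hα.map_div (neg_ne_zero.2 h3) (pow_ne_zero 2 h0), hα.map_neg h3, inv_pow,
      hα.map_inv (pow_ne_zero 2 h0)] at e2
    have e4 := hα.map_neg_one
    have e5 := hα.map_sq h0
    linear_combination (norm := abel) e1 - e2 - e5 - e4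
  have t2 := two 2 (by norm_num) (by norm_num) (by norm_num)
  have t3 := two 3 (by norm_num) (by norm_num) (by norm_num)
  have t6 := two 6 (by norm_num) (by norm_num) (by norm_num)
  have e6 := hα 2 3 (by norm_num) (by norm_num)
  norm_num at e6
  -- By `two` the doubles of `α 2`, `α 3` and `α 6` all equal `α (-1)`, and `α 6 = α 2 + α 3`.
  have hm : α (-1) = 0 := by
    linear_combination (norm := abel) t6 - t2 - t3 - (2 : ℤ) • e6
  have dbl : ∀ x, x ≠ 0 → α x + α x = 0 := fun x h0 => by
    by_cases h1 : x = 1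
    · rw [h1, hα.map_one, add_zero]
    by_cases h2 : x = -1
    · rw [h2, hm, add_zero]
    rw [two x h0 h1 h2, hm]
  -- Squares now have logarithm `0`, and `-c = c`.
  have prod : ∀ x, x ≠ 0 → x ≠ 1 → x ≠ -1 → α (1 - x ^ 2) = c := fun x h0 h1 h2 => by
    have e1 := h x h0 h1 h2
    have e2 := hα.map_sq h0
    have e3 := dbl x h0
    linear_combination (norm := abel) e2 + e3 - e1 - hc
  -- At `2`, `3` and `5` one finds `α 3 = α 8 = α 24 = c`; since `24 = 8 * 3`, this gives `c = c +
  -- c`.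
  have p2 := prod 2 (by norm_num) (by norm_num) (by norm_num)
  have p3 := prod 3 (by norm_num) (by norm_num) (by norm_num)
  have p5 := prod 5 (by norm_num) (by norm_num) (by norm_num)
  have n3 := hα.map_neg (x := 3) (by norm_num)
  have n8 := hα.map_neg (x := 8) (by norm_num)
  have n24 := hα.map_neg (x := 24) (by norm_num)
  have e24 := hα 8 3 (by norm_num) (by norm_num)
  norm_num at p2 p3 p5 e24
  have hc0 : c = 0 := by
    linear_combination (norm := abel) p5 - p2 - p3 + n3 + n8 - n24 - e24 + hm
  subst hc0
  refine ⟨rfl, fun y h0 => ?_⟩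
  by_cases h1 : y = 1
  · rw [h1, hα.map_one]
  by_cases h2 : y = -1
  · rw [h2, hm]
  have hp : 1 + y ≠ 0 := fun h => h2 (eq_neg_of_add_eq_zero_right h)
  have hq : y - 1 ≠ 0 := sub_ne_zero.2 h1
  -- For `x = (y - 1) / (1 + y)` the element `1 - x²` is `y` times a square, so every `y` is
  -- reached.
  have h3 := prod ((y - 1) / (1 + y)) (div_ne_zero hq hp) (fun h => by
    rw [div_eq_one_iff_eq hp] at h
    have : (2 : k) = 0 := by linear_combination -h
    exact two_ne_zero this) (fun h => by
    rw [div_eq_iff hp] at h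
    have : 2 * y = 0 := by linear_combination h
    exact h0 ((mul_eq_zero.1 this).resolve_left two_ne_zero))
  have h4 : 1 - ((y - 1) / (1 + y)) ^ 2 = 2 ^ 2 * y / (1 + y) ^ 2 := by field_simp; ring
  rw [h4, hα.map_div (mul_ne_zero (by norm_num) h0) (pow_ne_zero 2 hp),
    hα _ _ (by norm_num) h0, hα.map_sq two_ne_zero, hα.map_sq hp] at h3
  linear_combination (norm := abel) h3 - dbl 2 two_ne_zero + dbl _ hp

end IsLogarithm

/-- A function on pairs of nonzero elements whose increments satisfy a cocycle condition with
parameters `a ≠ 0, 1` is the sum of two logarithms and a constant. -/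
lemma exists_isLogarithm {S : k → M} {f f' : k → k → M}
    (h : ∀ a u v, a ≠ 0 → a ≠ 1 → u ≠ 0 → v ≠ 0 → f' (-a * u) ((1 - a) * v) = S a + f u v) :
    ∃ (α β : k → M) (c : M), IsLogarithm α ∧ IsLogarithm β ∧
      ∀ a, a ≠ 0 → a ≠ 1 → S a = c + α a + β (1 - a) := by
  -- The arguments are chosen so that the equations for `a` and `b` have the same left side; this
  -- eliminates `f'`.
  have gen : ∀ a b u v, a ≠ 0 → a ≠ 1 → b ≠ 0 → b ≠ 1 → u ≠ 0 → v ≠ 0 →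
      S a + f (b / a * u) ((1 - b) / (1 - a) * v) = S b + f u v := by
    intro a b u v ha ha1 hb hb1 hu hv
    have ha' : 1 - a ≠ 0 := sub_ne_zero.2 (Ne.symm ha1)
    have hb' : 1 - b ≠ 0 := sub_ne_zero.2 (Ne.symm hb1)
    rw [← h a _ _ ha ha1 (mul_ne_zero (div_ne_zero hb ha) hu)
      (mul_ne_zero (div_ne_zero hb' ha') hv), ← h b u v hb hb1 hu hv]
    congr 1 <;> field_simp
  -- The ratios `b / a = p` and `(1 - b) / (1 - a) = q` are solved by `a = (1 - q) / (p - q)` and `b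
  -- = p a`. By `gen` the increment of `f` under scaling by `(p, q)` is then `S b - S a`, whatever
  -- the point.
  have gen' : ∀ p q u v u' v', p ≠ 0 → q ≠ 0 → p ≠ 1 → q ≠ 1 → p ≠ q → u ≠ 0 → v ≠ 0 → u' ≠ 0 →
      v' ≠ 0 → f (p * u) (q * v) - f u v = f (p * u') (q * v') - f u' v' := by
    intro p q u v u' v' hp hq hp1 hq1 hpq hu hv hu' hv'
    have h1 : p - q ≠ 0 := sub_ne_zero.2 hpq
    have h2 : 1 - q ≠ 0 := sub_ne_zero.2 (Ne.symm hq1)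
    have h3 : p - 1 ≠ 0 := sub_ne_zero.2 hp1
    have e1 : 1 - (1 - q) / (p - q) = (p - 1) / (p - q) := by field_simp; ring
    have e2 : 1 - p * (1 - q) / (p - q) = q * (p - 1) / (p - q) := by field_simp; ring
    have e3 : p * (1 - q) / (p - q) / ((1 - q) / (p - q)) = p := by field_simp
    have e4 : q * (p - 1) / (p - q) / ((p - 1) / (p - q)) = q := by field_simp
    have n1 : (1 - q) / (p - q) ≠ 0 := div_ne_zero h2 h1
    have n2 : p * (1 - q) / (p - q) ≠ 0 := div_ne_zero (mul_ne_zero hp h2) h1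
    have n3 : (1 - q) / (p - q) ≠ 1 := fun h0 => by
      rw [h0, sub_self] at e1
      exact div_ne_zero h3 h1 e1.symm
    have n4 : p * (1 - q) / (p - q) ≠ 1 := fun h0 => by
      rw [h0, sub_self] at e2
      exact div_ne_zero (mul_ne_zero hq h3) h1 e2.symm
    have k1 := gen ((1 - q) / (p - q)) (p * (1 - q) / (p - q)) u v n1 n3 n2 n4 hu hv
    have k2 := gen ((1 - q) / (p - q)) (p * (1 - q) / (p - q)) u' v' n1 n3 n2 n4 hu' hv'
    rw [e1, e2, e3, e4] at k1 k2
    linear_combination (norm := abel) k1 - k2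
  have all : ∀ p q u v, p ≠ 0 → q ≠ 0 → u ≠ 0 → v ≠ 0 →
      f (p * u) (q * v) - f u v = f p q - f 1 1 := by
    classical
    intro p q u v hp hq hu hv
    have : Infinite k := CharZero.infinite k
    -- The scaling `(p, q)` is split into `(r, s)` and `(p / r, q / s)`; the excluded values make
    -- both satisfy the restrictions of `gen'`.
    obtain ⟨r, hr⟩ := Infinite.exists_notMem_finset ({0, 1, p} : Finset k)
    obtain ⟨s, hs⟩ := Infinite.exists_notMem_finset ({0, 1, r, q, q * r / p} : Finset k)
    simp only [Finset.mem_insert, Finset.mem_singleton, not_or] at hr hs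
    obtain ⟨r0, r1, rp⟩ := hr
    obtain ⟨s0, s1, sr, sq, sqr⟩ := hs
    have k1 := gen' r s u v 1 1 r0 s0 r1 s1 (Ne.symm sr) hu hv one_ne_zero one_ne_zero
    have k2 := gen' (p / r) (q / s) (r * u) (s * v) r s (div_ne_zero hp r0) (div_ne_zero hq s0)
      (fun h0 => rp ((div_eq_one_iff_eq r0).1 h0).symm)
      (fun h0 => sq ((div_eq_one_iff_eq s0).1 h0).symm)
      (fun h0 => sqr (by field_simp at h0 ⊢; linear_combination h0))
      (mul_ne_zero r0 hu) (mul_ne_zero s0 hv) r0 s0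
    rw [← mul_assoc, ← mul_assoc, div_mul_cancel₀ _ r0, div_mul_cancel₀ _ s0] at k2
    rw [mul_one, mul_one] at k1
    linear_combination (norm := abel) k1 + k2
  have hα : IsLogarithm fun u => f u 1 - f 1 1 := fun x y hx hy => by
    have := all x 1 y 1 hx one_ne_zero hy one_ne_zero
    rw [mul_one] at this
    beta_reduce
    linear_combination (norm := abel) this
  have hβ : IsLogarithm fun v => f 1 v - f 1 1 := fun x y hx hy => by
    have := all 1 x 1 y one_ne_zero hx one_ne_zero hy
    rw [mul_one] at this
    beta_reduce
    linear_combination (norm := abel) this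
  -- Now `f - f 1 1` is a homomorphism in both variables jointly. The constant is determined by
  -- `gen` with `a = 2`, where `1 - a = -1`.
  refine ⟨_, _, S 2 - (f 2 1 - f 1 1) - (f 1 (-1) - f 1 1), hα, hβ, fun b hb hb1 => ?_⟩
  have hb' : 1 - b ≠ 0 := sub_ne_zero.2 (Ne.symm hb1)
  have k1 := gen 2 b 1 1 two_ne_zero (by norm_num) hb hb1 one_ne_zero one_ne_zero
  have e0 : (1 : k) - 2 = -1 := by norm_num
  rw [mul_one, mul_one, e0] at k1
  have k2 := all (b / 2) 1 1 ((1 - b) / (-1)) (div_ne_zero hb two_ne_zero) one_ne_zero one_ne_zero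
    (div_ne_zero hb' (by norm_num))
  rw [mul_one, one_mul] at k2
  have k3 := hα.map_div hb two_ne_zero
  have k4 := hβ.map_div hb' (y := -1) (by norm_num)
  beta_reduce at k3 k4 ⊢
  linear_combination (norm := abel) k2 + k3 + k4 - k1

/-- The criterion by which the Steinberg relation is verified. -/
lemma steinberg_of_interpolation {b : k → k → M} {f f' : k → k → M}
    (hl : ∀ z, z ≠ 0 → IsLogarithm fun x => b x z) (hr : ∀ z, z ≠ 0 → IsLogarithm (b z))
    (hs : ∀ x y, x ≠ 0 → y ≠ 0 → b x y + b y x = 0)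
    (h : ∀ a u v, a ≠ 0 → a ≠ 1 → u ≠ 0 → v ≠ 0 →
      f' (-a * u) ((1 - a) * v) = b a (1 - a) + f u v)
    {a : k} (ha : a ≠ 0) (ha1 : a ≠ 1) : b a (1 - a) = 0 := by
  obtain ⟨α, β, c, hα, hβ, hS⟩ := exists_isLogarithm (S := fun a => b a (1 - a)) h
  -- Antisymmetry says `S y + S (1 - y) = 0`, so the logarithm `α + β` is constant on the products
  -- `y (1 - y)`.
  have hγ : ∀ x, x ≠ 0 → α x + β x = 0 := fun x hx => by
    refine (hα.add hβ).eq_zero_of_mul_one_sub (c := -(c + c)) (fun y hy hy1 => ?_) hx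
    have hy' : 1 - y ≠ 0 := sub_ne_zero.2 (Ne.symm hy1)
    have h1 := hS y hy hy1
    have h2 := hS (1 - y) hy' (by simpa using hy)
    have h3 := hs y (1 - y) hy hy'
    rw [sub_sub_cancel] at h2
    linear_combination (norm := abel) h3 - h1 - h2
  -- Antisymmetry for the pair `2` and `-1 = 1 - 2`, in which the logarithms cancel by `hγ`.
  have hc : c + c = 0 := by
    have h1 := hS 2 two_ne_zero (by norm_num)
    have h2 := hS (-1) (by norm_num) (by norm_num)
    have h3 := hs 2 (-1) two_ne_zero (by norm_num)
    have h4 := hγ 2 two_ne_zero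
    have h5 := hγ (-1) (by norm_num)
    norm_num at h1 h2
    linear_combination (norm := abel) h3 - h1 - h2 - h4 - h5
  -- From `1 - x² = (1 - x) (1 + x)`, bilinearity and `2 b (-1) (1 + x) = 0` one gets `S (x²) = 2 S
  -- x + 2 S (-x)`. Inserting `S y = c + α y - α (1 - y)` gives the claim.
  have hsq : ∀ x, x ≠ 0 → x ≠ 1 → x ≠ -1 → α (x ^ 2) - α (1 - x ^ 2) = c := by
    intro x h0 h1 h2
    have hm : 1 - x ≠ 0 := sub_ne_zero.2 (Ne.symm h1)
    have hp : 1 + x ≠ 0 := fun h => h2 (eq_neg_of_add_eq_zero_right h)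
    have he : 1 - x ^ 2 = (1 - x) * (1 + x) := by ring
    have hne : 1 - x ^ 2 ≠ 0 := by rw [he]; exact mul_ne_zero hm hp
    have s0 := hS (x ^ 2) (pow_ne_zero 2 h0) (fun h => hne (by rw [h, sub_self]))
    have s1 := hS x h0 h1
    have s2 := hS (-x) (neg_ne_zero.2 h0) (fun h => h2 (by rw [← h, neg_neg]))
    rw [sub_neg_eq_add] at s2
    have b0 := (hl _ hne).map_sq h0
    have b1 := (hr x h0) _ _ hm hp
    have b2 := (hl _ hp).map_neg h0
    have b3 := (hl _ hp).map_neg_one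
    beta_reduce at b0 b2 b3
    rw [← he] at b1
    have a0 := hα.map_neg h0
    have a1 := hα.map_neg_one
    have a2 := hα.map_sq h0
    have a3 := hβ _ _ hm hp
    rw [← he] at a3
    have g0 := hγ _ hne
    linear_combination (norm := abel) s0 - b0 - (2 : ℤ) • b1 - (2 : ℤ) • s1 + (2 : ℤ) • b2 + b3 -
      (2 : ℤ) • s2 - (2 : ℤ) • a0 - a1 + (2 : ℤ) • a3 + (2 : ℤ) • a2 - g0 - (2 : ℤ) • hc
  obtain ⟨hc0, hα0⟩ := hα.eq_zero_of_sq_div hsq hc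
  have ha' : 1 - a ≠ 0 := sub_ne_zero.2 (Ne.symm ha1)
  have h1 := hS a ha ha1
  have h2 := hγ _ ha'
  rw [hα0 _ ha'] at h2
  rw [hα0 a ha, hc0] at h1
  linear_combination (norm := abel) h1 + h2

end

end CobFr
end

/-! ### Classes of polynomials, additivity and antisymmetry of symbols. -/

noncomputable section
namespace CobFr

section

open Polynomial PreFr

variable {k : Type u} [Field k] {m m' : ℕ}

/-- At `c` the interpolation `Q + t (P - Q)` has the nonzero value `Q(c)`, which does not depend on
`t`; hence it is prime to `X - c` and to every divisor of it. -/
lemma isCoprime_interpolation {P Q : k[X]} {G : k[X]} {c : k} (hG : G ∣ X - C c)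
    (hPQ : P.eval c = Q.eval c) (hQ : Q.eval c ≠ 0) :
    IsCoprime (Q.map C + C X * (P.map C - Q.map C)) (G.map (C : k →+* k[X])) := by
  have h : G.map (C : k →+* k[X]) ∣ X - C (C c) := by simpa using Polynomial.map_dvd C hG
  refine .of_isCoprime_of_dvd_right (isCoprime_X_sub_C ?_).symm h
  rw [eval_add, eval_mul, eval_sub, Polynomial.eval_map, Polynomial.eval_map, eval₂_at_apply,
    eval₂_at_apply, hPQ, sub_self, mul_zero, add_zero]
  exact (isUnit_iff_ne_zero.2 hQ).map C

/-- Two monic polynomials of the same degree differ by one of smaller degree. -/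
lemma monic_interpolation {P Q : k[X]} (hP : P.Monic) (hQ : Q.Monic)
    (h : P.natDegree = Q.natDegree) : (Q.map C + C (X : k[X]) * (P.map C - Q.map C)).Monic := by
  refine (hQ.map C).add_of_left ?_
  have h1 : P.degree = Q.degree := by
    rw [degree_eq_natDegree hP.ne_zero, degree_eq_natDegree hQ.ne_zero, h]
  have h2 := degree_sub_lt_left h1 hP.ne_zero (by rw [hP.leadingCoeff, hQ.leadingCoeff])
  rw [← Polynomial.map_sub, degree_C_mul X_ne_zero, degree_map_eq_of_injective C_injective,
    degree_map_eq_of_injective C_injective, ← h1]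
  exact h2

/-- The properties of the classes of the correspondences given by a monic polynomial and a fixed
tuple of functions with at most simple zeros. -/
lemma exists_polynomial_cls (G : Fin m → k[X]) (c : Fin m → k) (hG : ∀ i, G i ∣ X - C (c i)) :
    ∃ F : k[X] → H0 k m,
      (∀ P Q, P.Monic → Q.Monic → (∀ i, P.eval (c i) ≠ 0) → (∀ i, Q.eval (c i) ≠ 0) →
        IsCoprime P Q → F (P * Q) = F P + F Q) ∧
      (∀ P Q, P.Monic → Q.Monic → P.natDegree = Q.natDegree →
        (∀ i, P.eval (c i) = Q.eval (c i)) → (∀ i, Q.eval (c i) ≠ 0) → F P = F Q) ∧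
      (∀ (a : k) (g : Fin m → kˣ), (∀ i, a ≠ c i) → (∀ i, (g i : k) = (G i).eval a) →
        F (X - C a) = cls k (ofMap (point g))) := by
  classical
  -- A polynomial that does not vanish at `c i` is prime to `X - c i`, hence to its divisor `G i`.
  have hcop : ∀ P : k[X], (∀ i, P.eval (c i) ≠ 0) → ∀ i, IsCoprime P (G i) := fun P h i =>
    .of_isCoprime_of_dvd_right (isCoprime_X_sub_C (isUnit_iff_ne_zero.2 (h i))).symm (hG i)
  -- The value `0` off the domain is arbitrary; in the three properties only admissible polynomials
  -- occur.
  refine ⟨fun P => if h : P.Monic ∧ ∀ i, P.eval (c i) ≠ 0 then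
    cls k (polFr (A := .of k) P G h.1 (hcop P h.2)) else 0, ?_, ?_, ?_⟩
  · intro P Q hP hQ h h' hPQ
    beta_reduce
    rw [dif_pos ⟨hP.mul hQ, fun i => by rw [eval_mul]; exact mul_ne_zero (h i) (h' i)⟩,
      dif_pos ⟨hP, h⟩, dif_pos ⟨hQ, h'⟩]
    exact cls_polFr_mul hP hQ _ _ hPQ
  · intro P Q hP hQ hd h h'
    beta_reduce
    rw [dif_pos ⟨hP, fun i => by rw [h]; exact h' i⟩, dif_pos ⟨hQ, h'⟩]
    have e1 : (evalRingHom (1 : k)).comp C = RingHom.id k := by ext; simp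
    have e0 : (evalRingHom (0 : k)).comp C = RingHom.id k := by ext; simp
    refine cls_polFr_homotopy _ (fun i => (G i).map C) (monic_interpolation hP hQ hd)
      (fun i => isCoprime_interpolation (hG i) (h i) (h' i)) _ _ _ _ ?_ ?_ ?_ ?_
    · simp [Polynomial.map_map, e1]
    · simp [Polynomial.map_map, e0]
    · simp [Polynomial.map_map, e1]
    · simp [Polynomial.map_map, e0]
  · intro a g ha hg
    beta_reduce
    rw [dif_pos ⟨monic_X_sub_C a, fun i => by
      rw [eval_sub, eval_X, eval_C]; exact sub_ne_zero.2 (ha i).symm⟩]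
    exact cls_polFr_X_sub_C a G g hg _ _

lemma gmul_cls_ofMap (g : Fin m → kˣ) (g' : Fin m' → kˣ) :
    gmul m m' (cls k (ofMap (point g))) (cls k (ofMap (point g'))) =
      cls k (ofMap (point (Fin.append g g'))) := by
  rw [gmul_cls]
  refine (cls_mul_ofMap (ofMap (point g)) (point g') (Gm.append m m')).trans ?_
  refine cls_eq_of_rel (.of_hom rfl (𝟙 _) (Category.id_comp _) (TauMap.comp_id _).symm ?_)
  refine Eq.trans ?_ (Functor.map_id_apply (Gm (m + m')) _ _).symm
  funext i
  refine Fin.addCases (fun j => ?_) (fun j => ?_) i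
  · refine (Fin.append_left _ _ j).trans (Units.ext ?_)
    change (Aff.proj 0 (Spec (.of k))).appTop _ = (Aff.proj 0 (Spec (.of k))).appTop _
    simp [point]
  · refine (Fin.append_right _ _ j).trans (Units.ext ?_)
    change (𝟙 _ ≫ Aff.proj 0 (Spec (.of k))).appTop _ = (Aff.proj 0 (Spec (.of k))).appTop _
    rw [Category.id_comp]
    simp [point]

/-- A point with an entry `1` is unchanged by the corresponding `Gm.setOne`, hence degenerate. -/
lemma cls_ofMap_eq_zero (g : Fin m → kˣ) (i : Fin m) (hi : g i = 1) :
    cls k (ofMap (point g)) = 0 := by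
  rw [cls_eq, ← clsHom_push_setOne k m i (ZF.mk (ofMap (point g))), ZF.push_mk, ← cls_eq, ← cls_eq]
  refine cls_eq_of_rel (.of_hom rfl (𝟙 _) (Category.id_comp _) (TauMap.comp_id _).symm ?_)
  refine Eq.trans ?_ (Functor.map_id_apply (Gm m) _ _).symm
  funext j
  by_cases h : j = i
  · subst h
    have h : (push (Gm.setOne m j) (ofMap (point g))).g j = 1 :=
      Function.update_self (β := fun _ => Γ(Aff 0 (Spec (.of k)), ⊤)ˣ) j 1 _
    refine Eq.trans (Units.ext ?_) h.symm
    change (Aff.proj 0 (Spec (.of k))).appTop (point g j) = 1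
    simp [point, hi]
  · exact (Function.update_of_ne h _ _).symm

/-- Take the tuple `(X, …, X)`. The polynomials `(X - a) (X - b)` and `(X - a b) (X - 1)` have the
same degree and the same value at `0`, hence the same class. The two inequalities make their factors
coprime. -/
lemma cls_ofMap_diag_add {a b : kˣ} (hab : a ≠ b) (hab' : a * b ≠ 1) :
    cls k (ofMap (point fun _ : Fin m => a)) + cls k (ofMap (point fun _ : Fin m => b)) =
      cls k (ofMap (point fun _ : Fin m => a * b)) +
        cls k (ofMap (point fun _ : Fin m => (1 : kˣ))) := by
  obtain ⟨F, h1, h2, h3⟩ := exists_polynomial_cls (fun _ : Fin m => (X : k[X])) (fun _ => 0)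
    (fun _ => by simp)
  have key : ∀ a : kˣ, F (X - C (a : k)) = cls k (ofMap (point fun _ : Fin m => a)) := fun a =>
    h3 _ _ (fun _ => a.ne_zero) (fun _ => by rw [eval_X])
  have hev : ∀ (a : kˣ) (_ : Fin m), (X - C (a : k)).eval 0 ≠ 0 := fun a _ => by simp
  have hco : ∀ a b : kˣ, a ≠ b → IsCoprime (X - C (a : k)) (X - C (b : k)) := fun a b h =>
    isCoprime_X_sub_C (isUnit_iff_ne_zero.2 (by
      rw [eval_sub, eval_X, eval_C]
      exact sub_ne_zero.2 (Units.val_injective.ne h)))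
  rw [← key, ← key, ← key, ← key,
    ← h1 _ _ (monic_X_sub_C _) (monic_X_sub_C _) (hev _) (hev _) (hco _ _ hab),
    ← h1 _ _ (monic_X_sub_C _) (monic_X_sub_C _) (hev _) (hev _) (hco _ _ hab')]
  refine h2 _ _ ((monic_X_sub_C _).mul (monic_X_sub_C _)) ((monic_X_sub_C _).mul (monic_X_sub_C _))
    ?_ (fun _ => by simp) (fun _ => by simp)
  rw [(monic_X_sub_C _).natDegree_mul (monic_X_sub_C _),
    (monic_X_sub_C _).natDegree_mul (monic_X_sub_C _), natDegree_X_sub_C, natDegree_X_sub_C,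
    natDegree_X_sub_C, natDegree_X_sub_C]

section

variable [CharZero k]

/-- With an auxiliary element `c`, the product `a b c` is computed as `a (b c)` and as `(a b) c`.
Finitely many values of `c` are excluded so that every multiplication involved is an admissible one.
-/
lemma map_mul_of_generic {M : Type*} [AddCommGroup M] {f : kˣ → M}
    (h : ∀ a b, a ≠ b → a * b ≠ 1 → f a + f b = f (a * b)) (a b : kˣ) : f (a * b) = f a + f b := by
  classical
  have : Infinite k := CharZero.infinite k
  obtain ⟨c, hc⟩ := Infinite.exists_notMem_finset
    ({0, (b : k), (b : k)⁻¹, (a : k) / b, (a : k)⁻¹ / b, (a : k) * b} : Finset k)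
  simp only [Finset.mem_insert, Finset.mem_singleton, not_or] at hc
  obtain ⟨h0, h1, h2, h3, h4, h5⟩ := hc
  lift c to kˣ using isUnit_iff_ne_zero.2 h0
  have hb := b.ne_zero
  have ha := a.ne_zero
  have e1 := h b c (fun h => h1 (by rw [h])) (fun h => h2 (eq_inv_of_mul_eq_one_right (by
    rw [← Units.val_mul, h, Units.val_one])))
  have e2 := h a (b * c) (fun h => h3 (by
    rw [h, Units.val_mul]; field_simp)) (fun h => h4 (by
    have h' : (a : k) * (b * c) = 1 := by
      rw [← Units.val_mul, ← Units.val_mul, h, Units.val_one]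
    field_simp
    linear_combination h'))
  have e3 := h (a * b) c (fun h => h5 (by rw [← Units.val_mul, h])) (fun h => h4 (by
    have h' : (a : k) * b * c = 1 := by
      rw [← Units.val_mul, ← Units.val_mul, h, Units.val_one]
    field_simp
    linear_combination h'))
  rw [← mul_assoc] at e2
  linear_combination (norm := abel) e3 - e2 - e1

/-- The index `i` guarantees that `m` is positive, so that the point `(1, …, 1)` has class zero. -/
lemma cls_ofMap_diag_mul (a b : kˣ) (i : Fin m) :
    cls k (ofMap (point fun _ : Fin m => a * b)) =
      cls k (ofMap (point fun _ : Fin m => a)) + cls k (ofMap (point fun _ : Fin m => b)) := by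
  refine map_mul_of_generic (f := fun a => cls k (ofMap (point fun _ : Fin m => a)))
    (fun a b h h' => ?_) a b
  rw [cls_ofMap_diag_add h h', cls_ofMap_eq_zero (fun _ => 1) i rfl, add_zero]

variable (k) in
/-- The homomorphism from the multiplicative group of the field to the degree one part. -/
def unitHom : Additive kˣ →+ H0 k 1 where
  toFun a := cls k (ofMap (point fun _ => a.toMul))
  map_zero' := cls_ofMap_eq_zero _ 0 rfl
  map_add' a b := cls_ofMap_diag_mul a.toMul b.toMul 0

lemma gmul_unitHom (a b : kˣ) : gmul 1 1 (unitHom k (.ofMul a)) (unitHom k (.ofMul b)) =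
    cls k (ofMap (point (Fin.append (fun _ : Fin 1 => a) fun _ : Fin 1 => b))) :=
  gmul_cls_ofMap _ _

lemma gmul_unitHom_self (a : kˣ) : gmul 1 1 (unitHom k (.ofMul a)) (unitHom k (.ofMul a)) =
    cls k (ofMap (point fun _ : Fin (1 + 1) => a)) := by
  rw [gmul_unitHom]
  congr 3
  funext i
  exact Fin.addCases (fun j => Fin.append_left _ _ j) (fun j => Fin.append_right _ _ j) i

/-- By additivity on the diagonal, `{ab}{ab} = {a}{a} + {b}{b}`; expanding the left side bilinearly
leaves the two mixed terms. -/
lemma gmul_unitHom_antisymm (a b : kˣ) : gmul 1 1 (unitHom k (.ofMul a)) (unitHom k (.ofMul b)) +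
    gmul 1 1 (unitHom k (.ofMul b)) (unitHom k (.ofMul a)) = 0 := by
  have h := cls_ofMap_diag_mul a b (0 : Fin (1 + 1))
  rw [← gmul_unitHom_self, ← gmul_unitHom_self, ← gmul_unitHom_self, ofMul_mul] at h
  simp only [map_add, AddMonoidHom.add_apply] at h
  linear_combination (norm := abel) h

end

end

end CobFr
end

/-! ### The Steinberg relation. -/

noncomputable section
namespace CobFr

section

open Polynomial PreFr

variable {k : Type u} [Field k]

/-- The monic polynomial `X ^ n * (X - 1) + (v - u) * X + u` with value `u` at `0` and `v` at `1`. -/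
def interpolant (n : ℕ) (u v : k) : k[X] := X ^ n * (X - C 1) + (C (v - u) * X + C u)

lemma eval_zero_interpolant {n : ℕ} (hn : n ≠ 0) (u v : k) : (interpolant n u v).eval 0 = u := by
  simp [interpolant, hn]

lemma eval_one_interpolant (n : ℕ) (u v : k) : (interpolant n u v).eval 1 = v := by
  simp [interpolant]

lemma degree_X_pow_mul_X_sub_one (n : ℕ) : (X ^ n * (X - C (1 : k))).degree = ((n + 1 : ℕ) : WithBot ℕ) := by
  rw [degree_mul, degree_X_pow, degree_X_sub_C]
  rfl

lemma degree_interpolant_aux {n : ℕ} (hn : 1 ≤ n) (u v : k) :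
    (C (v - u) * X + C u).degree < (X ^ n * (X - C (1 : k))).degree := by
  rw [degree_X_pow_mul_X_sub_one]
  exact degree_linear_le.trans_lt (by exact_mod_cast Nat.lt_succ_of_le hn)

lemma monic_interpolant {n : ℕ} (hn : 1 ≤ n) (u v : k) : (interpolant n u v).Monic :=
  ((monic_X_pow n).mul (monic_X_sub_C 1)).add_of_left (degree_interpolant_aux hn u v)

lemma degree_interpolant {n : ℕ} (hn : 1 ≤ n) (u v : k) :
    (interpolant n u v).degree = ((n + 1 : ℕ) : WithBot ℕ) := by
  rw [interpolant, degree_add_eq_left_of_degree_lt (degree_interpolant_aux hn u v),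
    degree_X_pow_mul_X_sub_one]

lemma natDegree_interpolant {n : ℕ} (hn : 1 ≤ n) (u v : k) :
    (interpolant n u v).natDegree = n + 1 :=
  natDegree_eq_of_degree_eq_some (degree_interpolant hn u v)

lemma degree_C_mul_X_mul_X_sub_one_lt (e u v : k) :
    (C e * (X ^ 1 * (X - C 1))).degree < (interpolant 2 u v).degree := by
  rw [degree_interpolant one_le_two]
  refine ((degree_mul_le _ _).trans (add_le_add degree_C_le
    (degree_X_pow_mul_X_sub_one 1).le)).trans_lt ?_
  rw [zero_add]
  exact_mod_cast Nat.lt_succ_self 2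

/-- A multiple of `X (X - 1)` changes neither the values at `0` and `1` nor the leading term, but it
can be used to avoid a zero at `a`. The result is then prime to `X - a`. -/
lemma exists_interpolating_cubic {a : k} (ha : a ≠ 0) (ha1 : a ≠ 1) (u v : k) :
    ∃ Q : k[X], Q.Monic ∧ Q.natDegree = 3 ∧ Q.eval 0 = u ∧ Q.eval 1 = v ∧ Q.eval a ≠ 0 := by
  obtain ⟨e, he⟩ : ∃ e : k, (interpolant 2 u v).eval a + e * (a * (a - 1)) ≠ 0 := by
    by_cases h : (interpolant 2 u v).eval a = 0
    · exact ⟨1, by rw [h, zero_add, one_mul]; exact mul_ne_zero ha (sub_ne_zero.2 ha1)⟩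
    · exact ⟨0, by rwa [zero_mul, add_zero]⟩
  refine ⟨interpolant 2 u v + C e * (X ^ 1 * (X - C 1)),
    (monic_interpolant one_le_two u v).add_of_left (degree_C_mul_X_mul_X_sub_one_lt e u v),
    natDegree_eq_of_degree_eq_some ?_, ?_, ?_, ?_⟩
  · rw [degree_add_eq_left_of_degree_lt (degree_C_mul_X_mul_X_sub_one_lt e u v),
      degree_interpolant one_le_two]
  · rw [eval_add, eval_zero_interpolant two_ne_zero]
    simp
  · rw [eval_add, eval_one_interpolant]
    simp
  · simpa using he

/-- The product of the classes of two elements of the field, extended by `1` at zero. -/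
def gmulField [CharZero k] (x y : k) : H0 k (1 + 1) := by
  classical
  exact gmul 1 1 (unitHom k (.ofMul (if h : x = 0 then 1 else Units.mk0 x h)))
    (unitHom k (.ofMul (if h : y = 0 then 1 else Units.mk0 y h)))

section

variable [CharZero k]

lemma gmulField_coe (a b : kˣ) :
    gmulField (a : k) b = gmul 1 1 (unitHom k (.ofMul a)) (unitHom k (.ofMul b)) := by
  rw [gmulField, dif_neg a.ne_zero, dif_neg b.ne_zero, Units.mk0_val, Units.mk0_val]

lemma isLogarithm_gmulField_left {z : k} (hz : z ≠ 0) :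
    IsLogarithm fun x => gmulField x z := by
  intro x y hx hy
  lift x to kˣ using isUnit_iff_ne_zero.2 hx
  lift y to kˣ using isUnit_iff_ne_zero.2 hy
  lift z to kˣ using isUnit_iff_ne_zero.2 hz
  simp only [← Units.val_mul, gmulField_coe, ofMul_mul, map_add, AddMonoidHom.add_apply]

lemma isLogarithm_gmulField_right {z : k} (hz : z ≠ 0) : IsLogarithm (gmulField z) := by
  intro x y hx hy
  lift x to kˣ using isUnit_iff_ne_zero.2 hx
  lift y to kˣ using isUnit_iff_ne_zero.2 hy
  lift z to kˣ using isUnit_iff_ne_zero.2 hz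
  simp only [← Units.val_mul, gmulField_coe, ofMul_mul, map_add]

lemma gmulField_antisymm {x y : k} (hx : x ≠ 0) (hy : y ≠ 0) :
    gmulField x y + gmulField y x = 0 := by
  lift x to kˣ using isUnit_iff_ne_zero.2 hx
  lift y to kˣ using isUnit_iff_ne_zero.2 hy
  rw [gmulField_coe, gmulField_coe, gmul_unitHom_antisymm]

/-- For the tuple `(X, 1 - X)` the class of a monic polynomial depends on its degree and its values
at `0` and `1`; `f` and `f'` are the classes in degrees `3` and `4`. Multiplication by `X - a`
scales the values by `-a` and `1 - a` and adds the class of the point `(a, 1 - a)`. -/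
lemma exists_interpolation_gmulField : ∃ f f' : k → k → H0 k (1 + 1), ∀ a u v : k,
    a ≠ 0 → a ≠ 1 → u ≠ 0 → v ≠ 0 → f' (-a * u) ((1 - a) * v) = gmulField a (1 - a) + f u v := by
  obtain ⟨F, h1, h2, h3⟩ := exists_polynomial_cls
    (Fin.append (fun _ : Fin 1 => (X : k[X])) fun _ : Fin 1 => 1 - X)
    (Fin.append (fun _ => 0) fun _ => 1) (Fin.addCases
      (fun i => by rw [Fin.append_left, Fin.append_left, C_0, sub_zero])
      (fun i => by rw [Fin.append_right, Fin.append_right, C_1, ← neg_sub (1 : k[X]), dvd_neg]))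
  have hF : ∀ {p : k → Prop}, p 0 → p 1 →
      ∀ i, p (Fin.append (fun _ : Fin 1 => (0 : k)) (fun _ : Fin 1 => 1) i) := fun h0 h1 =>
    Fin.addCases (fun i => by rwa [Fin.append_left]) (fun i => by rwa [Fin.append_right])
  refine ⟨fun u v => F (interpolant 2 u v), fun u v => F (interpolant 3 u v),
    fun a u v ha ha1 hu hv => ?_⟩
  -- The standard interpolant may vanish at `a`, so it is replaced by a cubic `Q` with the same
  -- values at `0` and `1` to which additivity applies.
  obtain ⟨Q, hQ, hd, h0, h1', hQa⟩ := exists_interpolating_cubic ha ha1 u v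
  have ha1' : 1 - a ≠ 0 := sub_ne_zero.2 ha1.symm
  have e1 : F (interpolant 2 u v) = F Q :=
    h2 _ _ (monic_interpolant one_le_two u v) hQ
      ((natDegree_interpolant one_le_two u v).trans hd.symm)
      (hF (p := fun x => (interpolant 2 u v).eval x = Q.eval x)
        (by rw [eval_zero_interpolant two_ne_zero, h0]) (by rw [eval_one_interpolant, h1']))
      (hF (p := fun x => Q.eval x ≠ 0) (by rwa [h0]) (by rwa [h1']))
  have e2 : F ((X - C a) * Q) = F (X - C a) + F Q :=
    h1 _ _ (monic_X_sub_C a) hQ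
      (hF (p := fun x => (X - C a).eval x ≠ 0) (by simpa) (by simpa))
      (hF (p := fun x => Q.eval x ≠ 0) (by rwa [h0]) (by rwa [h1']))
      (isCoprime_X_sub_C (isUnit_iff_ne_zero.2 hQa))
  have e3 : F (interpolant 3 (-a * u) ((1 - a) * v)) = F ((X - C a) * Q) :=
    h2 _ _ (monic_interpolant (by norm_num) _ _) ((monic_X_sub_C a).mul hQ)
      (by rw [natDegree_interpolant (by norm_num), (monic_X_sub_C a).natDegree_mul hQ, hd,
        natDegree_X_sub_C])
      (hF (p := fun x => (interpolant 3 (-a * u) ((1 - a) * v)).eval x = ((X - C a) * Q).eval x)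
        (by simp [eval_zero_interpolant, h0]) (by simp [eval_one_interpolant, h1']))
      (hF (p := fun x => ((X - C a) * Q).eval x ≠ 0) (by simp [h0, ha, hu])
        (by simp [h1', ha1', hv]))
  have e4 : F (X - C a) = gmulField a (1 - a) := by
    have := gmulField_coe (Units.mk0 a ha) (Units.mk0 (1 - a) ha1')
    rw [Units.val_mk0, Units.val_mk0] at this
    rw [this, gmul_unitHom]
    refine h3 a _ (hF (p := fun x => a ≠ x) ha ha1) (Fin.addCases (fun i => ?_) fun i => ?_)
    · rw [Fin.append_left, Fin.append_left, eval_X, Units.val_mk0]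
    · rw [Fin.append_right, Fin.append_right, eval_sub, eval_one, eval_X, Units.val_mk0]
  beta_reduce
  rw [e3, e2, e4, e1]

/-- The Steinberg relation. -/
lemma gmul_unitHom_eq_zero {a b : kˣ} (h : (a : k) + b = 1) :
    gmul 1 1 (unitHom k (.ofMul a)) (unitHom k (.ofMul b)) = 0 := by
  obtain ⟨f, f', hf⟩ := exists_interpolation_gmulField (k := k)
  have hb : (b : k) = 1 - a := by rw [← h, add_sub_cancel_left]
  rw [← gmulField_coe, hb]
  refine steinberg_of_interpolation (fun z hz => isLogarithm_gmulField_left hz)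
    (fun z hz => isLogarithm_gmulField_right hz) (fun x y hx hy => gmulField_antisymm hx hy) hf
    a.ne_zero fun ha => b.ne_zero ?_
  rw [hb, ha, sub_self]

end

end

end CobFr
end

/-! ### The homomorphism from Milnor K-theory. -/

noncomputable section
namespace CobFr

section

open PreFr

variable (k : Type u) [Field k] [CharZero k]

attribute [local instance] gringH0

/-- The homomorphism from the Milnor K-theory ring which takes `{a}` to the class of `a`. -/
def milnorHom : MilnorRing k →+* DirectSum ℕ (H0 k) :=
  (RingQuot.liftAlgHom ℤ (s := SteinbergRel k)
    ⟨TensorAlgebra.lift ℤ ((DirectSum.of (H0 k) 1).comp (unitHom k)).toIntLinearMap, by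
      rintro _ _ ⟨a, b, h⟩
      rw [map_mul, TensorAlgebra.lift_ι_apply, TensorAlgebra.lift_ι_apply, map_zero]
      refine (DirectSum.of_mul_of (A := H0 k) _ _).trans ?_
      refine Eq.trans ?_ (map_zero (DirectSum.of (H0 k) (1 + 1)))
      exact congrArg _ (gmul_unitHom_eq_zero h)⟩ : RingQuot (SteinbergRel k) →ₐ[ℤ] _).toRingHom

variable {k}

lemma milnorHom_milnorι (a : Additive kˣ) :
    milnorHom k (milnorι k a) = DirectSum.of (H0 k) 1 (unitHom k a) :=
  (RingQuot.liftAlgHom_mkAlgHom_apply ..).trans (TensorAlgebra.lift_ι_apply ..)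

/-- The degree `m` part is generated by products of `m` elements of degree one, and these go to
homogeneous elements of degree one. -/
lemma exists_milnorHom_eq {m : ℕ} {x : MilnorRing k} (hx : x ∈ KM k m) :
    ∃ y, milnorHom k x = DirectSum.of (H0 k) m y := by
  induction hx using Submodule.pow_induction_on_right' with
  | algebraMap r =>
    refine ⟨r • gone, ?_⟩
    rw [map_zsmul, eq_intCast, map_intCast, ← zsmul_one]
    rfl
  | add x y i hx hy h h' =>
    obtain ⟨a, ha⟩ := h
    obtain ⟨b, hb⟩ := h'
    exact ⟨a + b, by rw [map_add, map_add, ha, hb]⟩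
  | mul_mem i x hx h y hy =>
    obtain ⟨a, ha⟩ := h
    obtain ⟨b, rfl⟩ := hy
    refine ⟨gmul i 1 a (unitHom k b), ?_⟩
    rw [map_mul, ha, milnorHom_milnorι]
    exact DirectSum.of_mul_of _ _

lemma milnorHom_symbol {m : ℕ} (g : Fin m → kˣ) :
    milnorHom k (symbol g : KM k m) = DirectSum.of (H0 k) m (cls k (ofMap (point g))) := by
  change milnorHom k (List.ofFn fun i => milnorι k (.ofMul (g i))).prod = _
  induction m with
  | zero =>
    rw [List.ofFn_zero, List.prod_nil, map_one, Subsingleton.elim g Fin.elim0]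
    rfl
  | succ m ih =>
    rw [List.ofFn_succ', List.concat_eq_append, List.prod_append, List.prod_singleton, map_mul, ih,
      milnorHom_milnorι]
    refine (DirectSum.of_mul_of _ _).trans (congrArg _ ?_)
    refine (gmul_cls_ofMap _ _).trans ?_
    congr 3
    exact funext <| Fin.addCases (fun j => Fin.append_left _ _ j) fun j =>
      (Fin.append_right _ _ j).trans (by rw [Subsingleton.elim j 0]; rfl)

variable (k) in
/-- The homomorphism `K^M_m(k) → H⁰(C_* ℤF^cob(pt, 𝔾_m^∧m))`. -/
def milnorHomDegree (m : ℕ) : KM k m →+ H0 k m :=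
  (DFinsupp.evalAddMonoidHom m).comp
    ((milnorHom k).toAddMonoidHom.comp (KM k m).subtype.toAddMonoidHom)

lemma milnorHomDegree_apply {m : ℕ} (x : KM k m) {y : H0 k m}
    (h : milnorHom k x = DirectSum.of (H0 k) m y) : milnorHomDegree k m x = y :=
  (congrArg (fun z : DirectSum ℕ (H0 k) => z m) h).trans (DirectSum.of_eq_same m y)

lemma milnorHom_eq_of {m : ℕ} (x : KM k m) :
    milnorHom k x = DirectSum.of (H0 k) m (milnorHomDegree k m x) := by
  obtain ⟨y, hy⟩ := exists_milnorHom_eq x.2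
  rw [milnorHomDegree_apply x hy, hy]

end

end CobFr
end

theorem mainTheorem4 (k : Type u) [Field k] [CharZero k] :
    ∃ _ : DirectSum.GRing (H0 k),
      (∀ (n N n' N' m m' : ℕ) (c : PreFr n N (Spec (.of k)) (Gm m))
        (c' : PreFr n' N' (Spec (.of k)) (Gm m')),
        GradedMonoid.GMul.mul (cls k c) (cls k c') = cls k ((c.mul c').push (Gm.append m m'))) ∧
      (GradedMonoid.GOne.one : H0 k 0) = cls k (PreFr.ofMap (point (k := k) Fin.elim0)) ∧
      ∃ σ : ∀ m : ℕ, KM k m →+ H0 k m,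
        (∀ (m : ℕ) (g : Fin m → kˣ), σ m (symbol g) = cls k (PreFr.ofMap (point g))) ∧
        ∃ Φ : (DirectSum ℕ fun m => KM k m) →+* DirectSum ℕ (H0 k),
          ∀ (m : ℕ) (x : KM k m), Φ (DirectSum.of (fun m => KM k m) m x) =
            DirectSum.of (H0 k) m (σ m x) :=
  ⟨gringH0 k, fun _ _ _ _ _ _ c c' => gmul_cls c c', rfl, milnorHomDegree k,
    fun _ g => milnorHomDegree_apply _ (milnorHom_symbol g),
    -- The `σ m` are the graded pieces of one ring homomorphism on the whole Milnor ring, so their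
    -- sum is multiplicative without further verification.
    (milnorHom k).comp (DirectSum.coeRingHom (KM k)), fun m x => by
      rw [RingHom.comp_apply, DirectSum.coeRingHom_of, milnorHom_eq_of]⟩
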